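/- Let $m\ge 2$ be an integer and let $a,b\in(0,\frac1m)$. For $i\in\{1,\dots,m\}$ put $\Omega_i=[(i-1)a,ia)\times[0,1]^2$ and $\Omega_{m+i}=[ma,1]\times J_i\times[0,1]$, where $J_i=[\frac{i-1}m,\frac im)$ for $i<m$ and $J_m=[\frac{m-1}m,1]$. These $2m$ sets partition $[0,1]^3$. The generalized heterochaos baker map $f=f_{a,b}\colon[0,1]^3\to[0,1]^3$ is given by \[ f(x,y,z)=\Big(\tfrac{x-(i-1)a}{a},\ \tfrac{y}{m}+\tfrac{i-1}{m},\ (1-mb)z\Big)\ \text{on }\Omega_i,\qquad f(x,y,z)=\Big(\tfrac{x-ma}{1-ma},\ my-i+1,\ bz+1-mb+b(i-1)\Big)\ \text{on }\Omega_{m+i}. \] Let $D=\{\alpha_1,\dots,\alpha_m,\beta_1,\dots,\beta_m\}$ and let $\Sigma_D\subset D^{\mathbb Z}$ be the two-sided Dyck shift: the sequences $\omega$ such that no finite subword $\omega_i\cdots\omega_j$ is zero in the monoid with zero that is generated by $D$ with the relations $\alpha_i\beta_j=\delta_{ij}$. For $\omega\in\Sigma_D$ let $H_0(\omega)=0$,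 and $H_{i+1}(\omega)-H_i(\omega)=1$ if $\omega_i$ is some $\alpha_l$, and $=-1$ if $\omega_i$ is some $\beta_l$. Let $A_\alpha$ (resp. $A_\beta$) be the set of $\omega\in\Sigma_D$ with $H_i(\omega)\to\pm\infty$ (resp. $\mp\infty$) as $i\to\pm\infty$. Let $B_\alpha$ be the set of $\omega\in\Sigma_D$ such that, for every $i$ for which $\omega_i$ is some $\beta_l$, there is $k\ge1$ with $H_{i-k+1}(\omega)=H_{i+1}(\omega)$; let $B_\beta$ be the set of $\omega\in\Sigma_D$ such that, for every $i$ for which $\omega_i$ is some $\alpha_l$, there is $k\ge1$ with $H_{i+k}(\omega)=H_i(\omega)$. Let $\phi_\alpha\colon B_\alpha\to\{\alpha_1,\dots,\alpha_m,\beta\}^{\mathbb Z}$ replace every $\beta_l$ by $\beta$, let $\phi_\beta\colon B_\beta\to\{\alpha,\beta_1,\dots,\beta_m\}^{\mathbb Z}$ replace every $\alpha_l$ by $\alpha$, let $\lambda_\alpha,\lambda_\beta$ be the uniform Bernoulli measures on these two full shifts on $m+1$ symbols, and put $\nu_\gamma(E)=\lambda_\gamma(\phi_\gamma(E\cap B_\gamma))$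 for $\gamma\in\{\alpha,\beta\}$. Let $X$ be the set of points of $[0,1]^3$ that have a full (two-sided) $f$-orbit in $\bigcup_{i=1}^{2m}\operatorname{int}(\Omega_i)$, let $\bar\pi\colon X\to D^{\mathbb Z}$ be the coding map that records the visited pieces ($\Omega_i$ by $\alpha_i$, $\Omega_{m+i}$ by $\beta_i$); it is injective on $\bar\pi^{-1}(A_\alpha)$ and on $\bar\pi^{-1}(A_\beta)$. Define Borel measures on $[0,1]^3$ by $\mu_\gamma(E)=\nu_\gamma(\bar\pi(E\cap\bar\pi^{-1}(A_\gamma)))$, $\gamma\in\{\alpha,\beta\}$. **Theorem C (Non-entropy approachability).** Let $a\in\big(\frac1{m(m+1)},\frac1{m+1}\big)$ and $b\in(0,\frac1m)$ with $a\ge b$. Then $\mu_\alpha$, $\mu_\beta$ are $f$-invariant ergodic probability measures of entropy $\log(m+1)$ with $\mu_\alpha(\bigcup_{i=1}^m\Omega_i)=\mu_\beta(\bigcup_{i=m+1}^{2m}\Omega_i)=\frac m{m+1}$. The measure $\mu=\frac12(\mu_\alpha+\mu_\beta)$ is an $f$-invariant, non-ergodic probability measure of entropy $h(\mu)=\log(m+1)$.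 It is approachable by ergodic measures, that is, it lies in the weak* closure of the set of $f$-invariant ergodic Borel probability measures; indeed it is the weak* limit of a sequence of $f$-invariant probability measures each of which is supported on a single periodic orbit. However, $\mu$ is not entropy approachable by ergodic measures: there is no sequence $(\mu_n)$ of $f$-invariant ergodic Borel probability measures with $\mu_n\to\mu$ in the weak* topology and $\liminf_{n\to\infty}h(\mu_n)\ge h(\mu)$. Here $h$ is the measure-theoretic (Kolmogorov–Sinai) entropy relative to $f$. -/

import Mathlib

open Set Filter Topology MeasureTheory

/-! ### Invariant measures: entropy and approachability by ergodic measures -/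

namespace Dynamics

variable {X : Type*} [MeasurableSpace X]

/-- The itinerary of length `n` with respect to a finite partition `P : X → Fin k` (the cells are
the fibres of `P`); its fibres are the cells of the join of `P, T⁻¹ P, …, T^{-(n-1)} P`. -/
def itinerary (T : X → X) {k : ℕ} (P : X → Fin k) (n : ℕ) (x : X) : Fin n → Fin k :=
  fun j => P (T^[j] x)

/-- The Shannon entropy of the join of `P, T⁻¹ P, …, T^{-(n-1)} P`. -/
noncomputable def joinEntropy (T : X → X) (μ : Measure X) {k : ℕ} (P : X → Fin k) (n : ℕ) : ℝ :=
  ∑ w : Fin n → Fin k, Real.negMulLog (μ.real (itinerary T P n ⁻¹' {w}))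

/-- The entropy `lim (1/n) H(P ∨ ⋯ ∨ T^{-(n-1)} P)` of `T` relative to a finite partition. -/
noncomputable def partitionEntropy (T : X → X) (μ : Measure X) {k : ℕ} (P : X → Fin k) : ENNReal :=
  limsup (fun n : ℕ => ENNReal.ofReal (joinEntropy T μ P n / n)) atTop

/-- The (Kolmogorov–Sinai) measure-theoretic entropy of `μ` relative to `T`: the supremum over all
finite measurable partitions. -/
noncomputable def entropy (T : X → X) (μ : Measure X) : ENNReal :=
  ⨆ (k : ℕ) (P : X → Fin k) (_ : Measurable P), partitionEntropy T μ P

/-- `μ` is the uniform distribution on the orbit of a periodic point of `T`. -/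
def IsPeriodicOrbitMeasure (T : X → X) (μ : Measure X) : Prop :=
  ∃ (p : X) (n : ℕ), 0 < n ∧ Function.IsPeriodicPt T n p ∧
    μ = (n : ENNReal)⁻¹ • ∑ k ∈ Finset.range n, Measure.dirac (T^[k] p)

variable [TopologicalSpace X] [OpensMeasurableSpace X]

/-- `μ` lies in the weak* closure of the set of ergodic `T`-invariant probability measures. -/
def Approachable (T : X → X) (μ : ProbabilityMeasure X) : Prop :=
  μ ∈ closure {ν : ProbabilityMeasure X | Ergodic T (ν : Measure X)}

/-- Some sequence of ergodic `T`-invariant probability measures converges to `μ` in the weak*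
topology, with lower limit of the entropies at least the entropy of `μ`. -/
def EntropyApproachable (T : X → X) (μ : ProbabilityMeasure X) : Prop :=
  ∃ ν : ℕ → ProbabilityMeasure X, (∀ n, Ergodic T (ν n : Measure X)) ∧
    Tendsto ν atTop (𝓝 μ) ∧
    entropy T (μ : Measure X) ≤ liminf (fun n => entropy T (ν n : Measure X)) atTop

end Dynamics

/-! ### The Dyck shift and its two ergodic measures of maximal entropy -/

namespace Dyck

/-- The `2m` brackets: `Sum.inl i` is the left bracket `α_{i+1}`, `Sum.inr i` is the right bracket
`β_{i+1}`. -/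
abbrev Bracket (m : ℕ) : Type := Fin m ⊕ Fin m

/-- The defining relations of the Dyck monoid with zero. The generators are the brackets
(`some γ`) and the zero (`none`). -/
inductive Rel (m : ℕ) : FreeMonoid (Option (Bracket m)) → FreeMonoid (Option (Bracket m)) → Prop
  | same (i : Fin m) :
      Rel m (FreeMonoid.of (some (Sum.inl i)) * FreeMonoid.of (some (Sum.inr i))) 1
  | diff (i j : Fin m) (h : i ≠ j) :
      Rel m (FreeMonoid.of (some (Sum.inl i)) * FreeMonoid.of (some (Sum.inr j)))
        (FreeMonoid.of none)
  | zero_left (γ : Option (Bracket m)) :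
      Rel m (FreeMonoid.of none * FreeMonoid.of γ) (FreeMonoid.of none)
  | zero_right (γ : Option (Bracket m)) :
      Rel m (FreeMonoid.of γ * FreeMonoid.of none) (FreeMonoid.of none)

/-- The value of a word of brackets in the Dyck monoid. -/
def red {m : ℕ} (w : List (Bracket m)) : PresentedMonoid (Rel m) :=
  (w.map fun γ => PresentedMonoid.of (Rel m) (some γ)).prod

/-- The zero of the Dyck monoid. -/
def zero (m : ℕ) : PresentedMonoid (Rel m) := PresentedMonoid.of (Rel m) none

/-- The two-sided Dyck shift: the value of every finite subword is nonzero. -/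
def shift (m : ℕ) : Set (ℤ → Bracket m) :=
  {ω | ∀ (i : ℤ) (n : ℕ), red (List.ofFn fun k : Fin n => ω (i + (k : ℕ))) ≠ zero m}

/-- `1` for a left bracket, `-1` for a right bracket. -/
def sign {m : ℕ} : Bracket m → ℤ
  | Sum.inl _ => 1
  | Sum.inr _ => -1

/-- The number of left brackets minus the number of right brackets in the positions
`0, …, i - 1` for `i ≥ 0`, and the negative of this number for the positions `i, …, -1` for
`i ≤ 0`. -/
noncomputable def height {m : ℕ} (ω : ℤ → Bracket m) (i : ℤ) : ℤ :=
  ∑ j ∈ Finset.Ico 0 i, sign (ω j) - ∑ j ∈ Finset.Ico i 0, sign (ω j)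

/-- Sequences of the Dyck shift whose height goes from `-∞` to `∞`. -/
def setAα (m : ℕ) : Set (ℤ → Bracket m) :=
  {ω | ω ∈ shift m ∧ Tendsto (height ω) atTop atTop ∧ Tendsto (height ω) atBot atBot}

/-- Sequences of the Dyck shift whose height goes from `∞` to `-∞`. -/
def setAβ (m : ℕ) : Set (ℤ → Bracket m) :=
  {ω | ω ∈ shift m ∧ Tendsto (height ω) atTop atBot ∧ Tendsto (height ω) atBot atTop}

/-- Sequences of the Dyck shift in which every right bracket is closed. -/
def setBα (m : ℕ) : Set (ℤ → Bracket m) :=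
  {ω | ω ∈ shift m ∧ ∀ i : ℤ, (∃ l, ω i = Sum.inl l) ∨
    ((∃ l, ω i = Sum.inr l) ∧ ∃ k : ℕ, 1 ≤ k ∧ height ω (i - k + 1) = height ω (i + 1))}

/-- Sequences of the Dyck shift in which every left bracket is closed. -/
def setBβ (m : ℕ) : Set (ℤ → Bracket m) :=
  {ω | ω ∈ shift m ∧ ∀ i : ℤ, (∃ l, ω i = Sum.inr l) ∨
    ((∃ l, ω i = Sum.inl l) ∧ ∃ k : ℕ, 1 ≤ k ∧ height ω (i + k) = height ω i)}

/-- Replace all right brackets by one symbol `β = Sum.inr ()`. -/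
def forgetRight {m : ℕ} (ω : ℤ → Bracket m) : ℤ → Fin m ⊕ Unit :=
  fun i => Sum.map id (fun _ => ()) (ω i)

/-- Replace all left brackets by one symbol `α = Sum.inl ()`. -/
def forgetLeft {m : ℕ} (ω : ℤ → Bracket m) : ℤ → Unit ⊕ Fin m :=
  fun i => Sum.map (fun _ => ()) id (ω i)

/-- The uniform Bernoulli measure on the full two-sided shift over a finite alphabet. -/
noncomputable def bernoulli (S : Type) [Fintype S] [Nonempty S] [MeasurableSpace S] :
    Measure (ℤ → S) :=
  Measure.infinitePi fun _ : ℤ => (PMF.uniformOfFintype S).toMeasure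

/-- The measure `E ↦ λ_α (φ_α (E ∩ B_α))`, where `λ_α` is the uniform Bernoulli measure on the
`m + 1` symbols `α_1, …, α_m, β` and `φ_α` is `forgetRight`. -/
noncomputable def nuα (m : ℕ) : Measure (ℤ → Bracket m) :=
  ((bernoulli (Fin m ⊕ Unit)).comap (fun ω : setBα m => forgetRight ω.1)).map Subtype.val

/-- The measure `E ↦ λ_β (φ_β (E ∩ B_β))`, where `λ_β` is the uniform Bernoulli measure on the
`m + 1` symbols `α, β_1, …, β_m` and `φ_β` is `forgetLeft`. -/
noncomputable def nuβ (m : ℕ) : Measure (ℤ → Bracket m) :=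
  ((bernoulli (Unit ⊕ Fin m)).comap (fun ω : setBβ m => forgetLeft ω.1)).map Subtype.val

end Dyck

/-! ### The generalized heterochaos baker map on the cube -/

namespace Baker

open Dyck (Bracket)

/-- The cube `[0,1]³`. -/
def cube : Set (ℝ × ℝ × ℝ) := Icc 0 1 ×ˢ Icc 0 1 ×ˢ Icc 0 1

/-- The pieces: `Ω a (Sum.inl i)` and `Ω a (Sum.inr i)` are the pieces with the numbers `i + 1` and
`m + i + 1`. -/
def Ω {m : ℕ} (a : ℝ) : Bracket m → Set (ℝ × ℝ × ℝ)
  | Sum.inl i => {p | p ∈ cube ∧ (i : ℕ) * a ≤ p.1 ∧ p.1 < ((i : ℕ) + 1) * a}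
  | Sum.inr i => {p | p ∈ cube ∧ m * a ≤ p.1 ∧ ((i : ℕ) : ℝ) / m ≤ p.2.1 ∧
      (p.2.1 < ((i : ℕ) + 1) / m ∨ ((i : ℕ) + 1 = m ∧ p.2.1 = 1))}

/-- The affine map that defines the baker map on the piece `Ω a γ`. -/
noncomputable def branch {m : ℕ} (a b : ℝ) : Bracket m → ℝ × ℝ × ℝ → ℝ × ℝ × ℝ
  | Sum.inl i, (x, y, z) => ((x - (i : ℕ) * a) / a, y / m + (i : ℕ) / m, (1 - m * b) * z)
  | Sum.inr i, (x, y, z) =>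
      ((x - m * a) / (1 - m * a), m * y - (i : ℕ), b * z + 1 - m * b + b * (i : ℕ))

lemma pos_of_mem {m : ℕ} {a : ℝ} (ha : a ∈ Ioo (0 : ℝ) (1 / m)) : (0 : ℝ) < m ∧ m * a < 1 := by
  have hm : (0 : ℝ) < m := by
    have h := ha.1.trans ha.2
    rwa [one_div, inv_pos] at h
  exact ⟨hm, by have := (lt_div_iff₀ hm).1 ha.2; linarith⟩

/-- The pieces cover the cube. -/
lemma exists_mem_Ω {m : ℕ} {a : ℝ} (ha : a ∈ Ioo (0 : ℝ) (1 / m)) {p : ℝ × ℝ × ℝ} (hp : p ∈ cube) :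
    ∃ γ : Bracket m, p ∈ Ω a γ := by
  obtain ⟨hm, hma⟩ := pos_of_mem ha
  have hp' := hp
  obtain ⟨⟨hx0, hx1⟩, ⟨hy0, hy1⟩, -⟩ := hp'
  have ha0 := ha.1
  by_cases hx : p.1 < m * a
  · have hd : 0 ≤ p.1 / a := div_nonneg hx0 ha0.le
    have h1 := Nat.floor_le hd
    have h2 := Nat.lt_floor_add_one (p.1 / a)
    have h3 : ⌊p.1 / a⌋₊ < m := (Nat.floor_lt hd).2 ((div_lt_iff₀ ha0).2 hx)
    exact ⟨Sum.inl ⟨⌊p.1 / a⌋₊, h3⟩, hp, (le_div_iff₀ ha0).1 h1, (div_lt_iff₀ ha0).1 h2⟩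
  · push Not at hx
    by_cases hy : p.2.1 < 1
    · have hd : 0 ≤ p.2.1 * m := mul_nonneg hy0 hm.le
      have h1 := Nat.floor_le hd
      have h2 := Nat.lt_floor_add_one (p.2.1 * m)
      have h3 : ⌊p.2.1 * m⌋₊ < m := (Nat.floor_lt hd).2 (by nlinarith)
      exact ⟨Sum.inr ⟨⌊p.2.1 * m⌋₊, h3⟩, hp, hx, (div_le_iff₀ hm).2 h1,
        Or.inl ((lt_div_iff₀ hm).2 h2)⟩
    · have hy' : p.2.1 = 1 := le_antisymm hy1 (not_lt.1 hy)
      have hm' : 0 < m := by exact_mod_cast hm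
      refine ⟨Sum.inr ⟨m - 1, by omega⟩, hp, hx, ?_, Or.inr ⟨?_, hy'⟩⟩
      · rw [hy', div_le_one hm]
        exact_mod_cast Nat.sub_le m 1
      · simp only
        omega

/-- The pieces are pairwise disjoint. -/
lemma eq_of_mem_Ω {m : ℕ} {a : ℝ} (ha : a ∈ Ioo (0 : ℝ) (1 / m)) {p : ℝ × ℝ × ℝ}
    {γ δ : Bracket m} (h : p ∈ Ω a γ) (h' : p ∈ Ω a δ) : γ = δ := by
  obtain ⟨hm, hma⟩ := pos_of_mem ha
  have ha0 := ha.1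
  have key : ∀ (i j : Fin m), ((i : ℕ) : ℝ) < (j : ℕ) + 1 → ((j : ℕ) : ℝ) < (i : ℕ) + 1 → i = j := by
    intro i j h1 h2
    have h1' : (i : ℕ) < (j : ℕ) + 1 := by exact_mod_cast h1
    have h2' : (j : ℕ) < (i : ℕ) + 1 := by exact_mod_cast h2
    exact Fin.ext (by omega)
  have hle : ∀ i : Fin m, ((i : ℕ) : ℝ) + 1 ≤ m := fun i => by exact_mod_cast i.2
  rcases γ with i | i <;> rcases δ with j | j
  · obtain ⟨-, h1, h2⟩ := h
    obtain ⟨-, h3, h4⟩ := h'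
    exact congrArg Sum.inl (key i j (lt_of_mul_lt_mul_right (h1.trans_lt h4) ha0.le)
      (lt_of_mul_lt_mul_right (h3.trans_lt h2) ha0.le))
  · obtain ⟨-, -, h2⟩ := h
    obtain ⟨-, h3, -⟩ := h'
    exact absurd (h3.trans_lt h2) (not_lt.2 (mul_le_mul_of_nonneg_right (hle i) ha0.le))
  · obtain ⟨-, -, h2⟩ := h'
    obtain ⟨-, h3, -⟩ := h
    exact absurd (h3.trans_lt h2) (not_lt.2 (mul_le_mul_of_nonneg_right (hle j) ha0.le))
  · obtain ⟨-, -, h1, h2⟩ := h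
    obtain ⟨-, -, h3, h4⟩ := h'
    rw [div_le_iff₀ hm] at h1 h3
    rw [lt_div_iff₀ hm] at h2 h4
    have hi := hle i
    have hj := hle j
    refine congrArg Sum.inr (key i j ?_ ?_)
    · rcases h4 with h4 | ⟨h4, h5⟩
      · exact h1.trans_lt h4
      · have : ((j : ℕ) : ℝ) + 1 = m := by exact_mod_cast h4
        linarith
    · rcases h2 with h2 | ⟨h2, h5⟩
      · exact h3.trans_lt h2
      · have : ((i : ℕ) : ℝ) + 1 = m := by exact_mod_cast h2
        linarith

lemma branch_mem_cube {m : ℕ} {a b : ℝ} (ha : a ∈ Ioo (0 : ℝ) (1 / m)) (hb : b ∈ Ioo (0 : ℝ) (1 / m))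
    {γ : Bracket m} {p : ℝ × ℝ × ℝ} (h : p ∈ Ω a γ) : branch a b γ p ∈ cube := by
  obtain ⟨hm, hma⟩ := pos_of_mem ha
  obtain ⟨-, hmb⟩ := pos_of_mem hb
  have ha0 := ha.1
  have hb0 := hb.1
  obtain ⟨x, y, z⟩ := p
  rcases γ with i | i
  · obtain ⟨⟨⟨hx0, hx1⟩, ⟨hy0, hy1⟩, hz0, hz1⟩, h1, h2⟩ := h
    simp only at hx0 hx1 hy0 hy1 hz0 hz1 h1 h2
    have hi : ((i : ℕ) : ℝ) + 1 ≤ m := by exact_mod_cast i.2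
    have hi0 : (0 : ℝ) ≤ ((i : ℕ) : ℝ) := Nat.cast_nonneg _
    refine ⟨⟨div_nonneg (by linarith) ha0.le, (div_le_one ha0).2 (by linarith)⟩, ⟨?_, ?_⟩, ?_, ?_⟩
    · exact add_nonneg (div_nonneg hy0 hm.le) (div_nonneg hi0 hm.le)
    · simp only [branch]
      rw [← add_div, div_le_one hm]
      linarith
    · exact mul_nonneg (by linarith) hz0
    · exact mul_le_one₀ (by nlinarith) hz0 hz1
  · obtain ⟨⟨⟨hx0, hx1⟩, ⟨hy0, hy1⟩, hz0, hz1⟩, h1, h2, h3⟩ := h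
    simp only at hx0 hx1 hy0 hy1 hz0 hz1 h1 h2 h3
    have hi : ((i : ℕ) : ℝ) + 1 ≤ m := by exact_mod_cast i.2
    have hi0 : (0 : ℝ) ≤ ((i : ℕ) : ℝ) := Nat.cast_nonneg _
    rw [div_le_iff₀ hm] at h2
    rw [lt_div_iff₀ hm] at h3
    refine ⟨⟨div_nonneg (by linarith) (by linarith), (div_le_one (by linarith)).2 (by linarith)⟩,
      ⟨?_, ?_⟩, ?_, ?_⟩
    · simp only [branch]
      linarith
    · simp only [branch]
      rcases h3 with h3 | ⟨h3, rfl⟩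
      · linarith
      · have : ((i : ℕ) : ℝ) + 1 = m := by exact_mod_cast h3
        linarith
    · simp only [branch]
      nlinarith [mul_nonneg hb0.le hz0, mul_nonneg hb0.le hi0]
    · simp only [branch]
      nlinarith [mul_nonneg hb0.le (sub_nonneg.2 hz1), mul_nonneg hb0.le (sub_nonneg.2 hi)]

/-- The generalized heterochaos baker map `f_{a,b}` of the cube: it is `branch a b γ` on each
piece `Ω a γ`. -/
noncomputable def map {m : ℕ} {a b : ℝ} (ha : a ∈ Ioo (0 : ℝ) (1 / m)) (hb : b ∈ Ioo (0 : ℝ) (1 / m))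
    (p : cube) : cube :=
  ⟨branch a b (exists_mem_Ω ha p.2).choose p, branch_mem_cube ha hb (exists_mem_Ω ha p.2).choose_spec⟩

lemma map_of_mem {m : ℕ} {a b : ℝ} (ha : a ∈ Ioo (0 : ℝ) (1 / m)) (hb : b ∈ Ioo (0 : ℝ) (1 / m))
    (p : cube) (γ : Bracket m) (h : (p : ℝ × ℝ × ℝ) ∈ Ω a γ) :
    (map ha hb p : ℝ × ℝ × ℝ) = branch a b γ p := by
  rw [eq_of_mem_Ω ha h (exists_mem_Ω ha p.2).choose_spec]
  rfl

variable {m : ℕ} {a b : ℝ} (ha : a ∈ Ioo (0 : ℝ) (1 / m)) (hb : b ∈ Ioo (0 : ℝ) (1 / m))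

/-- `p` has a two-sided orbit through the interiors of the pieces, with itinerary `ω`. (The map is
injective on the union of these interiors, so the orbit and `ω` are unique.) -/
def HasCode (p : cube) (ω : ℤ → Bracket m) : Prop :=
  ∃ q : ℤ → cube, q 0 = p ∧ ∀ n : ℤ,
    (q n : ℝ × ℝ × ℝ) ∈ interior (Ω a (ω n)) ∧ map ha hb (q n) = q (n + 1)

/-- The set of points whose full orbit stays in the interiors of the pieces. -/
def codable : Set cube := {p | ∃ ω, HasCode ha hb p ω}

/-- The coding map. -/
noncomputable def code (p : codable ha hb) : ℤ → Bracket m := p.2.choose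

/-- The transfer of a measure `ν` on bracket sequences to the cube by the coding map `π`, over a
set `A` on whose preimage `π` is injective: the measure `E ↦ ν (π (E ∩ π⁻¹ A))`. -/
noncomputable def transfer (A : Set (ℤ → Bracket m)) (ν : Measure (ℤ → Bracket m)) : Measure cube :=
  (ν.comap (fun p : {p : codable ha hb // code ha hb p ∈ A} => code ha hb p.1)).map
    (fun p => (p.1 : cube))

/-- The ergodic measure `μ_α` of entropy `log (m + 1)`. -/
noncomputable def muα : Measure cube := transfer ha hb (Dyck.setAα m) (Dyck.nuα m)

/-- The ergodic measure `μ_β` of entropy `log (m + 1)`. -/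
noncomputable def muβ : Measure cube := transfer ha hb (Dyck.setAβ m) (Dyck.nuβ m)

end Baker

/-!
The baker map is a pushdown automaton. Write the coordinate `y` to the base `m`: on the pieces of
`α_i` the map pushes the digit `i`, on the pieces of `β_i` it pops this digit (`Baker.IsStackPath`),
whereas `x` and `z` belong to a one-sided expanding and a one-sided contracting affine system, and
are functions of the future and of the past of the itinerary. So an orbit is the same thing as an
itinerary with a compatible sequence of stacks (`Baker.exists_orbit`). If the height tends to `-∞`
in the past, then the stack is formed by the left brackets that are not yet matched, and is
determined by the itinerary (`Dyck.yCoord_eq_of_isStackPath`).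

**The two measures.** A sequence over the `m + 1` symbols `α_1, …, α_m, β` is filled in by giving to
each right bracket the subscript of its partner (`Dyck.fill`). The mean height of a Bernoulli
sequence grows, so that almost surely all right brackets have partners, and `ν_α` is the image of
the Bernoulli measure under `fill` (`Dyck.nuα_eq`). To see that almost every filled sequence is
realized by a point one has to exclude the stacks of the values `0` and `1`. That one of these values
occurs at some time is an invariant event, so it has probability `0` or `1`; but the two events have
the same probability because of the symmetry `i ↦ m - 1 - i` of the digits, and they exclude each
other (`Dyck.ae_regular_fill`). Since a point has at most one itinerary, `μ_α` is an image of
the Bernoulli measure (`Baker.muα_eq`), and `μ_β` is obtained by time reversal, which exchanges left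
and right brackets (`Dyck.rev`). Ergodicity, the masses of the pieces and the lower bound
`log (m + 1)` for the entropies follow (`Baker.le_joinEntropy_muα`).

**The upper bound for entropies.** Let `ν` be ergodic. The map preserves the order of each of the
three coordinates on each piece. So, given the itinerary, the positions in a fine grid along an
orbit segment of length `n` are determined by the sums of the three rounded coordinates, which take
`O(n)` values only: they contribute `O(log n)` to the entropy (`Baker.shannon_cell_le`). The
subscripts of the right brackets are determined by the other letters and by those digits of the
initial stack that are ever exposed; if on average there are at least as many left as right
brackets, then the number of these digits is `o(n)` in mean
(`Dynamics.tendsto_integral_maxDeviation`), and the entropy is bounded by that of the process with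
the subscripts of the right brackets forgotten (`Baker.entropy_le_of_nonneg`). In the other case the
orbit segments are read backwards, and the subscripts of the left brackets are forgotten
(`Baker.entropy_le_of_nonpos`). This process has `m + 1` states, whence the bound `log (m + 1)`;
moreover, its entropy is at most `log 2 + t * log m` where `t ≥ 1 / 2` is the larger one of the
masses of the left and of the right pieces (`Baker.entropy_le_of_leftPart`).

**The mean.** It gives the left pieces the mass `1 / 2`, unlike `μ_α`, which is absolutely continuous
with respect to it: so it is not ergodic. Ergodic measures near it have entropies hardly above
`log 2 + (log m) / 2 = log (2 √m) < log (m + 1)` (`Baker.not_entropyApproachable`). On the other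
hand, for a word `u` of a typical sequence the palindromic word `u ū`, where `ū` is the reversal of
`u`, pops everything that it has pushed, so it is the itinerary of a periodic orbit. This orbit
follows a typical orbit of `μ_α` and then a typical orbit of `μ_β` for the same time
(`Baker.exists_periodic_shadow`), and hence equidistributes with respect to the mean
(`Baker.exists_tendsto_periodic`).
-/

/-! ### Shannon entropy of finite-valued maps -/

namespace Shannon

open Real (negMulLog)

variable {Ω A B : Type*} [MeasurableSpace Ω]

/-- The Shannon entropy of a map `X` with finitely many values. -/
noncomputable def shannon (μ : Measure Ω) [Fintype A] (X : Ω → A) : ℝ :=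
  ∑ a, negMulLog (μ.real (X ⁻¹' {a}))

/-- Gibbs' inequality: the entropy is at most the cross entropy. -/
lemma sum_negMulLog_le [Fintype A] {p q : A → ℝ} (hp : ∀ a, 0 ≤ p a) (hq : ∀ a, 0 ≤ q a)
    (hpq : ∀ a, q a = 0 → p a = 0) (hs : ∑ a, q a ≤ ∑ a, p a) :
    ∑ a, negMulLog (p a) ≤ ∑ a, p a * (-Real.log (q a)) := by
  have key : ∀ a, negMulLog (p a) ≤ p a * (-Real.log (q a)) + (q a - p a) := by
    intro a
    rcases (hp a).eq_or_lt with h | h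
    · rw [← h]; simpa using hq a
    · have hqa : 0 < q a := (hq a).lt_of_ne fun h0 => h.ne' (hpq a h0.symm)
      have h1 := Real.log_le_sub_one_of_pos (div_pos hqa h)
      rw [Real.log_div hqa.ne' h.ne'] at h1
      have h2 := mul_le_mul_of_nonneg_left h1 h.le
      have h3 : p a * (q a / p a - 1) = q a - p a := by field_simp
      rw [h3] at h2
      simp only [negMulLog]
      linarith
  calc ∑ a, negMulLog (p a) ≤ ∑ a, (p a * (-Real.log (q a)) + (q a - p a)) :=
        Finset.sum_le_sum fun a _ => key a
    _ = ∑ a, p a * (-Real.log (q a)) + (∑ a, q a - ∑ a, p a) := by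
        rw [Finset.sum_add_distrib, Finset.sum_sub_distrib]
    _ ≤ _ := by linarith

variable {μ : Measure Ω}

lemma shannon_congr [Fintype A] {X Y : Ω → A} (h : X =ᵐ[μ] Y) : shannon μ X = shannon μ Y := by
  refine Finset.sum_congr rfl fun a _ => ?_
  congr 1
  refine measureReal_congr ?_
  filter_upwards [h] with ω hω
  change (X ω = a) = (Y ω = a)
  rw [hω]

lemma measureReal_fiber_le [IsFiniteMeasure μ] (X : Ω → A) (g : A → B) (a : A) :
    μ.real (X ⁻¹' {a}) ≤ μ.real ((g ∘ X) ⁻¹' {g a}) :=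
  measureReal_mono fun ω hω => by
    have : X ω = a := hω
    simp [this]

variable [MeasurableSpace A] [MeasurableSingletonClass A]

lemma sum_measureReal_fiber_mul [IsFiniteMeasure μ] [Fintype A] [Fintype B] {X : Ω → A}
    (hX : Measurable X) (g : A → B) (F : B → ℝ) :
    ∑ a, μ.real (X ⁻¹' {a}) * F (g a) = ∑ b, μ.real ((g ∘ X) ⁻¹' {b}) * F b := by
  classical
  have h : ∀ b, μ.real ((g ∘ X) ⁻¹' {b}) = ∑ a with g a = b, μ.real (X ⁻¹' {a}) := by
    intro b
    rw [sum_measureReal_preimage_singleton _ fun a _ => hX (measurableSet_singleton a)]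
    congr 1
    ext ω
    simp
  simp_rw [h, Finset.sum_mul]
  rw [← Finset.sum_fiberwise (Finset.univ : Finset A) g]
  refine Finset.sum_congr rfl fun b _ => Finset.sum_congr rfl fun a ha => ?_
  rw [(Finset.mem_filter.1 ha).2]

lemma sum_measureReal_fiber [IsProbabilityMeasure μ] [Fintype A] {X : Ω → A} (hX : Measurable X) :
    ∑ a, μ.real (X ⁻¹' {a}) = 1 := by
  rw [sum_measureReal_preimage_singleton _ fun a _ => hX (measurableSet_singleton a)]
  simp

lemma shannon_comp_le [IsProbabilityMeasure μ] [Fintype A] [Fintype B] {X : Ω → A}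
    (hX : Measurable X) (g : A → B) : shannon μ (g ∘ X) ≤ shannon μ X := by
  have h1 : shannon μ (g ∘ X)
      = ∑ a, μ.real (X ⁻¹' {a}) * (-Real.log (μ.real ((g ∘ X) ⁻¹' {g a}))) := by
    rw [sum_measureReal_fiber_mul hX g fun b => -Real.log (μ.real ((g ∘ X) ⁻¹' {b}))]
    exact Finset.sum_congr rfl fun b _ => by simp only [negMulLog]; ring
  rw [h1]
  refine Finset.sum_le_sum fun a _ => ?_
  rcases (measureReal_nonneg (μ := μ) (s := X ⁻¹' {a})).eq_or_lt with h | h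
  · simp [← h]
  · have := Real.log_le_log h (measureReal_fiber_le X g a)
    simp only [negMulLog]
    nlinarith

/-- If `Z` determines `X` outside a null set then the entropy of `X` is at most that of `Z`. -/
lemma shannon_le_of_determined [IsProbabilityMeasure μ] [Fintype A] [Fintype B] {X : Ω → B}
    {Z : Ω → A} (hZ : Measurable Z) {G : Set Ω} (hG : ∀ᵐ ω ∂μ, ω ∈ G)
    (h : ∀ ω ∈ G, ∀ ω' ∈ G, Z ω = Z ω' → X ω = X ω') : shannon μ X ≤ shannon μ Z := by
  classical
  obtain ⟨ω₀, -⟩ := hG.exists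
  let g : A → B := fun b => if hb : ∃ ω ∈ G, Z ω = b then X hb.choose else X ω₀
  have hg : X =ᵐ[μ] g ∘ Z := by
    filter_upwards [hG] with ω hω
    have hb : ∃ ω' ∈ G, Z ω' = Z ω := ⟨ω, hω, rfl⟩
    simp only [g, Function.comp, dif_pos hb]
    exact h _ hω _ hb.choose_spec.1 hb.choose_spec.2.symm
  rw [shannon_congr hg]
  exact shannon_comp_le hZ g

variable [MeasurableSpace B] [MeasurableSingletonClass B]

/-- The entropy is at most the cross entropy relative to any subprobability vector. -/
lemma shannon_le_cross [IsProbabilityMeasure μ] [Fintype A] {X : Ω → A} (hX : Measurable X)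
    {q : A → ℝ} (hq : ∀ a, 0 ≤ q a) (hpq : ∀ a, q a = 0 → μ.real (X ⁻¹' {a}) = 0)
    (hs : ∑ a, q a ≤ 1) : shannon μ X ≤ ∑ a, μ.real (X ⁻¹' {a}) * (-Real.log (q a)) :=
  sum_negMulLog_le (fun _ => measureReal_nonneg) hq hpq (by rwa [sum_measureReal_fiber hX])

lemma shannon_le_log_card [IsProbabilityMeasure μ] [Fintype A] {X : Ω → A} (hX : Measurable X) :
    shannon μ X ≤ Real.log (Fintype.card A) := by
  have hne : Nonempty Ω := by
    by_contra h
    rw [not_nonempty_iff] at h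
    exact IsProbabilityMeasure.ne_zero μ (Measure.eq_zero_of_isEmpty μ)
  have hA : Nonempty A := hne.map X
  have hc : (0 : ℝ) < Fintype.card A := by exact_mod_cast Fintype.card_pos
  refine (shannon_le_cross hX (q := fun _ => (Fintype.card A : ℝ)⁻¹) (fun _ => by positivity)
    (fun a h => absurd h (by positivity)) (by simp)).trans_eq ?_
  rw [← Finset.sum_mul, sum_measureReal_fiber hX, Real.log_inv]
  simp

lemma shannon_pair_le [IsProbabilityMeasure μ] [Fintype A] [Fintype B] {X : Ω → A} {Y : Ω → B}
    (hX : Measurable X) (hY : Measurable Y) :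
    shannon μ (fun ω => (X ω, Y ω)) ≤ shannon μ X + shannon μ Y := by
  have hXY : Measurable fun ω => (X ω, Y ω) := hX.prodMk hY
  set P : A × B → ℝ := fun c => μ.real ((fun ω => (X ω, Y ω)) ⁻¹' {c})
  have hPX : ∀ c, P c ≤ μ.real (X ⁻¹' {c.1}) := fun c =>
    measureReal_fiber_le (fun ω => (X ω, Y ω)) Prod.fst c
  have hPY : ∀ c, P c ≤ μ.real (Y ⁻¹' {c.2}) := fun c =>
    measureReal_fiber_le (fun ω => (X ω, Y ω)) Prod.snd c
  refine (shannon_le_cross hXY (q := fun c => μ.real (X ⁻¹' {c.1}) * μ.real (Y ⁻¹' {c.2}))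
    (fun c => by positivity) (fun c h => ?_) ?_).trans_eq ?_
  · rcases mul_eq_zero.1 h with h | h
    · exact le_antisymm ((hPX c).trans_eq h) measureReal_nonneg
    · exact le_antisymm ((hPY c).trans_eq h) measureReal_nonneg
  · rw [Fintype.sum_prod_type]
    simp_rw [← Finset.mul_sum, sum_measureReal_fiber hY, mul_one]
    rw [sum_measureReal_fiber hX]
  · have h1 := sum_measureReal_fiber_mul (μ := μ) hXY Prod.fst
      fun a => -Real.log (μ.real (X ⁻¹' {a}))
    have h2 := sum_measureReal_fiber_mul (μ := μ) hXY Prod.snd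
      fun b => -Real.log (μ.real (Y ⁻¹' {b}))
    have e1 : (Prod.fst ∘ fun ω => (X ω, Y ω)) = X := rfl
    have e2 : (Prod.snd ∘ fun ω => (X ω, Y ω)) = Y := rfl
    rw [e1] at h1
    rw [e2] at h2
    have hS : shannon μ X + shannon μ Y
        = ∑ c : A × B, P c * (-Real.log (μ.real (X ⁻¹' {c.1})) + -Real.log (μ.real (Y ⁻¹' {c.2}))) := by
      simp_rw [mul_add]
      rw [Finset.sum_add_distrib, h1, h2]
      simp only [shannon, negMulLog, neg_mul, mul_neg]
    rw [hS]
    refine Finset.sum_congr rfl fun c _ => ?_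
    rcases (measureReal_nonneg (μ := μ) (s := (fun ω => (X ω, Y ω)) ⁻¹' {c})).eq_or_lt with h | h
    · simp only [P, ← h, zero_mul]
    · rw [Real.log_mul (h.trans_le (hPX c)).ne' (h.trans_le (hPY c)).ne']
      ring

/-- Adjoining to `Y` a number `U < N (Y)` raises the entropy by at most the mean of `log (N (Y))`. -/
lemma shannon_pair_le_of_lt [IsProbabilityMeasure μ] [Fintype A] {Y : Ω → A} (hY : Measurable Y)
    {K : ℕ} {U : Ω → Fin K} (hU : Measurable U) {N : A → ℕ} (hN : ∀ a, 0 < N a)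
    (h : ∀ᵐ ω ∂μ, (U ω : ℕ) < N (Y ω)) :
    shannon μ (fun ω => (Y ω, U ω)) ≤ shannon μ Y + ∑ a, μ.real (Y ⁻¹' {a}) * Real.log (N a) := by
  have hYU : Measurable fun ω => (Y ω, U ω) := hY.prodMk hU
  set P : A × Fin K → ℝ := fun c => μ.real ((fun ω => (Y ω, U ω)) ⁻¹' {c})
  have hPY : ∀ c, P c ≤ μ.real (Y ⁻¹' {c.1}) := fun c =>
    measureReal_fiber_le (fun ω => (Y ω, U ω)) Prod.fst c
  have hP0 : ∀ c : A × Fin K, ¬ (c.2 : ℕ) < N c.1 → P c = 0 := by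
    intro c hc
    have : μ ((fun ω => (Y ω, U ω)) ⁻¹' {c}) = 0 := by
      refine measure_mono_null (fun ω hω => ?_) (ae_iff.1 h)
      have hω' : (Y ω, U ω) = c := hω
      rw [← hω'] at hc
      exact hc
    simp [P, measureReal_def, this]
  refine (shannon_le_cross hYU
    (q := fun c => if (c.2 : ℕ) < N c.1 then μ.real (Y ⁻¹' {c.1}) / N c.1 else 0)
    (fun c => by split_ifs <;> positivity) (fun c hc => ?_) ?_).trans_eq ?_
  · by_cases hlt : (c.2 : ℕ) < N c.1
    · rw [if_pos hlt] at hc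
      have hN' : (N c.1 : ℝ) ≠ 0 := by exact_mod_cast (hN c.1).ne'
      have := (div_eq_zero_iff.1 hc).resolve_right hN'
      exact le_antisymm ((hPY c).trans_eq this) measureReal_nonneg
    · exact hP0 c hlt
  · rw [Fintype.sum_prod_type, ← sum_measureReal_fiber (μ := μ) hY]
    refine Finset.sum_le_sum fun a _ => ?_
    have hN' : (0 : ℝ) < N a := by exact_mod_cast hN a
    simp only
    rw [← Finset.sum_filter, Finset.sum_const, nsmul_eq_mul]
    have hcard : (Finset.univ.filter fun u : Fin K => (u : ℕ) < N a).card ≤ N a := by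
      rw [← Finset.card_map Fin.valEmbedding]
      refine (Finset.card_le_card (t := Finset.range (N a)) fun u hu => ?_).trans_eq
        (Finset.card_range _)
      obtain ⟨v, hv, rfl⟩ := Finset.mem_map.1 hu
      exact Finset.mem_range.2 (Finset.mem_filter.1 hv).2
    calc _ ≤ (N a : ℝ) * (μ.real (Y ⁻¹' {a}) / N a) := by gcongr
      _ = _ := by field_simp
  · have h1 := sum_measureReal_fiber_mul (μ := μ) hYU Prod.fst
      fun a => -Real.log (μ.real (Y ⁻¹' {a})) + Real.log (N a)
    have e1 : (Prod.fst ∘ fun ω => (Y ω, U ω)) = Y := rfl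
    rw [e1] at h1
    have h2 : shannon μ Y + ∑ a, μ.real (Y ⁻¹' {a}) * Real.log (N a)
        = ∑ a, μ.real (Y ⁻¹' {a}) * (-Real.log (μ.real (Y ⁻¹' {a})) + Real.log (N a)) := by
      simp only [shannon, negMulLog, mul_add, Finset.sum_add_distrib, neg_mul, mul_neg]
    rw [h2, ← h1]
    refine Finset.sum_congr rfl fun c _ => ?_
    by_cases hlt : (c.2 : ℕ) < N c.1
    · rcases (measureReal_nonneg (μ := μ) (s := (fun ω => (Y ω, U ω)) ⁻¹' {c})).eq_or_lt
        with h | h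
      · simp only [← h, zero_mul]
      · have hN' : (N c.1 : ℝ) ≠ 0 := by exact_mod_cast (hN c.1).ne'
        rw [if_pos hlt, Real.log_div (h.trans_le (hPY c)).ne' hN']
        ring
    · have := hP0 c hlt
      simp only [P] at this
      rw [this, zero_mul, zero_mul]

/-- The entropy of a tuple is at most the sum of the entropies of its entries. -/
lemma shannon_tuple_le [IsProbabilityMeasure μ] [Fintype A] {n : ℕ} {X : Fin n → Ω → A}
    (hX : ∀ j, Measurable (X j)) :
    shannon μ (fun ω j => X j ω) ≤ ∑ j, shannon μ (X j) := by
  induction n with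
  | zero =>
    refine (shannon_le_log_card (measurable_pi_lambda _ fun j => hX j)).trans ?_
    simp
  | succ n ih =>
    have h0 : Measurable fun ω (j : Fin n) => X j.castSucc ω :=
      measurable_pi_lambda _ fun j => hX _
    refine (shannon_le_of_determined (Z := fun ω => ((fun j : Fin n => X j.castSucc ω),
      X (Fin.last n) ω)) (h0.prodMk (hX _)) (G := univ) (by simp) ?_).trans ?_
    · intro ω _ ω' _ h
      obtain ⟨h1, h2⟩ := Prod.mk.inj h
      funext j
      refine Fin.lastCases h2 (fun i => congrFun h1 i) j
    · refine (shannon_pair_le h0 (hX _)).trans ?_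
      rw [Fin.sum_univ_castSucc]
      exact add_le_add (ih fun j => hX _) le_rfl


lemma shannon_comp_measurePreserving [Fintype A] {T : Ω → Ω}
    (hT : MeasurePreserving T μ μ) {X : Ω → A} (hX : Measurable X) :
    shannon μ (X ∘ T) = shannon μ X := by
  refine Finset.sum_congr rfl fun a _ => ?_
  rw [preimage_comp, hT.measureReal_preimage (hX (measurableSet_singleton a)).nullMeasurableSet]

/-- A map that almost always vanishes has small entropy. -/
lemma exists_shannon_le_of_measure_ne_zero_le (k : ℕ) {ε : ℝ} (hε : 0 < ε) :
    ∃ δ > 0, ∀ (ν : Measure Ω) [IsProbabilityMeasure ν] (Z : Ω → Fin (k + 1)), Measurable Z →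
      ν.real {ω | Z ω ≠ 0} ≤ δ → shannon ν Z ≤ ε := by
  have hc := Real.continuous_negMulLog
  have hk : (0 : ℝ) < k + 1 := by positivity
  obtain ⟨δ₀, hδ₀, h0⟩ := Metric.continuousAt_iff.1 (hc.continuousAt (x := 0)) (ε / (k + 1))
    (by positivity)
  obtain ⟨δ₁, hδ₁, h1⟩ := Metric.continuousAt_iff.1 (hc.continuousAt (x := 1)) (ε / (k + 1))
    (by positivity)
  refine ⟨min δ₀ δ₁ / 2, by positivity, fun ν _ Z hZ hν => ?_⟩
  have hlt : min δ₀ δ₁ / 2 < min δ₀ δ₁ := half_lt_self (lt_min hδ₀ hδ₁)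
  have hn : ν.real (Z ⁻¹' {0}) = 1 - ν.real {ω | Z ω ≠ 0} := by
    have := probReal_compl_eq_one_sub (μ := ν) (hZ (measurableSet_singleton 0))
    have e : (Z ⁻¹' {0})ᶜ = {ω | Z ω ≠ 0} := rfl
    rw [e] at this
    linarith
  have b0 : negMulLog (ν.real (Z ⁻¹' {0})) ≤ ε / (k + 1) := by
    have := h1 (x := ν.real (Z ⁻¹' {0})) (by
      rw [hn, Real.dist_eq, sub_sub_cancel_left, abs_neg, abs_of_nonneg measureReal_nonneg]
      exact hν.trans_lt (hlt.trans_le (min_le_right _ _)))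
    rw [Real.negMulLog_one, Real.dist_eq, sub_zero] at this
    exact (le_abs_self _).trans this.le
  have b1 : ∀ i : Fin k, negMulLog (ν.real (Z ⁻¹' {i.succ})) ≤ ε / (k + 1) := by
    intro i
    have hle : ν.real (Z ⁻¹' {i.succ}) ≤ ν.real {ω | Z ω ≠ 0} :=
      measureReal_mono fun ω hω => by
        have : Z ω = i.succ := hω
        simp [this]
    have := h0 (x := ν.real (Z ⁻¹' {i.succ})) (by
      rw [Real.dist_eq, sub_zero, abs_of_nonneg measureReal_nonneg]
      exact (hle.trans hν).trans_lt (hlt.trans_le (min_le_left _ _)))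
    rw [Real.negMulLog_zero, Real.dist_eq, sub_zero] at this
    exact (le_abs_self _).trans this.le
  rw [shannon, Fin.sum_univ_succ]
  calc _ ≤ ε / (k + 1) + ∑ _i : Fin k, ε / (k + 1) := add_le_add b0 (Finset.sum_le_sum fun i _ => b1 i)
    _ = ε := by simp; field_simp; ring

end Shannon

/-! ### Mean ergodic theorem in `L¹` and deviations of Birkhoff sums -/

namespace Dynamics

section MeanErgodic

variable {Ω : Type*} [MeasurableSpace Ω] {μ : Measure Ω} [IsProbabilityMeasure μ] {T : Ω → Ω}

omit [IsProbabilityMeasure μ] in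
lemma toLp_birkhoffAverage (hT : MeasurePreserving T μ μ) {g : Ω → ℝ} (hg : MemLp g 2 μ) (n : ℕ)
    (h : MemLp (birkhoffAverage ℝ T g n) 2 μ) :
    birkhoffAverage ℝ (Lp.compMeasurePreservingₗᵢ (p := 2) (E := ℝ) ℝ T hT) id n (hg.toLp g)
      = h.toLp _ := by
  have hit : ∀ k, (⇑(Lp.compMeasurePreservingₗᵢ (p := 2) (E := ℝ) ℝ T hT))^[k] (hg.toLp g)
      = (hg.comp_measurePreserving (hT.iterate k)).toLp (g ∘ T^[k]) := by
    intro k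
    have : (⇑(Lp.compMeasurePreservingₗᵢ (p := 2) (E := ℝ) ℝ T hT))^[k]
        = Lp.compMeasurePreserving (p := 2) (E := ℝ) T^[k] (hT.iterate k) := by
      rw [← Lp.compMeasurePreserving_iterate]; rfl
    rw [this, Lp.toLp_compMeasurePreserving]
  have hsum : ∀ n, ∃ h' : MemLp (birkhoffSum T g n) 2 μ,
      ∑ k ∈ Finset.range n, (hg.comp_measurePreserving (hT.iterate k)).toLp (g ∘ T^[k])
        = h'.toLp _ := by
    intro n
    induction n with
    | zero =>
      refine ⟨by simp, ?_⟩
      rw [Finset.sum_range_zero]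
      exact (MemLp.toLp_zero _).symm
    | succ n ih =>
      obtain ⟨h', e⟩ := ih
      have e' : birkhoffSum T g (n + 1) = birkhoffSum T g n + g ∘ T^[n] := by
        funext x; exact birkhoffSum_succ ..
      refine ⟨e' ▸ h'.add (hg.comp_measurePreserving (hT.iterate n)), ?_⟩
      rw [Finset.sum_range_succ, e, ← MemLp.toLp_add]
      exact MemLp.toLp_congr _ _ (by rw [e'])
  obtain ⟨h', e⟩ := hsum n
  simp only [birkhoffAverage, birkhoffSum, id, hit]
  rw [e, ← MemLp.toLp_const_smul]
  exact MemLp.toLp_congr _ _ (ae_of_all _ fun x => rfl)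

/-- The mean ergodic theorem in `L¹` for bounded functions. -/
theorem tendsto_integral_abs_birkhoffAverage_sub (hT : Ergodic T μ) {g : Ω → ℝ}
    (hg : Measurable g) {C : ℝ} (hC : ∀ x, |g x| ≤ C) :
    Tendsto (fun n => ∫ x, |birkhoffAverage ℝ T g n x - ∫ y, g y ∂μ| ∂μ) atTop (𝓝 0) := by
  have hTm := hT.toMeasurePreserving
  have hg2 : MemLp g 2 μ := MemLp.of_bound hg.aestronglyMeasurable C (ae_of_all _ hC)
  have hAm : ∀ n, Measurable (birkhoffAverage ℝ T g n) := fun n => by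
    exact (Finset.measurable_sum (Finset.range n) fun k _ =>
      hg.comp (hTm.measurable.iterate k)).const_smul (n : ℝ)⁻¹
  have hAb : ∀ n x, |birkhoffAverage ℝ T g n x| ≤ C := by
    intro n x
    have h0 : 0 ≤ C := (abs_nonneg _).trans (hC x)
    simp only [birkhoffAverage, birkhoffSum, smul_eq_mul, abs_mul, abs_inv, Nat.abs_cast]
    rcases Nat.eq_zero_or_pos n with rfl | hn
    · simpa using h0
    · have hn' : (0 : ℝ) < n := by exact_mod_cast hn
      rw [inv_mul_le_iff₀ hn']
      refine (Finset.abs_sum_le_sum_abs _ _).trans ?_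
      refine (Finset.sum_le_sum fun k _ => hC _).trans_eq ?_
      simp
  have hA2 : ∀ n, MemLp (birkhoffAverage ℝ T g n) 2 μ := fun n =>
    MemLp.of_bound (hAm n).aestronglyMeasurable C (ae_of_all _ (hAb n))
  set U := Lp.compMeasurePreservingₗᵢ (p := 2) (E := ℝ) ℝ T hTm
  have hvn := ContinuousLinearMap.tendsto_birkhoffAverage_orthogonalProjection (𝕜 := ℝ)
    U.toContinuousLinearMap U.norm_toContinuousLinearMap_le (hg2.toLp g)
  set L : Lp ℝ 2 μ := ((U.toContinuousLinearMap.eqLocus (1 : Lp ℝ 2 μ →L[ℝ] Lp ℝ 2 μ)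
    ).orthogonalProjectionOnto (hg2.toLp g) : Lp ℝ 2 μ) with hL
  have hfix : U L = L := by
    have := ((U.toContinuousLinearMap.eqLocus (1 : Lp ℝ 2 μ →L[ℝ] Lp ℝ 2 μ)
      ).orthogonalProjectionOnto (hg2.toLp g)).2
    exact this
  obtain ⟨c, hc⟩ : ∃ c : ℝ, L =ᵐ[μ] Function.const Ω c := by
    refine hT.ae_eq_const_of_ae_eq_comp_ae (Lp.aestronglyMeasurable L) ?_
    have h1 := Lp.coeFn_compMeasurePreserving L hTm
    have h2 : Lp.compMeasurePreserving T hTm L = L := hfix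
    rw [h2] at h1
    exact h1.symm
  have hvn' : Tendsto (fun n => (hA2 n).toLp _) atTop (𝓝 L) := by
    refine hvn.congr fun n => ?_
    exact toLp_birkhoffAverage hTm hg2 n (hA2 n)
  have hkey : Tendsto (fun n => ∫ x, |birkhoffAverage ℝ T g n x - c| ∂μ) atTop (𝓝 0) := by
    have hn := (tendsto_iff_norm_sub_tendsto_zero.1 hvn')
    refine squeeze_zero (fun n => integral_nonneg fun x => abs_nonneg _) (fun n => ?_) hn
    have e : ⇑((hA2 n).toLp _ - L) =ᵐ[μ] fun x => birkhoffAverage ℝ T g n x - c := by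
      filter_upwards [Lp.coeFn_sub ((hA2 n).toLp _) L, (hA2 n).coeFn_toLp, hc] with x h1 h2 h3
      rw [h1, Pi.sub_apply, h2, h3]; rfl
    rw [Lp.norm_def, eLpNorm_congr_ae e]
    have hms : AEStronglyMeasurable (fun x => birkhoffAverage ℝ T g n x - c) μ :=
      ((hAm n).sub_const c).aestronglyMeasurable
    have hle := eLpNorm_le_eLpNorm_of_exponent_le (μ := μ) (p := 1) (q := 2) (by norm_num) hms
    have hfin : eLpNorm (fun x => birkhoffAverage ℝ T g n x - c) 2 μ ≠ ⊤ :=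
      ((hA2 n).sub (memLp_const c)).eLpNorm_ne_top
    have e1 : ∫ x, |birkhoffAverage ℝ T g n x - c| ∂μ
        = (eLpNorm (fun x => birkhoffAverage ℝ T g n x - c) 1 μ).toReal := by
      rw [eLpNorm_one_eq_lintegral_enorm, ← integral_norm_eq_lintegral_enorm hms]
      simp only [Real.norm_eq_abs]
    rw [e1]
    exact ENNReal.toReal_mono hfin hle
  have hgi : Integrable g μ := hg2.integrable (by norm_num)
  have hint : ∀ n, 0 < n → ∫ x, birkhoffAverage ℝ T g n x ∂μ = ∫ x, g x ∂μ := by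
    intro n hn
    simp only [birkhoffAverage, birkhoffSum]
    rw [integral_smul, integral_finsetSum]
    · have : ∀ k, ∫ x, g (T^[k] x) ∂μ = ∫ x, g x ∂μ := fun k => by
        have := integral_map (hTm.iterate k).measurable.aemeasurable (μ := μ) (f := g)
          hg.aestronglyMeasurable
        rw [(hTm.iterate k).map_eq] at this
        exact this.symm
      simp only [this, Finset.sum_const, Finset.card_range, smul_eq_mul, nsmul_eq_mul]
      have hn' : (n : ℝ) ≠ 0 := by exact_mod_cast hn.ne'
      field_simp
    · intro k _
      exact (hTm.iterate k).integrable_comp_of_integrable hgi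
  have hcg : c = ∫ x, g x ∂μ := by
    have h1 : ∀ᶠ n : ℕ in atTop, |∫ x, g x ∂μ - c|
        ≤ ∫ x, |birkhoffAverage ℝ T g n x - c| ∂μ := by
      filter_upwards [eventually_gt_atTop 0] with n hn
      have hi : Integrable (birkhoffAverage ℝ T g n) μ := (hA2 n).integrable (by norm_num)
      rw [← hint n hn]
      have : ∫ x, birkhoffAverage ℝ T g n x ∂μ - c = ∫ x, (birkhoffAverage ℝ T g n x - c) ∂μ := by
        rw [integral_sub hi (integrable_const c)]; simp
      rw [this]
      exact abs_integral_le_integral_abs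
    have h2 := ge_of_tendsto hkey h1
    have := abs_nonpos_iff.1 h2
    linarith
  rw [← hcg]
  exact hkey

/-- The largest deviation from linear growth of the Birkhoff sums up to time `n`. -/
noncomputable def maxDeviation (T : Ω → Ω) (g : Ω → ℝ) (c : ℝ) (n : ℕ) (x : Ω) : ℝ :=
  (Finset.range (n + 1)).sup' Finset.nonempty_range_add_one fun k => |birkhoffSum T g k x - k * c|

omit [IsProbabilityMeasure μ] [MeasurableSpace Ω] in
lemma abs_birkhoffSum_sub_le {g : Ω → ℝ} {C c : ℝ} (hC : ∀ x, |g x - c| ≤ C) (k : ℕ) (x : Ω) :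
    |birkhoffSum T g k x - k * c| ≤ k * C := by
  have : birkhoffSum T g k x - k * c = ∑ j ∈ Finset.range k, (g (T^[j] x) - c) := by
    simp [birkhoffSum]
  rw [this]
  refine (Finset.abs_sum_le_sum_abs _ _).trans ((Finset.sum_le_sum fun j _ => hC _).trans_eq ?_)
  simp

omit [IsProbabilityMeasure μ] [MeasurableSpace Ω] in
/-- Comparison of the deviation at time `j l + t` with the deviations over blocks of length `l`. -/
lemma abs_birkhoffSum_block {g : Ω → ℝ} {C c : ℝ} (hC : ∀ x, |g x - c| ≤ C) (l j t : ℕ) (x : Ω) :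
    |birkhoffSum T g (j * l + t) x - (j * l + t : ℕ) * c|
      ≤ ∑ i ∈ Finset.range j, |birkhoffSum T g l (T^[i * l] x) - l * c| + t * C := by
  induction j with
  | zero => simpa using abs_birkhoffSum_sub_le hC t x
  | succ j ih =>
    have e : birkhoffSum T g ((j + 1) * l + t) x - ((j + 1) * l + t : ℕ) * c
        = (birkhoffSum T g (j * l) x - (j * l : ℕ) * c)
          + (birkhoffSum T g l (T^[j * l] x) - l * c)
          + (birkhoffSum T g t (T^[(j + 1) * l] x) - t * c) := by
      rw [birkhoffSum_add, show (j + 1) * l = j * l + l by ring, birkhoffSum_add]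
      push_cast; ring
    have h0 : ∀ j, |birkhoffSum T g (j * l) x - (j * l : ℕ) * c|
        ≤ ∑ i ∈ Finset.range j, |birkhoffSum T g l (T^[i * l] x) - l * c| := by
      intro j
      induction j with
      | zero => simp
      | succ j ih =>
        rw [Finset.sum_range_succ, show (j + 1) * l = j * l + l by ring, birkhoffSum_add]
        have : birkhoffSum T g (j * l) x + birkhoffSum T g l (T^[j * l] x) - (j * l + l : ℕ) * c
          = (birkhoffSum T g (j * l) x - (j * l : ℕ) * c)
            + (birkhoffSum T g l (T^[j * l] x) - l * c) := by push_cast; ring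
        rw [this]
        exact (abs_add_le _ _).trans (add_le_add ih le_rfl)
    rw [e, Finset.sum_range_succ]
    exact (abs_add_le _ _).trans (add_le_add ((abs_add_le _ _).trans (add_le_add (h0 j) le_rfl))
      (abs_birkhoffSum_sub_le hC _ _))

lemma measurable_maxDeviation (hT : Measurable T) {g : Ω → ℝ} (hg : Measurable g) (c : ℝ) (n : ℕ) :
    Measurable (maxDeviation T g c n) := by
  unfold maxDeviation
  have := Finset.measurable_sup' (s := Finset.range (n + 1)) Finset.nonempty_range_add_one
    (f := fun k x => |birkhoffSum T g k x - k * c|) fun k _ => by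
      have : Measurable (birkhoffSum T g k) := by
        unfold birkhoffSum
        exact Finset.measurable_sum _ fun j _ => hg.comp (hT.iterate j)
      exact (this.sub_const _).abs
  convert this using 1
  funext x
  simp [Finset.sup'_apply]

/-- In mean, the Birkhoff sums up to time `n` deviate from linear growth by `o(n)` at most. -/
theorem tendsto_integral_maxDeviation (hT : Ergodic T μ) {g : Ω → ℝ}
    (hg : Measurable g) {C : ℝ} (hC : ∀ x, |g x| ≤ C) :
    Tendsto (fun n : ℕ => (∫ x, maxDeviation T g (∫ y, g y ∂μ) n x ∂μ) / n) atTop (𝓝 0) := by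
  have hTm := hT.toMeasurePreserving
  set c := ∫ y, g y ∂μ with hc
  obtain ⟨x₀⟩ : Nonempty Ω := by
    by_contra h
    rw [not_nonempty_iff] at h
    exact IsProbabilityMeasure.ne_zero μ (Measure.eq_zero_of_isEmpty μ)
  have hC0 : 0 ≤ C := (abs_nonneg _).trans (hC x₀)
  have hcC : |c| ≤ C := by
    have := norm_integral_le_of_norm_le_const (μ := μ) (f := g) (ae_of_all _ hC)
    simpa using this
  have hC2 : ∀ x, |g x - c| ≤ 2 * C := fun x => by
    refine (abs_sub _ _).trans ?_
    linarith [hC x]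
  have hbm : ∀ k, Measurable (birkhoffSum T g k) := fun k => by
    unfold birkhoffSum
    exact Finset.measurable_sum _ fun j _ => hg.comp (hTm.measurable.iterate j)
  have hint : ∀ k, Integrable (fun x => |birkhoffSum T g k x - k * c|) μ := fun k =>
    Integrable.of_bound ((hbm k).sub_const _).abs.aestronglyMeasurable (k * (2 * C))
      (ae_of_all _ fun x => by
        rw [Real.norm_eq_abs, abs_abs]; exact abs_birkhoffSum_sub_le hC2 k x)
  have hnn : ∀ n x, 0 ≤ maxDeviation T g c n x := fun n x =>
    (abs_nonneg _).trans (Finset.le_sup' (fun k => |birkhoffSum T g k x - k * c|)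
      (Finset.mem_range.2 (Nat.succ_pos n)))
  have hbd : ∀ l : ℕ, 0 < l → ∀ n : ℕ, ∫ x, maxDeviation T g c n x ∂μ
      ≤ (n : ℝ) / l * ∫ x, |birkhoffSum T g l x - l * c| ∂μ + l * (2 * C) := by
    intro l hl n
    set F : Ω → ℝ := fun x =>
      ∑ i ∈ Finset.range (n / l), |birkhoffSum T g l (T^[i * l] x) - l * c| + l * (2 * C)
    have hpt : ∀ x, maxDeviation T g c n x ≤ F x := by
      intro x
      refine Finset.sup'_le _ _ fun k hk => ?_
      have hk' : k ≤ n := Nat.lt_succ_iff.1 (Finset.mem_range.1 hk)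
      have := abs_birkhoffSum_block (T := T) hC2 l (k / l) (k % l) x
      rw [Nat.div_add_mod'] at this
      refine this.trans (add_le_add ?_ ?_)
      · exact Finset.sum_le_sum_of_subset_of_nonneg
          (Finset.range_subset_range.2 (Nat.div_le_div_right hk')) fun _ _ _ => abs_nonneg _
      · have : (k % l : ℕ) ≤ l := (Nat.mod_lt _ hl).le
        have : ((k % l : ℕ) : ℝ) ≤ l := by exact_mod_cast this
        gcongr
    have hi : ∀ i, Integrable (fun x => |birkhoffSum T g l (T^[i * l] x) - l * c|) μ := fun i =>
      (hTm.iterate (i * l)).integrable_comp_of_integrable (hint l)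
    have hFi : Integrable F μ := (integrable_finsetSum _ fun i _ => hi i).add (integrable_const _)
    have hle : ∫ x, maxDeviation T g c n x ∂μ ≤ ∫ x, F x ∂μ :=
      integral_mono_of_nonneg (ae_of_all _ fun x => hnn n x) hFi (ae_of_all _ hpt)
    refine hle.trans ?_
    rw [integral_add (integrable_finsetSum _ fun i _ => hi i) (integrable_const _),
      integral_finsetSum _ fun i _ => hi i]
    have e : ∀ i, ∫ x, |birkhoffSum T g l (T^[i * l] x) - l * c| ∂μ
        = ∫ x, |birkhoffSum T g l x - l * c| ∂μ := fun i => by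
      have := integral_map (hTm.iterate (i * l)).measurable.aemeasurable (μ := μ)
        (f := fun x => |birkhoffSum T g l x - l * c|)
        ((hbm l).sub_const _).abs.aestronglyMeasurable
      rw [(hTm.iterate (i * l)).map_eq] at this
      exact this.symm
    simp only [e, Finset.sum_const, Finset.card_range, nsmul_eq_mul, integral_const, probReal_univ,
      one_smul]
    have h0 : 0 ≤ ∫ x, |birkhoffSum T g l x - l * c| ∂μ := integral_nonneg fun x => abs_nonneg _
    have := Nat.cast_div_le (α := ℝ) (m := n) (n := l)
    gcongr
  rw [Metric.tendsto_atTop]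
  intro ε hε
  have hL1 := tendsto_integral_abs_birkhoffAverage_sub hT hg hC
  obtain ⟨l, hl0, hl⟩ : ∃ l : ℕ, 0 < l ∧
      ∫ x, |birkhoffAverage ℝ T g l x - c| ∂μ < ε / 2 := by
    obtain ⟨l, h1, h2⟩ := ((hL1.eventually_lt_const (half_pos hε)).and
      (eventually_gt_atTop 0)).exists
    exact ⟨l, h2, h1⟩
  have hl' : (0 : ℝ) < l := by exact_mod_cast hl0
  have hS : ∫ x, |birkhoffSum T g l x - l * c| ∂μ ≤ l * (ε / 2) := by
    have : ∀ x, |birkhoffSum T g l x - l * c| = l * |birkhoffAverage ℝ T g l x - c| := fun x => by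
      rw [← abs_of_pos hl', ← abs_mul, abs_of_pos hl']
      congr 1
      simp only [birkhoffAverage, smul_eq_mul]
      field_simp
    simp_rw [this]
    rw [integral_const_mul]
    gcongr
  obtain ⟨N, hN⟩ := exists_nat_gt (l * (2 * C) / (ε / 2))
  refine ⟨N + 1, fun n hn => ?_⟩
  have hn0 : (0 : ℝ) < n := by
    have : 0 < n := by omega
    exact_mod_cast this
  have hnN : (N : ℝ) ≤ n := by
    have : N ≤ n := by omega
    exact_mod_cast this
  have hI0 : 0 ≤ ∫ x, maxDeviation T g c n x ∂μ := integral_nonneg fun x => hnn n x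
  rw [Real.dist_eq, sub_zero, abs_of_nonneg (div_nonneg hI0 hn0.le), div_lt_iff₀ hn0]
  refine (hbd l hl0 n).trans_lt ?_
  have h1 : (n : ℝ) / l * ∫ x, |birkhoffSum T g l x - l * c| ∂μ ≤ n * (ε / 2) := by
    calc _ ≤ (n : ℝ) / l * (l * (ε / 2)) := by gcongr
      _ = _ := by field_simp
  have h2 : l * (2 * C) < n * (ε / 2) := by
    rw [div_lt_iff₀ (half_pos hε)] at hN
    exact hN.trans_le (by gcongr)
  linarith

end MeanErgodic

end Dynamics

/-! ### Bounds for the entropy of a measure-preserving map -/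

namespace Dynamics

open Shannon

section Bounds

variable {X : Type*} [MeasurableSpace X] {T : X → X} {μ : Measure X}

lemma measurable_itinerary (hT : Measurable T) {k : ℕ} {P : X → Fin k} (hP : Measurable P) (n : ℕ) :
    Measurable (itinerary T P n) :=
  measurable_pi_lambda _ fun j => hP.comp (hT.iterate j)

lemma joinEntropy_eq_shannon {k : ℕ} (P : X → Fin k) (n : ℕ) :
    joinEntropy T μ P n = shannon μ (itinerary T P n) := rfl

lemma partitionEntropy_le {k : ℕ} {P : X → Fin k} {L : ℝ}
    (h : ∀ ε > 0, ∀ᶠ n : ℕ in atTop, joinEntropy T μ P n ≤ n * (L + ε)) :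
    partitionEntropy T μ P ≤ ENNReal.ofReal L := by
  have h1 : ∀ ε > 0, partitionEntropy T μ P ≤ ENNReal.ofReal (L + ε) := by
    intro ε hε
    refine limsup_le_of_le (by isBoundedDefault) ?_
    filter_upwards [h ε hε, eventually_gt_atTop 0] with n hn h0
    have h0' : (0 : ℝ) < n := by exact_mod_cast h0
    refine ENNReal.ofReal_le_ofReal ?_
    rw [div_le_iff₀ h0']
    linarith
  have h2 : Tendsto (fun ε : ℝ => ENNReal.ofReal (L + ε)) (𝓝[>] 0) (𝓝 (ENNReal.ofReal L)) := by
    have : Tendsto (fun ε : ℝ => L + ε) (𝓝[>] 0) (𝓝 (L + 0)) :=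
      (tendsto_const_nhds.add tendsto_id).mono_left nhdsWithin_le_nhds
    rw [add_zero] at this
    exact ENNReal.tendsto_ofReal this
  exact ge_of_tendsto h2 (eventually_mem_nhdsWithin.mono fun ε hε => h1 ε hε)

lemma eventually_joinEntropy_le {k : ℕ} {P : X → Fin k} {L : ℝ} (hL : 0 ≤ L)
    (h : partitionEntropy T μ P ≤ ENNReal.ofReal L) {ε : ℝ} (hε : 0 < ε) :
    ∀ᶠ n : ℕ in atTop, joinEntropy T μ P n ≤ n * (L + ε) := by
  have h1 : partitionEntropy T μ P < ENNReal.ofReal (L + ε) :=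
    h.trans_lt ((ENNReal.ofReal_lt_ofReal_iff (by linarith)).2 (by linarith))
  filter_upwards [eventually_lt_of_limsup_lt h1, eventually_gt_atTop 0] with n hn h0
  have h0' : (0 : ℝ) < n := by exact_mod_cast h0
  have := ((ENNReal.ofReal_lt_ofReal_iff (by linarith)).1 hn).le
  rw [div_le_iff₀ h0'] at this
  linarith

lemma le_partitionEntropy {k : ℕ} {P : X → Fin k} {L : ℝ}
    (h : ∀ n : ℕ, n * L ≤ joinEntropy T μ P n) : ENNReal.ofReal L ≤ partitionEntropy T μ P := by
  refine le_limsup_of_frequently_le ?_ (by isBoundedDefault)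
  refine Eventually.frequently ?_
  filter_upwards [eventually_gt_atTop 0] with n h0
  have h0' : (0 : ℝ) < n := by exact_mod_cast h0
  refine ENNReal.ofReal_le_ofReal ?_
  rw [le_div_iff₀ h0']
  linarith [h n]

lemma le_entropy {k : ℕ} {P : X → Fin k} (hP : Measurable P) :
    partitionEntropy T μ P ≤ entropy T μ :=
  le_iSup_of_le k (le_iSup_of_le P (le_iSup_of_le hP le_rfl))

lemma entropy_le {L : ENNReal}
    (h : ∀ (k : ℕ) (P : X → Fin k), Measurable P → partitionEntropy T μ P ≤ L) :
    entropy T μ ≤ L :=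
  iSup_le fun k => iSup_le fun P => iSup_le fun hP => h k P hP

/-! ### The entropy of the mean of two measures -/

lemma negMulLog_half_add_le {p q : ℝ} (hp : 0 ≤ p) (hq : 0 ≤ q) :
    Real.negMulLog (2⁻¹ * (p + q))
      ≤ 2⁻¹ * (Real.negMulLog p + Real.negMulLog q) + 2⁻¹ * (p + q) * Real.log 2 := by
  have key : ∀ {s t : ℝ}, 0 ≤ s → 0 ≤ t → s * Real.log s ≤ s * Real.log (s + t) := by
    intro s t hs ht
    rcases hs.eq_or_lt with rfl | hs
    · simp
    · exact mul_le_mul_of_nonneg_left (Real.log_le_log hs (by linarith)) hs.le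
  have h1 := key hp hq
  have h2 := key hq hp
  rw [add_comm q p] at h2
  rcases (add_nonneg hp hq).eq_or_lt with h | h
  · have hp0 : p = 0 := by linarith
    have hq0 : q = 0 := by linarith
    simp [hp0, hq0]
  · simp only [Real.negMulLog]
    rw [Real.log_mul (by norm_num) h.ne', Real.log_inv]
    linarith

lemma le_negMulLog_half_add {p q : ℝ} (hp : 0 ≤ p) (hq : 0 ≤ q) :
    2⁻¹ * (Real.negMulLog p + Real.negMulLog q) ≤ Real.negMulLog (2⁻¹ * (p + q)) := by
  have := Real.concaveOn_negMulLog.2 (show p ∈ Ici 0 from hp) (show q ∈ Ici 0 from hq)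
    (by norm_num : (0 : ℝ) ≤ 2⁻¹) (by norm_num : (0 : ℝ) ≤ 2⁻¹) (by norm_num)
  simp only [smul_eq_mul] at this
  rw [← mul_add, ← mul_add] at this
  exact this

variable {ν : Measure X}

lemma measureReal_half_add [IsFiniteMeasure μ] [IsFiniteMeasure ν] (s : Set X) :
    ((2 : ENNReal)⁻¹ • (μ + ν)).real s = 2⁻¹ * (μ.real s + ν.real s) := by
  rw [measureReal_ennreal_smul_apply, measureReal_add_apply]
  simp

lemma shannon_half_add_le [IsProbabilityMeasure μ] [IsProbabilityMeasure ν] {A : Type*} [Fintype A]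
    [MeasurableSpace A] [MeasurableSingletonClass A] {Y : X → A} (hY : Measurable Y) :
    shannon ((2 : ENNReal)⁻¹ • (μ + ν)) Y ≤ 2⁻¹ * (shannon μ Y + shannon ν Y) + Real.log 2 := by
  simp only [shannon, measureReal_half_add]
  refine (Finset.sum_le_sum fun a _ =>
    negMulLog_half_add_le measureReal_nonneg measureReal_nonneg).trans_eq ?_
  rw [Finset.sum_add_distrib, ← Finset.mul_sum, Finset.sum_add_distrib, ← Finset.sum_mul,
    ← Finset.mul_sum, Finset.sum_add_distrib, sum_measureReal_fiber hY, sum_measureReal_fiber hY]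
  norm_num

lemma le_shannon_half_add [IsFiniteMeasure μ] [IsFiniteMeasure ν] {A : Type*} [Fintype A]
    (Y : X → A) :
    2⁻¹ * (shannon μ Y + shannon ν Y) ≤ shannon ((2 : ENNReal)⁻¹ • (μ + ν)) Y := by
  simp only [shannon, measureReal_half_add]
  rw [← Finset.sum_add_distrib, Finset.mul_sum]
  exact Finset.sum_le_sum fun a _ => le_negMulLog_half_add measureReal_nonneg measureReal_nonneg

lemma entropy_half_add_le [IsProbabilityMeasure μ] [IsProbabilityMeasure ν] (hT : Measurable T)
    {L : ℝ} (hL : 0 ≤ L) (hμ : entropy T μ ≤ ENNReal.ofReal L) (hν : entropy T ν ≤ ENNReal.ofReal L) :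
    entropy T ((2 : ENNReal)⁻¹ • (μ + ν)) ≤ ENNReal.ofReal L := by
  refine entropy_le fun k P hP => partitionEntropy_le fun ε hε => ?_
  obtain ⟨N, hN⟩ := exists_nat_gt (Real.log 2 / (ε / 2))
  rw [div_lt_iff₀ (half_pos hε)] at hN
  filter_upwards [eventually_joinEntropy_le hL ((le_entropy hP).trans hμ) (half_pos hε),
    eventually_joinEntropy_le hL ((le_entropy hP).trans hν) (half_pos hε),
    eventually_ge_atTop N] with n h1 h2 h3
  have h3' : (N : ℝ) ≤ n := by exact_mod_cast h3
  have := shannon_half_add_le (μ := μ) (ν := ν) (measurable_itinerary hT hP n)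
  rw [joinEntropy_eq_shannon] at h1 h2 ⊢
  nlinarith

/-! ### Partitions into small cells suffice -/

variable [MetricSpace X] [BorelSpace X] [CompactSpace X]

/-- A finite measurable partition is approximated by coarsenings of partitions of small mesh. -/
lemma exists_measure_ne_comp_le [IsProbabilityMeasure μ] {A : ℕ → Type*} {c : ∀ N, X → A N}
    (hc : ∀ δ > 0, ∃ N, ∀ p q, c N p = c N q → dist p q < δ) {k : ℕ} {P : X → Fin k}
    (hP : Measurable P) {ε : ℝ} (hε : 0 < ε) :
    ∃ N, ∃ g : A N → Fin k, μ.real {p | P p ≠ g (c N p)} ≤ ε := by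
  classical
  have hne : Nonempty X := by
    by_contra h
    rw [not_nonempty_iff] at h
    exact IsProbabilityMeasure.ne_zero μ (Measure.eq_zero_of_isEmpty μ)
  obtain ⟨x₀⟩ := hne
  have hk : 0 < k := (P x₀).pos
  have hk' : (0 : ℝ) < k := by exact_mod_cast hk
  have hK : ∀ i : Fin k, ∃ K ⊆ P ⁻¹' {i}, IsCompact K ∧ μ ((P ⁻¹' {i}) \ K)
      < ENNReal.ofReal (ε / k) := fun i =>
    (hP (measurableSet_singleton i)).exists_isCompact_sdiff_lt (measure_ne_top _ _)
      (ENNReal.ofReal_pos.2 (by positivity)).ne'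
  choose K hKP hKc hKμ using hK
  have hsep : ∀ i j : Fin k, ∃ δ > 0, i ≠ j → ∀ p ∈ K i, ∀ q ∈ K j, δ ≤ dist p q := by
    intro i j
    by_cases hij : i = j
    · exact ⟨1, one_pos, fun h => absurd hij h⟩
    · have hd : Disjoint (K i) (K j) := by
        rw [Set.disjoint_left]
        intro x hx hy
        exact hij ((hKP i hx : P x = i).symm.trans (hKP j hy))
      obtain ⟨δ, hδ, h⟩ := Metric.exists_pos_forall_lt_edist (hKc i) (hKc j).isClosed hd
      refine ⟨δ, by exact_mod_cast hδ, fun _ p hp q hq => ?_⟩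
      have := h p hp q hq
      rw [edist_dist, ← ENNReal.ofReal_coe_nnreal, ENNReal.ofReal_lt_ofReal_iff'] at this
      exact this.1.le
  choose δ hδ hsep using hsep
  obtain ⟨δ', hδ', hle⟩ : ∃ δ' > 0, ∀ i j, δ' ≤ δ i j := by
    have hn : (Finset.univ : Finset (Fin k × Fin k)).Nonempty := ⟨(⟨0, hk⟩, ⟨0, hk⟩), by simp⟩
    refine ⟨Finset.univ.inf' hn fun p => δ p.1 p.2, (Finset.lt_inf'_iff hn).2 fun p _ => hδ _ _,
      fun i j => Finset.inf'_le (fun p : Fin k × Fin k => δ p.1 p.2) (Finset.mem_univ (i, j))⟩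
  obtain ⟨N, hN⟩ := hc δ' hδ'
  let g : A N → Fin k := fun a =>
    if h : ∃ p, p ∈ (⋃ i, K i) ∧ c N p = a then P h.choose else P x₀
  refine ⟨N, g, ?_⟩
  have hg : ∀ p ∈ ⋃ i, K i, P p = g (c N p) := by
    intro p hp
    have h : ∃ q, q ∈ (⋃ i, K i) ∧ c N q = c N p := ⟨p, hp, rfl⟩
    simp only [g, dif_pos h]
    obtain ⟨i, hi⟩ := mem_iUnion.1 hp
    obtain ⟨j, hj⟩ := mem_iUnion.1 h.choose_spec.1
    have hij : i = j := by
      by_contra hij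
      have h1 := hsep i j hij p hi _ hj
      have h2 := hN _ _ h.choose_spec.2
      rw [dist_comm] at h2
      linarith [hle i j]
    rw [(hKP i hi : P p = i), (hKP j hj : P h.choose = j), hij]
  have hsub : {p | P p ≠ g (c N p)} ⊆ ⋃ i, (P ⁻¹' {i}) \ K i := by
    intro p hp
    refine mem_iUnion.2 ⟨P p, rfl, fun hpK => hp (hg p (mem_iUnion.2 ⟨_, hpK⟩))⟩
  have hμ : μ {p | P p ≠ g (c N p)} ≤ ENNReal.ofReal ε := by
    calc _ ≤ μ (⋃ i, (P ⁻¹' {i}) \ K i) := measure_mono hsub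
      _ ≤ ∑ i, μ ((P ⁻¹' {i}) \ K i) := measure_iUnion_fintype_le _ _
      _ ≤ ∑ _i : Fin k, ENNReal.ofReal (ε / k) := Finset.sum_le_sum fun i _ => (hKμ i).le
      _ = ENNReal.ofReal ε := by
        rw [Finset.sum_const, Finset.card_univ, Fintype.card_fin, nsmul_eq_mul,
          ← ENNReal.ofReal_natCast, ← ENNReal.ofReal_mul hk'.le]
        congr 1; field_simp
  exact ENNReal.toReal_le_of_le_ofReal hε.le hμ

/-- The entropy is bounded by the entropies relative to partitions of arbitrarily small mesh. -/
theorem entropy_le_of_cells [IsProbabilityMeasure μ] (hT : MeasurePreserving T μ μ)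
    {A : ℕ → Type*} [∀ N, Fintype (A N)] [∀ N, MeasurableSpace (A N)]
    [∀ N, MeasurableSingletonClass (A N)] {c : ∀ N, X → A N} (hcm : ∀ N, Measurable (c N))
    (hc : ∀ δ > 0, ∃ N, ∀ p q, c N p = c N q → dist p q < δ) {L : ℝ}
    (h : ∀ N, ∀ ε > 0, ∀ᶠ n : ℕ in atTop,
      shannon μ (fun p (j : Fin n) => c N (T^[j] p)) ≤ n * (L + ε)) :
    entropy T μ ≤ ENNReal.ofReal L := by
  refine entropy_le fun k P hP => partitionEntropy_le fun ε hε => ?_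
  obtain ⟨δ, hδ, hZ⟩ := exists_shannon_le_of_measure_ne_zero_le (Ω := X) k (half_pos hε)
  obtain ⟨N, g, hg⟩ := exists_measure_ne_comp_le (μ := μ) hc hP hδ
  have hgm : Measurable fun p => g (c N p) := (measurable_of_finite g).comp (hcm N)
  have hD : MeasurableSet {p | P p = g (c N p)} := measurableSet_eq_fun hP hgm
  classical
  let Z : X → Fin (k + 1) := fun p => if P p = g (c N p) then 0 else (P p).succ
  have hZm : Measurable Z := Measurable.ite hD measurable_const ((measurable_of_finite Fin.succ).comp hP)
  have hZe : shannon μ Z ≤ ε / 2 := by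
    refine hZ μ Z hZm (le_trans (le_of_eq ?_) hg)
    congr 1
    ext p
    simp only [Z, mem_ofPred_eq]
    split_ifs with h <;> simp [h]
  filter_upwards [h N (ε / 2) (half_pos hε)] with n hn
  have m1 : Measurable fun p (j : Fin n) => c N (T^[j] p) :=
    measurable_pi_lambda _ fun j => (hcm N).comp (hT.measurable.iterate j)
  have m2 : ∀ j : Fin n, Measurable (Z ∘ T^[j]) := fun j => hZm.comp (hT.measurable.iterate j)
  have m2' : Measurable fun p (j : Fin n) => (Z ∘ T^[j]) p := measurable_pi_lambda _ m2
  calc joinEntropy T μ P n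
      ≤ shannon μ (fun p => ((fun j : Fin n => c N (T^[j] p)), fun j : Fin n => (Z ∘ T^[j]) p)) := by
        refine shannon_le_of_determined (m1.prodMk m2') (G := univ) (by simp) ?_
        intro p _ q _ hpq
        obtain ⟨h1, h2⟩ := Prod.mk.inj hpq
        funext j
        have h1' : c N (T^[j] p) = c N (T^[j] q) := congrFun h1 j
        have h2' : Z (T^[j] p) = Z (T^[j] q) := congrFun h2 j
        change P (T^[j] p) = P (T^[j] q)
        simp only [Z] at h2'
        split_ifs at h2' with ha hb hb
        · rw [ha, hb, h1']
        · exact absurd h2'.symm (Fin.succ_ne_zero _)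
        · exact absurd h2' (Fin.succ_ne_zero _)
        · exact Fin.succ_injective _ h2'
    _ ≤ _ := shannon_pair_le m1 m2'
    _ ≤ n * (L + ε / 2) + ∑ j : Fin n, shannon μ (Z ∘ T^[j]) := add_le_add hn (shannon_tuple_le m2)
    _ ≤ n * (L + ε / 2) + ∑ _j : Fin n, ε / 2 := by
        gcongr with j
        rw [shannon_comp_measurePreserving (hT.iterate j) hZm]
        exact hZe
    _ = n * (L + ε) := by simp; ring

end Bounds

/-! ### Ergodicity of factors and of periodic orbits -/

section Ergodicity

variable {Ω X : Type*} [MeasurableSpace Ω] [MeasurableSpace X]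

/-- A factor of an ergodic map is ergodic; the semiconjugacy is needed almost everywhere only. -/
lemma ergodic_map_of_ae_semiconj {μ : Measure Ω} {S : Ω → Ω} (hS : Ergodic S μ) {T : X → X}
    (hT : Measurable T) {g : Ω → X} (hg : Measurable g) (h : g ∘ S =ᵐ[μ] T ∘ g) :
    Ergodic T (μ.map g) where
  measurable := hT
  map_eq := by
    rw [Measure.map_map hT hg, ← Measure.map_congr h, ← Measure.map_map hg hS.measurable,
      hS.toMeasurePreserving.map_eq]
  aeconst_set s hs hinv := by
    have hpre : S ⁻¹' (g ⁻¹' s) =ᵐ[μ] g ⁻¹' s := by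
      filter_upwards [h] with ω hω
      have h1 : g (S ω) = T (g ω) := hω
      have h2 : (T (g ω) ∈ s) = (g ω ∈ s) := congrArg (g ω ∈ ·) hinv
      change (g (S ω) ∈ s) = (g ω ∈ s)
      rw [h1, h2]
    have := hS.quasiErgodic.aeconst_set₀ (hg hs).nullMeasurableSet hpre
    rw [← (hg.measurePreserving μ).aeconst_preimage hs.nullMeasurableSet]
    exact this

lemma IsPeriodicOrbitMeasure.ergodic {T : X → X} (hT : Measurable T) {μ : Measure X}
    (h : IsPeriodicOrbitMeasure T μ) : Ergodic T μ := by
  obtain ⟨p, n, hn, hp, rfl⟩ := h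
  have hmap : Measure.map T ((n : ENNReal)⁻¹ • ∑ k ∈ Finset.range n, Measure.dirac (T^[k] p))
      = (n : ENNReal)⁻¹ • ∑ k ∈ Finset.range n, Measure.dirac (T^[k] p) := by
    have h1 : ∀ n, Measure.map T (∑ k ∈ Finset.range n, Measure.dirac (T^[k] p))
        = ∑ k ∈ Finset.range n, Measure.dirac (T^[k + 1] p) := by
      intro n
      induction n with
      | zero => simp
      | succ n ih =>
        rw [Finset.sum_range_succ, Measure.map_add _ _ hT, ih, Measure.map_dirac' hT,
          Finset.sum_range_succ, Function.iterate_succ_apply']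
    rw [Measure.map_smul, h1]
    congr 1
    obtain ⟨l, rfl⟩ := Nat.exists_eq_succ_of_ne_zero hn.ne'
    rw [Finset.sum_range_succ, Finset.sum_range_succ', hp.eq, Function.iterate_zero, id]
  refine ⟨⟨hT, hmap⟩, ⟨fun s hs hinv => ?_⟩⟩
  have hk : ∀ k, T^[k] p ∈ s ↔ p ∈ s := by
    intro k
    induction k with
    | zero => rfl
    | succ k ih =>
      rw [Function.iterate_succ_apply', ← ih]
      conv_rhs => rw [← hinv]
      rfl
  have happ : ∀ t : Set X, (∀ k, T^[k] p ∉ t) → MeasurableSet t →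
      ((n : ENNReal)⁻¹ • ∑ k ∈ Finset.range n, Measure.dirac (T^[k] p)) t = 0 := by
    intro t ht htm
    rw [Measure.smul_apply, Measure.finsetSum_apply]
    simp [Measure.dirac_apply' _ htm, ht]
  rw [eventuallyConst_set']
  by_cases hps : p ∈ s
  · refine Or.inr (ae_eq_univ.2 (happ _ (fun k hks => hks ((hk k).2 hps)) hs.compl))
  · exact Or.inl (ae_eq_empty.2 (happ _ (fun k hks => hps ((hk k).1 hks)) hs))

end Ergodicity

end Dynamics

/-! ### The two-sided Bernoulli shift -/

namespace BernoulliShift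

open ProbabilityTheory

variable {S : Type*}

/-- Translation of two-sided sequences by `d`. -/
def shiftBy (d : ℤ) (ω : ℤ → S) : ℤ → S := fun i => ω (i + d)

lemma shiftBy_iterate (d : ℤ) (n : ℕ) (ω : ℤ → S) :
    (shiftBy d)^[n] ω = shiftBy (n * d) ω := by
  induction n with
  | zero => funext i; simp [shiftBy]
  | succ n ih =>
    rw [Function.iterate_succ_apply', ih]
    funext i
    simp only [shiftBy]
    congr 1
    push_cast; ring

variable [MeasurableSpace S]

lemma measurable_shiftBy (d : ℤ) : Measurable (shiftBy d : (ℤ → S) → ℤ → S) :=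
  measurable_pi_lambda _ fun _ => measurable_pi_apply _

variable (κ : Measure S) [IsProbabilityMeasure κ]

lemma measurePreserving_reindex {e : ℤ → ℤ} (he : Function.Injective e) :
    MeasurePreserving (fun (ω : ℤ → S) i => ω (e i)) (Measure.infinitePi fun _ : ℤ => κ)
      (Measure.infinitePi fun _ : ℤ => κ) :=
  ⟨measurable_pi_lambda _ fun _ => measurable_pi_apply _,
    Measure.map_infinitePi_infinitePi_of_inj (P := fun _ : ℤ => κ) he⟩

/-- Far translates of a cylinder are independent of it. -/
lemma exists_measure_inter_shiftBy_eq {d : ℤ} (hd : d ≠ 0) {A : Set (ℤ → S)}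
    (hA : A ∈ measurableCylinders fun _ : ℤ => S) :
    ∃ n : ℕ, (Measure.infinitePi fun _ : ℤ => κ) (A ∩ ((shiftBy d)^[n] ⁻¹' A))
      = (Measure.infinitePi fun _ : ℤ => κ) A * (Measure.infinitePi fun _ : ℤ => κ) A := by
  classical
  obtain ⟨I, B, hB, rfl⟩ := (mem_measurableCylinders _).1 hA
  obtain ⟨N, hN⟩ : ∃ N : ℕ, ∀ i ∈ I, |i| < N := by
    refine ⟨(I.sup fun i => i.natAbs) + 1, fun i hi => ?_⟩
    have : i.natAbs ≤ I.sup fun i => i.natAbs := Finset.le_sup (f := fun i : ℤ => i.natAbs) hi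
    rw [Int.abs_eq_natAbs]
    exact_mod_cast Nat.lt_succ_of_le this
  set n := 2 * N
  set J : Finset ℤ := I.image fun i => i + n * d
  have hIJ : Disjoint I J := by
    rw [Finset.disjoint_left]
    intro j hj hj'
    obtain ⟨i, hi, rfl⟩ := Finset.mem_image.1 hj'
    have h1 := hN _ hi
    have h2 := hN _ hj
    have hNp : (0 : ℤ) < N := (abs_nonneg _).trans_lt h1
    have h3 : |(n : ℤ) * d| < 2 * N := by
      have : (n : ℤ) * d = (i + n * d) - i := by ring
      rw [this]
      exact (abs_sub _ _).trans_lt (by linarith)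
    rw [abs_mul] at h3
    have h4 : (1 : ℤ) ≤ |d| := Int.one_le_abs hd
    have h5 : |(n : ℤ)| = 2 * N := by simp [n]
    rw [h5] at h3
    nlinarith
  have hind := (iIndepFun_infinitePi (P := fun _ : ℤ => κ) (X := fun _ (x : S) => x)
    (fun _ => measurable_id)).indepFun_finset I J hIJ fun i => measurable_pi_apply i
  let φ : (J → S) → (I → S) := fun η i =>
    η ⟨i + n * d, Finset.mem_image.2 ⟨i, i.2, rfl⟩⟩
  have hφ : Measurable φ := measurable_pi_lambda _ fun i => measurable_pi_apply _
  refine ⟨n, ?_⟩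
  have e : (shiftBy d)^[n] ⁻¹' (cylinder I B)
      = (fun (ω : ℤ → S) (i : J) => ω i) ⁻¹' (φ ⁻¹' B) := by
    ext ω
    rw [mem_preimage, shiftBy_iterate]
    rfl
  have hpres : (Measure.infinitePi fun _ : ℤ => κ) ((shiftBy d)^[n] ⁻¹' (cylinder I B))
      = (Measure.infinitePi fun _ : ℤ => κ) (cylinder I B) :=
    ((measurePreserving_reindex κ (e := fun i => i + d) fun _ _ h =>
      add_right_cancel h).iterate n).measure_preimage
        (MeasurableSet.cylinder I hB).nullMeasurableSet
  have := hind.measure_inter_preimage_eq_mul B (φ ⁻¹' B) hB (hφ hB)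
  rw [← e] at this
  refine this.trans ?_
  rw [hpres]
  rfl

/-- An invariant set is close to a cylinder, and a cylinder is independent of its far translates: so
the measure of an invariant set is equal to its square. -/
theorem ergodic_shiftBy {d : ℤ} (hd : d ≠ 0) :
    Ergodic (shiftBy d) (Measure.infinitePi fun _ : ℤ => κ) := by
  set μ := Measure.infinitePi fun _ : ℤ => κ
  have hmp : MeasurePreserving (shiftBy d) μ μ :=
    measurePreserving_reindex κ (e := fun i => i + d) fun _ _ h => add_right_cancel h
  refine ⟨hmp, ⟨fun s hs hinv => ?_⟩⟩
  have hdense := Measure.MeasureDense.of_generateFrom_isSetAlgebra_finite (μ := μ)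
    (𝒜 := measurableCylinders fun _ : ℤ => S)
    isSetAlgebra_measurableCylinders generateFrom_measurableCylinders.symm
  have hinvn : ∀ n, (shiftBy d)^[n] ⁻¹' s = s := fun n => by
    induction n with
    | zero => rfl
    | succ n ih => rw [Function.iterate_succ, preimage_comp, ih, hinv]
  have key : ∀ ε : ℝ, 0 < ε → |μ.real s - μ.real s * μ.real s| ≤ 4 * ε := by
    intro ε hε
    obtain ⟨A, hA, hAs⟩ := hdense.approx s hs (measure_ne_top _ _) ε hε
    have hAm : MeasurableSet A := .of_mem_measurableCylinders hA
    have hAs' : μ.real (symmDiff s A) ≤ ε := ENNReal.toReal_le_of_le_ofReal hε.le hAs.le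
    have hdiff : ∀ t u : Set (ℤ → S), |μ.real t - μ.real u| ≤ μ.real (symmDiff t u) := by
      have h1 : ∀ t u : Set (ℤ → S), μ.real t ≤ μ.real u + μ.real (symmDiff t u) := fun t u => by
        refine (measureReal_mono (fun x hx => ?_)).trans (measureReal_union_le _ _)
        by_cases hxu : x ∈ u
        · exact Or.inl hxu
        · exact Or.inr (Or.inl ⟨hx, hxu⟩)
      intro t u
      have h2 := h1 u t
      rw [symmDiff_comm] at h2
      rw [abs_le]
      constructor <;> linarith [h1 t u]
    obtain ⟨n, hn⟩ := exists_measure_inter_shiftBy_eq κ hd hA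
    have hn' : μ.real (A ∩ ((shiftBy d)^[n] ⁻¹' A)) = μ.real A * μ.real A := by
      simp only [measureReal_def, μ, hn, ENNReal.toReal_mul]
    have h1 : |μ.real s - μ.real A| ≤ ε := (hdiff s A).trans hAs'
    have h2 : |μ.real s - μ.real A * μ.real A| ≤ 2 * ε := by
      rw [← hn']
      refine (hdiff _ _).trans ?_
      have hsub : symmDiff s (A ∩ ((shiftBy d)^[n] ⁻¹' A))
          ⊆ symmDiff s A ∪ (shiftBy d)^[n] ⁻¹' (symmDiff s A) := by
        have hpre : (shiftBy d)^[n] ⁻¹' (symmDiff s A)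
            = symmDiff s ((shiftBy d)^[n] ⁻¹' A) := by
          conv_rhs => rw [← hinvn n]
          rfl
        rw [hpre]
        intro x hx
        simp only [mem_symmDiff, mem_inter_iff, mem_union] at hx ⊢
        tauto
      refine (measureReal_mono hsub).trans ((measureReal_union_le _ _).trans ?_)
      rw [(hmp.iterate n).measureReal_preimage (hs.symmDiff hAm).nullMeasurableSet]
      linarith
    have h3 : |μ.real A * μ.real A - μ.real s * μ.real s| ≤ 2 * ε := by
      have : μ.real A * μ.real A - μ.real s * μ.real s
          = -(μ.real s - μ.real A) * (μ.real A + μ.real s) := by ring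
      rw [this, abs_mul, abs_neg]
      have h4 : |μ.real A + μ.real s| ≤ 2 := by
        rw [abs_of_nonneg (by positivity)]
        linarith [measureReal_le_one (μ := μ) (s := A), measureReal_le_one (μ := μ) (s := s)]
      calc _ ≤ ε * 2 := mul_le_mul h1 h4 (abs_nonneg _) hε.le
        _ = _ := by ring
    have := abs_sub_le (μ.real s) (μ.real A * μ.real A) (μ.real s * μ.real s)
    linarith
  have h0 : μ.real s - μ.real s * μ.real s = 0 := by
    rw [← abs_nonpos_iff]
    refine le_of_forall_pos_le_add fun ε hε => ?_
    have := key (ε / 4) (by positivity)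
    linarith
  have h1 : μ.real s * (1 - μ.real s) = 0 := by linarith
  rw [eventuallyConst_set']
  rcases mul_eq_zero.1 h1 with h | h
  · exact Or.inl (ae_eq_empty.2 ((measureReal_eq_zero_iff).1 h))
  · refine Or.inr (ae_eq_univ.2 ((prob_compl_eq_zero_iff hs).2 ?_))
    have : μ.real s = 1 := by linarith
    rw [measureReal_def] at this
    exact (ENNReal.toReal_eq_one_iff _).1 this

/-- The strong law of large numbers along any sequence of distinct coordinates. -/
lemma ae_tendsto_average {e : ℕ → ℤ} (he : Function.Injective e) {s : S → ℝ} (hs : Measurable s)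
    (hsi : Integrable s κ) :
    ∀ᵐ ω ∂(Measure.infinitePi fun _ : ℤ => κ),
      Tendsto (fun n : ℕ => (∑ i ∈ Finset.range n, s (ω (e i))) / n) atTop (𝓝 (∫ x, s x ∂κ)) := by
  set μ := Measure.infinitePi fun _ : ℤ => κ
  have hev : ∀ i : ℤ, MeasurePreserving (fun ω : ℤ → S => ω i) μ κ := fun i =>
    measurePreserving_eval_infinitePi (fun _ : ℤ => κ) i
  have hind := iIndepFun_infinitePi (P := fun _ : ℤ => κ) (X := fun _ (x : S) => s x) (fun _ => hs)
  have := strong_law_ae_real (μ := μ) (fun i (ω : ℤ → S) => s (ω (e i)))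
    ((hev (e 0)).integrable_comp_of_integrable hsi)
    (fun i j hij => hind.indepFun (he.ne hij))
    (fun i => by
      have hid : ∀ i : ℤ, IdentDistrib (fun ω : ℤ → S => s (ω i)) s μ κ := fun i =>
        ⟨(hs.comp (measurable_pi_apply i)).aemeasurable, hs.aemeasurable, by
          rw [← (hev i).map_eq, Measure.map_map hs (measurable_pi_apply i)]; rfl⟩
      exact (hid (e i)).trans (hid (e 0)).symm)
  have hE : ∫ ω, s (ω (e 0)) ∂μ = ∫ x, s x ∂κ := by
    rw [← (hev (e 0)).map_eq, integral_map (measurable_pi_apply _).aemeasurable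
      hs.aestronglyMeasurable]
  rw [hE] at this
  exact this

end BernoulliShift

instance Sum.discreteMeasurableSpace {α β : Type*} [MeasurableSpace α] [MeasurableSpace β]
    [DiscreteMeasurableSpace α] [DiscreteMeasurableSpace β] : DiscreteMeasurableSpace (α ⊕ β) :=
  ⟨fun _ => measurableSet_sum_iff.2 ⟨.of_discrete, .of_discrete⟩⟩

/-! ### Heights and balanced words -/

namespace Dyck

variable {m : ℕ}

@[simp] lemma height_zero (ω : ℤ → Bracket m) : height ω 0 = 0 := by simp [height]

lemma height_succ (ω : ℤ → Bracket m) (i : ℤ) : height ω (i + 1) = height ω i + sign (ω i) := by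
  unfold height
  rcases le_or_gt 0 i with h | h
  · have h1 : Finset.Ico (i + 1) 0 = ∅ := Finset.Ico_eq_empty (by omega)
    have h2 : Finset.Ico i 0 = ∅ := Finset.Ico_eq_empty (by omega)
    have h3 : Finset.Ico 0 (i + 1) = insert i (Finset.Ico 0 i) := by
      ext j; simp only [Finset.mem_Ico, Finset.mem_insert]; omega
    rw [h1, h2, h3, Finset.sum_insert (by simp)]
    simp [add_comm]
  · have h1 : Finset.Ico 0 (i + 1) = ∅ := Finset.Ico_eq_empty (by omega)
    have h2 : Finset.Ico 0 i = ∅ := Finset.Ico_eq_empty (by omega)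
    have h3 : Finset.Ico i 0 = insert i (Finset.Ico (i + 1) 0) := by
      ext j; simp only [Finset.mem_Ico, Finset.mem_insert]; omega
    rw [h1, h2, h3, Finset.sum_insert (by simp)]
    simp

lemma height_succ_of_inl {ω : ℤ → Bracket m} {i : ℤ} {l : Fin m} (h : ω i = Sum.inl l) :
    height ω (i + 1) = height ω i + 1 := by rw [height_succ, h]; rfl

lemma height_succ_of_inr {ω : ℤ → Bracket m} {i : ℤ} {l : Fin m} (h : ω i = Sum.inr l) :
    height ω (i + 1) = height ω i - 1 := by rw [height_succ, h]; rfl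

lemma height_congr {ω ω' : ℤ → Bracket m} (h : ∀ i, sign (ω i) = sign (ω' i)) :
    height ω = height ω' := by
  funext i; simp [height, h]

/-- The height stays at least `height ω r` during the `n` steps after time `r`. -/
def StaysAbove (ω : ℤ → Bracket m) (r : ℤ) (n : ℕ) : Prop :=
  ∀ k : ℕ, k ≤ n → height ω r ≤ height ω (r + k)

/-- The subword of length `n` that starts at `r` is a well-nested bracket pattern (the subscripts
of the brackets being ignored). -/
def Balanced (ω : ℤ → Bracket m) (r : ℤ) (n : ℕ) : Prop :=
  StaysAbove ω r n ∧ height ω (r + n) = height ω r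

/-- Matching brackets have the same subscript. -/
def Matched (ω : ℤ → Bracket m) : Prop :=
  ∀ (s : ℤ) (n : ℕ) (i j : Fin m), Balanced ω (s + 1) n → ω s = Sum.inl i →
    ω (s + 1 + n) = Sum.inr j → i = j

lemma StaysAbove.mono {ω : ℤ → Bracket m} {r : ℤ} {n n' : ℕ} (h : StaysAbove ω r n) (hn : n' ≤ n) :
    StaysAbove ω r n' := fun k hk => h k (hk.trans hn)

/-- The last bracket of a word that stays above its initial height, if it is a right bracket,
closes a balanced subword. -/
lemma StaysAbove.exists_match {ω : ℤ → Bracket m} {r : ℤ} {n : ℕ} {j : Fin m}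
    (h : StaysAbove ω r (n + 1)) (hj : ω (r + n) = Sum.inr j) :
    ∃ s k : ℕ, ∃ i, s + k + 1 = n ∧ StaysAbove ω r s ∧ height ω (r + s) = height ω (r + (n + 1)) ∧
      ω (r + s) = Sum.inl i ∧ Balanced ω (r + s + 1) k := by
  have hlast := height_succ_of_inr hj
  -- `s` is the last time before the final bracket at which the height is at most the final one
  have hex : ∃ s : ℕ, s ≤ n ∧ height ω (r + s) ≤ height ω (r + (n + 1)) ∧
      ∀ t : ℕ, s < t → t ≤ n → height ω (r + (n + 1)) < height ω (r + t) := by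
    have h0 : ∃ s ≤ n, height ω (r + (s : ℕ)) ≤ height ω (r + (n + 1)) := by
      refine ⟨0, Nat.zero_le _, ?_⟩
      have := h (n + 1) le_rfl
      push_cast at this
      simpa using this
    classical
    let P : ℕ → Prop := fun s => height ω (r + (s : ℕ)) ≤ height ω (r + (n + 1))
    refine ⟨Nat.findGreatest P n, Nat.findGreatest_le n, ?_, fun t h1 h2 => ?_⟩
    · obtain ⟨s, hs, hs'⟩ := h0
      exact Nat.findGreatest_spec (P := P) hs hs'
    · exact not_le.1 (Nat.findGreatest_is_greatest (P := P) h1 h2)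
  obtain ⟨s, hsn, hs, hgt⟩ := hex
  rw [← add_assoc] at hs hgt
  have hsn' : s < n := by
    refine hsn.lt_of_ne fun e => ?_
    subst e
    omega
  have h1 := hgt (s + 1) (Nat.lt_succ_self s) hsn'
  push_cast at h1
  rw [← add_assoc] at h1
  rcases hω : ω (r + s) with i | i
  · have h2 := height_succ_of_inl hω
    have heq : height ω (r + s) = height ω (r + n + 1) := by omega
    refine ⟨s, n - s - 1, i, by omega, h.mono (by omega), by rw [heq, add_assoc], hω, ?_, ?_⟩
    · intro k hk
      have := hgt (s + 1 + k) (by omega) (by omega)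
      push_cast at this
      rw [show r + (s : ℤ) + 1 + k = r + (s + 1 + k) by ring]
      omega
    · have : r + (s : ℤ) + 1 + (n - s - 1 : ℕ) = r + n := by omega
      rw [this]
      omega
  · have h2 := height_succ_of_inr hω
    omega

/-- Induction on the nesting structure of balanced words. -/
theorem Balanced.induction {ω : ℤ → Bracket m} {motive : ℤ → ℕ → Prop}
    (nil : ∀ r, motive r 0)
    (step : ∀ (r : ℤ) (s k : ℕ) (i j : Fin m), Balanced ω r s → Balanced ω (r + s + 1) k →
      ω (r + s) = Sum.inl i → ω (r + s + 1 + k) = Sum.inr j → motive r s →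
      motive (r + s + 1) k → motive r (s + k + 2))
    {r : ℤ} {n : ℕ} (h : Balanced ω r n) : motive r n := by
  induction n using Nat.strong_induction_on generalizing r with
  | _ n ih =>
    rcases n with _ | n
    · exact nil r
    · have h1 := h.1 n (Nat.le_succ n)
      have h2 := h.2
      push_cast at h2
      rw [← add_assoc] at h2
      rcases hω : ω (r + n) with j | j
      · have := height_succ_of_inl hω
        omega
      · obtain ⟨s, k, i, hn, hs, hh, hi, hk⟩ := h.1.exists_match hω
        have hbs : Balanced ω r s := ⟨hs, by rw [hh, ← add_assoc, h2]⟩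
        have e : r + (s : ℤ) + 1 + k = r + n := by omega
        have := step r s k i j hbs hk hi (by rw [e, hω]) (ih s (by omega) hbs)
          (ih k (by omega) hk)
        rw [show n + 1 = s + k + 2 by omega]
        exact this

/-- Induction on the structure of words that stay above their initial height. -/
theorem StaysAbove.induction {ω : ℤ → Bracket m} {r : ℤ} {motive : ℕ → Prop}
    (nil : motive 0)
    (push : ∀ (n : ℕ) (i : Fin m), StaysAbove ω r n → ω (r + n) = Sum.inl i → motive n →
      motive (n + 1))
    (bal : ∀ (s k : ℕ), StaysAbove ω r s → Balanced ω (r + s) k → motive s → motive (s + k))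
    {n : ℕ} (h : StaysAbove ω r n) : motive n := by
  induction n using Nat.strong_induction_on with
  | _ n ih =>
    rcases n with _ | n
    · exact nil
    · rcases hω : ω (r + n) with j | j
      · exact push n j (h.mono (Nat.le_succ n)) hω (ih n (Nat.lt_succ_self n) (h.mono (Nat.le_succ n)))
      · obtain ⟨s, k, i, hn, hs, hh, hi, hk⟩ := h.exists_match hω
        have hb : Balanced ω (r + s) (k + 2) := by
          have h1 := height_succ_of_inl hi
          refine ⟨fun t ht => ?_, ?_⟩
          · rcases t with _ | t
            · simp
            · by_cases htk : t ≤ k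
              · have := hk.1 t htk
                have e : r + (s : ℤ) + (t + 1 : ℕ) = r + s + 1 + t := by push_cast; ring
                rw [e]
                omega
              · have e : r + (s : ℤ) + (t + 1 : ℕ) = r + (n + 1) := by omega
                rw [e, hh]
          · have e : r + (s : ℤ) + (k + 2 : ℕ) = r + (n + 1) := by omega
            rw [e, hh]
        have := bal s (k + 2) hs hb (ih s (by omega) hs)
        rwa [show s + (k + 2) = n + 1 by omega] at this

/-- If the height tends to `-∞` in the past then there are arbitrarily early times at which the
height is at most all the heights until time `i`. -/
lemma exists_record {ω : ℤ → Bracket m} (hω : Tendsto (height ω) atBot atBot) (N i : ℤ) :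
    ∃ r ≤ N, ∀ j, r ≤ j → j ≤ i → height ω r ≤ height ω j := by
  obtain ⟨M, hM⟩ : ∃ M, ∀ j, N ≤ j → j ≤ i → M ≤ height ω j := by
    obtain ⟨M, hM⟩ := ((Finset.Icc N i).image (height ω)).bddBelow
    exact ⟨M, fun j h1 h2 => hM (Finset.mem_coe.2
      (Finset.mem_image_of_mem _ (Finset.mem_Icc.2 ⟨h1, h2⟩)))⟩
  obtain ⟨r, ⟨hr1, hr2⟩, hmax⟩ := Int.exists_greatest_of_bdd
    (P := fun j => j ≤ N ∧ height ω j ≤ M) ⟨N, fun z hz => hz.1⟩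
    (((hω.eventually_le_atBot M).and (eventually_le_atBot N)).exists.imp fun z hz => ⟨hz.2, hz.1⟩)
  refine ⟨r, hr1, fun j h1 h2 => ?_⟩
  rcases h1.eq_or_lt with rfl | h1
  · exact le_rfl
  · by_cases hjN : j ≤ N
    · have : ¬ height ω j ≤ M := fun h => absurd (hmax j ⟨hjN, h⟩) (not_le.2 h1)
      omega
    · exact hr2.trans (hM j (by omega) h2)

/-- A right bracket is matched if the height was at some earlier time at most the height after
this bracket. -/
lemma exists_match_of_le {ω : ℤ → Bracket m} {i j : ℤ} (hji : j ≤ i)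
    (h : height ω j < height ω i) :
    ∃ (k : ℕ) (l : Fin m), Balanced ω (i - k) k ∧ ω (i - k - 1) = Sum.inl l := by
  obtain ⟨s, ⟨hs1, hs2⟩, hmax⟩ := Int.exists_greatest_of_bdd
    (P := fun j => j ≤ i ∧ height ω j < height ω i) ⟨i, fun z hz => hz.1⟩ ⟨j, hji, h⟩
  have hsi : s < i := hs1.lt_of_ne fun e => by rw [e] at hs2; exact lt_irrefl _ hs2
  have hgt : ∀ t, s < t → t ≤ i → height ω i ≤ height ω t := fun t h1 h2 => by
    by_contra hlt
    exact absurd (hmax t ⟨h2, not_le.1 hlt⟩) (not_le.2 h1)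
  have h1 := hgt (s + 1) (by omega) (by omega)
  rcases hω : ω s with l | l
  · have h2 := height_succ_of_inl hω
    have heq : height ω (s + 1) = height ω i := by omega
    refine ⟨(i - s - 1).toNat, l, ⟨fun k hk => ?_, ?_⟩, ?_⟩
    · have e : i - ((i - s - 1).toNat : ℤ) = s + 1 := by omega
      rw [e, heq]
      exact hgt _ (by omega) (by omega)
    · have e : i - ((i - s - 1).toNat : ℤ) = s + 1 := by omega
      rw [e, heq]
      congr 1
      omega
    · rw [← hω]; congr 1; omega
  · have h2 := height_succ_of_inr hω
    omega

/-- A position is matched to at most one left bracket. -/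
lemma match_unique {ω : ℤ → Bracket m} {i : ℤ} {k k' : ℕ} {l l' : Fin m}
    (h : Balanced ω (i - k) k) (hl : ω (i - k - 1) = Sum.inl l)
    (h' : Balanced ω (i - k') k') (hl' : ω (i - k' - 1) = Sum.inl l') : l = l' := by
  have key : ∀ {k k' : ℕ} {l : Fin m}, Balanced ω (i - k) k → ω (i - k - 1) = Sum.inl l →
      Balanced ω (i - k') k' → k' ≤ k := by
    intro k k' l h hl h'
    by_contra hlt
    have h1 := h'.1 (k' - k - 1) (by omega)
    have e1 : i - (k' : ℤ) + (k' - k - 1 : ℕ) = i - k - 1 := by omega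
    rw [e1] at h1
    have h2 := h'.2
    have h3 := h.2
    rw [sub_add_cancel] at h2 h3
    have h4 := height_succ_of_inl hl
    rw [sub_add_cancel] at h4
    omega
  have hkk : k = k' := le_antisymm (key h' hl' h) (key h hl h')
  subst hkk
  rw [hl] at hl'
  exact Sum.inl.inj hl'

/-! ### The Dyck monoid -/

/-- The subword of length `n` that starts at `r`. -/
def subword (ω : ℤ → Bracket m) (r : ℤ) (n : ℕ) : List (Bracket m) :=
  List.ofFn fun k : Fin n => ω (r + (k : ℕ))

lemma subword_add (ω : ℤ → Bracket m) (r : ℤ) (n k : ℕ) :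
    subword ω r (n + k) = subword ω r n ++ subword ω (r + n) k := by
  simp only [subword]
  rw [List.ofFn_add]
  congr 1
  congr 1
  funext j
  congr 1
  simp only [Fin.val_natAdd]
  push_cast; ring

lemma subword_one (ω : ℤ → Bracket m) (r : ℤ) : subword ω r 1 = [ω r] := by
  simp [subword]

lemma red_append (v w : List (Bracket m)) : red (v ++ w) = red v * red w := by
  simp [red]

@[simp] lemma red_nil : red ([] : List (Bracket m)) = 1 := by simp [red]

lemma of_mul_of_eq_one (i : Fin m) : red [Sum.inl i, Sum.inr i] = 1 := by
  refine Eq.trans ?_ (PresentedMonoid.mk_eq_mk_of_rel (Rel.same i))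
  simp [red, PresentedMonoid.of]

lemma red_pair_of_ne {i j : Fin m} (h : i ≠ j) : red [Sum.inl i, Sum.inr j] = zero m := by
  refine Eq.trans ?_ (PresentedMonoid.mk_eq_mk_of_rel (Rel.diff i j h))
  simp [red, PresentedMonoid.of]

lemma red_mul_zero (w : List (Bracket m)) : red w * zero m = zero m := by
  induction w with
  | nil => simp
  | cons γ w ih =>
    have h1 : red (γ :: w) = PresentedMonoid.of (Rel m) (some γ) * red w := by simp [red]
    have h2 : PresentedMonoid.of (Rel m) (some γ) * zero m = zero m :=
      PresentedMonoid.mk_eq_mk_of_rel (Rel.zero_right (some γ))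
    rw [h1, mul_assoc, ih, h2]

/-- The action of the Dyck monoid on stacks (`none` being the failure state): `β_j` pushes `j`,
and `α_i` pops `i` and fails if the top of the stack is not `i`. -/
def act : Option (Bracket m) → Function.End (Option (List (Fin m)))
  | some (Sum.inl i) => fun s => s.bind fun l => if l.head? = some i then some l.tail else none
  | some (Sum.inr j) => fun s => s.map (j :: ·)
  | none => fun _ => none

lemma act_rel (v w : FreeMonoid (Option (Bracket m))) (h : Rel m v w) :
    FreeMonoid.lift act v = FreeMonoid.lift act w := by
  cases h with
  | same i =>
    rw [map_mul, map_one, FreeMonoid.lift_eval_of, FreeMonoid.lift_eval_of]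
    funext s
    change act (some (Sum.inl i)) (act (some (Sum.inr i)) s) = s
    cases s <;> simp [act]
  | diff i j hij =>
    rw [map_mul, FreeMonoid.lift_eval_of, FreeMonoid.lift_eval_of, FreeMonoid.lift_eval_of]
    funext s
    change act (some (Sum.inl i)) (act (some (Sum.inr j)) s) = none
    cases s <;> simp [act, hij.symm]
  | zero_left γ =>
    rw [map_mul, FreeMonoid.lift_eval_of, FreeMonoid.lift_eval_of]
    rfl
  | zero_right γ =>
    rw [map_mul, FreeMonoid.lift_eval_of, FreeMonoid.lift_eval_of]
    funext s
    rcases γ with _ | _ | _ <;> rfl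

/-- A product of left brackets is not zero. -/
lemma red_map_inl_ne_zero (w : List (Fin m)) : red (w.map Sum.inl) ≠ zero m := by
  intro h
  have h1 := congrArg (PresentedMonoid.lift act act_rel) h
  have key : ∀ (w t : List (Fin m)), (PresentedMonoid.lift act act_rel (red (w.map Sum.inl)))
      (some (w.reverse ++ t)) = some t := by
    intro w
    induction w with
    | nil => intro t; simp [Function.End.one_def]
    | cons i w ih =>
      intro t
      have e : red ((i :: w).map Sum.inl)
          = PresentedMonoid.of (Rel m) (some (Sum.inl i)) * red (w.map Sum.inl) := by simp [red]
      have e2 : (i :: w).reverse ++ t = w.reverse ++ (i :: t) := by simp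
      rw [e, map_mul, PresentedMonoid.lift_of, e2]
      refine (congrArg (act (some (Sum.inl i))) (ih _)).trans ?_
      simp [act]
  have h2 := key w []
  rw [h1, zero, PresentedMonoid.lift_of] at h2
  simp [act] at h2

lemma red_subword_succ (ω : ℤ → Bracket m) (r : ℤ) (s k : ℕ) :
    red (subword ω r (s + k + 2)) = red (subword ω r s) * (red [ω (r + s)]
      * red (subword ω (r + s + 1) k) * red [ω (r + s + 1 + k)]) := by
  rw [show s + k + 2 = s + (1 + (k + 1)) by ring, subword_add, subword_add, subword_add,
    subword_one, subword_one, red_append, red_append, red_append]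
  simp only [mul_assoc, Nat.cast_one]

/-- The balanced subwords of a sequence in the Dyck shift have the value `1`. -/
lemma red_subword_of_mem_shift {ω : ℤ → Bracket m} (hω : ω ∈ shift m) {r : ℤ} {n : ℕ}
    (h : Balanced ω r n) : red (subword ω r n) = 1 := by
  refine h.induction (motive := fun r n => red (subword ω r n) = 1) (fun r => by simp [subword]) ?_
  intro r s k i j _ _ hi hj h1 h2
  have h3 := red_subword_succ ω r s k
  rw [h1, h2, hi, hj, one_mul, mul_one, ← red_append] at h3
  rw [h3]
  by_cases hij : i = j
  · rw [hij]; exact of_mul_of_eq_one j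
  · exact absurd (h3.trans (red_pair_of_ne hij)) (hω r _)

lemma matched_of_mem_shift {ω : ℤ → Bracket m} (hω : ω ∈ shift m) : Matched ω := by
  intro s n i j hb hi hj
  by_contra hij
  have h3 := red_subword_succ ω s 0 n
  simp only [Nat.cast_zero, add_zero] at h3
  rw [red_subword_of_mem_shift hω hb, hi, hj, mul_one, ← red_append] at h3
  refine hω s (0 + n + 2) (h3.trans ?_)
  have e : red (subword ω s 0) = 1 := by simp [subword]
  rw [e, one_mul]
  exact red_pair_of_ne hij

lemma Matched.red_subword {ω : ℤ → Bracket m} (hω : Matched ω) {r : ℤ} {n : ℕ}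
    (h : Balanced ω r n) : red (subword ω r n) = 1 := by
  refine h.induction (motive := fun r n => red (subword ω r n) = 1) (fun r => by simp [subword]) ?_
  intro r s k i j _ hk hi hj h1 h2
  rw [red_subword_succ ω r s k, h1, h2, hi, hj, one_mul, mul_one, ← red_append,
    hω _ _ _ _ hk hi hj]
  exact of_mul_of_eq_one j

lemma Matched.exists_red_subword {ω : ℤ → Bracket m} (hω : Matched ω) {r : ℤ} {n : ℕ}
    (h : StaysAbove ω r n) : ∃ w : List (Fin m), red (subword ω r n) = red (w.map Sum.inl) := by
  refine h.induction (motive := fun n => ∃ w : List (Fin m),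
    red (subword ω r n) = red (w.map Sum.inl)) ⟨[], by simp [subword]⟩ ?_ ?_
  · rintro n i - hi ⟨w, hw⟩
    refine ⟨w ++ [i], ?_⟩
    rw [subword_add, subword_one, red_append, hw, hi, List.map_append, red_append]
    rfl
  · rintro s k - hb ⟨w, hw⟩
    refine ⟨w, ?_⟩
    rw [subword_add, red_append, hω.red_subword hb, mul_one, hw]

lemma Matched.mem_shift {ω : ℤ → Bracket m} (hω : Matched ω)
    (hH : Tendsto (height ω) atBot atBot) : ω ∈ shift m := by
  intro i n h0
  change red (subword ω i n) = zero m at h0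
  obtain ⟨r, hr, hrec⟩ := exists_record hH i (i + n)
  have habove : StaysAbove ω r ((i - r).toNat + n) := fun k hk => hrec _ (by omega) (by omega)
  obtain ⟨w, hw⟩ := hω.exists_red_subword habove
  rw [subword_add, red_append, show r + ((i - r).toNat : ℤ) = i by omega, h0, red_mul_zero] at hw
  exact red_map_inl_ne_zero w hw.symm

/-! ### Reversal -/

/-- Time reversal: `ω` is read backwards and left and right brackets are exchanged. -/
def rev (ω : ℤ → Bracket m) : ℤ → Bracket m := fun k => (ω (-1 - k)).swap

@[simp] lemma rev_rev (ω : ℤ → Bracket m) : rev (rev ω) = ω := by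
  funext k; simp [rev]

lemma sign_swap (γ : Bracket m) : sign γ.swap = -sign γ := by cases γ <;> simp [sign]

lemma height_rev (ω : ℤ → Bracket m) (i : ℤ) : height (rev ω) i = height ω (-i) := by
  have hstep : ∀ i, height (rev ω) (i + 1) = height (rev ω) i - sign (ω (-1 - i)) := fun i => by
    rw [height_succ]; simp only [rev, sign_swap]; ring
  have hstep' : ∀ i, height ω (-i) = height ω (-(i + 1)) + sign (ω (-1 - i)) := fun i => by
    have := height_succ ω (-(i + 1))
    rw [show -(i + 1) + 1 = -i by ring] at this
    rw [this]; congr 3; ring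
  induction i using Int.induction_on with
  | zero => simp
  | succ i ih => rw [hstep, ih, hstep']; ring
  | pred i ih =>
    have h1 := hstep (-i - 1)
    have h2 := hstep' (-i - 1)
    rw [sub_add_cancel] at h1 h2
    omega

/-- The antiautomorphism of the Dyck monoid that exchanges `α_i` and `β_i`. -/
def revHom (m : ℕ) : PresentedMonoid (Rel m) →* (PresentedMonoid (Rel m))ᵐᵒᵖ :=
  PresentedMonoid.lift (fun γ => MulOpposite.op (PresentedMonoid.of (Rel m) (γ.map Sum.swap))) (by
    intro v w h
    cases h with
    | same i =>
      rw [map_mul, map_one, FreeMonoid.lift_eval_of, FreeMonoid.lift_eval_of, ← MulOpposite.op_mul]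
      exact congrArg MulOpposite.op (PresentedMonoid.mk_eq_mk_of_rel (Rel.same i))
    | diff i j hij =>
      rw [map_mul, FreeMonoid.lift_eval_of, FreeMonoid.lift_eval_of, FreeMonoid.lift_eval_of,
        ← MulOpposite.op_mul]
      exact congrArg MulOpposite.op (PresentedMonoid.mk_eq_mk_of_rel (Rel.diff j i hij.symm))
    | zero_left γ =>
      rw [map_mul, FreeMonoid.lift_eval_of, FreeMonoid.lift_eval_of, ← MulOpposite.op_mul]
      exact congrArg MulOpposite.op (PresentedMonoid.mk_eq_mk_of_rel (Rel.zero_right _))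
    | zero_right γ =>
      rw [map_mul, FreeMonoid.lift_eval_of, FreeMonoid.lift_eval_of, ← MulOpposite.op_mul]
      exact congrArg MulOpposite.op (PresentedMonoid.mk_eq_mk_of_rel (Rel.zero_left _)))

lemma revHom_red (w : List (Bracket m)) :
    revHom m (red w) = MulOpposite.op (red (w.map Sum.swap).reverse) := by
  induction w with
  | nil => simp
  | cons γ w ih =>
    have h1 : red (γ :: w) = PresentedMonoid.of (Rel m) (some γ) * red w := by simp [red]
    rw [h1, map_mul, ih, List.map_cons, List.reverse_cons, red_append, MulOpposite.op_mul]
    congr 1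

lemma subword_rev (ω : ℤ → Bracket m) (i : ℤ) (n : ℕ) :
    ((subword (rev ω) i n).map Sum.swap).reverse = subword ω (-i - n) n := by
  refine List.ext_getElem (by simp [subword]) fun k h1 h2 => ?_
  have hk : k < n := by simpa [subword] using h2
  simp only [subword, List.getElem_reverse, List.getElem_map, List.getElem_ofFn, List.length_map,
    List.length_ofFn, rev, Sum.swap_swap]
  congr 1
  omega

lemma rev_mem_shift {ω : ℤ → Bracket m} (hω : ω ∈ shift m) : rev ω ∈ shift m := by
  intro i n h
  have h1 := congrArg (revHom m) h
  change revHom m (red (subword (rev ω) i n)) = revHom m (zero m) at h1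
  rw [revHom_red, subword_rev] at h1
  exact hω _ n (MulOpposite.op_injective h1)

lemma rev_mem_setBα {ω : ℤ → Bracket m} (hω : ω ∈ setBβ m) : rev ω ∈ setBα m := by
  refine ⟨rev_mem_shift hω.1, fun i => ?_⟩
  rcases hω.2 (-1 - i) with ⟨l, hl⟩ | ⟨⟨l, hl⟩, k, hk, h⟩
  · exact Or.inl ⟨l, by simp [rev, hl]⟩
  · refine Or.inr ⟨⟨l, by simp [rev, hl]⟩, k, hk, ?_⟩
    rw [height_rev, height_rev, show -(i - (k : ℤ) + 1) = -1 - i + k by ring, h]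
    congr 1; ring

lemma rev_mem_setBβ {ω : ℤ → Bracket m} (hω : ω ∈ setBα m) : rev ω ∈ setBβ m := by
  refine ⟨rev_mem_shift hω.1, fun i => ?_⟩
  rcases hω.2 (-1 - i) with ⟨l, hl⟩ | ⟨⟨l, hl⟩, k, hk, h⟩
  · exact Or.inl ⟨l, by simp [rev, hl]⟩
  · refine Or.inr ⟨⟨l, by simp [rev, hl]⟩, k, hk, ?_⟩
    rw [height_rev, height_rev, show -(i + (k : ℤ)) = -1 - i - k + 1 by ring, h]
    congr 1; ring

lemma rev_mem_setAβ {ω : ℤ → Bracket m} (hω : ω ∈ setAα m) : rev ω ∈ setAβ m := by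
  have e : height (rev ω) = height ω ∘ Neg.neg := funext fun i => height_rev ω i
  refine ⟨rev_mem_shift hω.1, ?_, ?_⟩ <;> rw [e]
  · exact hω.2.2.comp tendsto_neg_atTop_atBot
  · exact hω.2.1.comp tendsto_neg_atBot_atTop

lemma rev_mem_setAα {ω : ℤ → Bracket m} (hω : ω ∈ setAβ m) : rev ω ∈ setAα m := by
  have e : height (rev ω) = height ω ∘ Neg.neg := funext fun i => height_rev ω i
  refine ⟨rev_mem_shift hω.1, ?_, ?_⟩ <;> rw [e]
  · exact hω.2.2.comp tendsto_neg_atTop_atBot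
  · exact hω.2.1.comp tendsto_neg_atBot_atTop

lemma measurable_rev : Measurable (rev : (ℤ → Bracket m) → ℤ → Bracket m) :=
  measurable_pi_lambda _ fun k => (measurable_of_finite Sum.swap).comp (measurable_pi_apply (-1 - k))

end Dyck

/-! ### Filling in the subscripts of the right brackets -/

/-- If `g` inverts `f`, and `f` is almost surjective, then pulling a measure back by `f` amounts to
pushing it forward by `g`. -/
lemma MeasureTheory.Measure.map_comap_eq_map {S X Y : Type*} [MeasurableSpace S]
    [MeasurableSpace X] [MeasurableSpace Y] {μ : Measure Y} {ι : S → X} (hιm : Measurable ι)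
    (hι : Function.Injective ι)
    (hS : ∀ E : Set S, MeasurableSet E → ∃ F : Set X, MeasurableSet F ∧ ι ⁻¹' F = E)
    {f : S → Y} {g : Y → X} (hg : Measurable g) (hgf : ∀ s, g (f s) = ι s)
    (hf : ∀ᵐ y ∂μ, y ∈ range f) : (μ.comap f).map ι = μ.map g := by
  have hinj : Function.Injective f := fun s t h => hι (by rw [← hgf, ← hgf, h])
  have himg : ∀ F : Set X, f '' (ι ⁻¹' F) =ᵐ[μ] g ⁻¹' F := by
    intro F
    filter_upwards [hf] with y hy
    obtain ⟨s, rfl⟩ := hy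
    refine propext ⟨?_, fun h => ⟨s, ?_, rfl⟩⟩
    · rintro ⟨t, ht, hts⟩
      change g (f s) ∈ F
      rw [← hts, hgf]
      exact ht
    · change ι s ∈ F
      rw [← hgf]
      exact h
  ext F hF
  rw [Measure.map_apply hιm hF, Measure.map_apply hg hF, Measure.comap_apply₀ f μ hinj]
  · exact measure_congr (himg F)
  · intro E hE
    obtain ⟨F', hF', rfl⟩ := hS E hE
    exact (hg hF').nullMeasurableSet.congr (himg F').symm
  · exact (hιm hF).nullMeasurableSet

namespace Dyck

open BernoulliShift

variable {m : ℕ}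

lemma height_shiftBy (d : ℤ) (ω : ℤ → Bracket m) (i : ℤ) :
    height (shiftBy d ω) i = height ω (i + d) - height ω d := by
  induction i using Int.induction_on with
  | zero => simp
  | succ i ih =>
    rw [height_succ, ih, show (i : ℤ) + 1 + d = i + d + 1 by ring, height_succ ω]
    simp only [shiftBy]; ring
  | pred i ih =>
    have h1 := height_succ (shiftBy d ω) (-i - 1)
    have h2 := height_succ ω (-i - 1 + d)
    rw [sub_add_cancel, ih] at h1
    rw [show (-(i : ℤ) - 1 + d) + 1 = -i + d by ring] at h2
    simp only [shiftBy] at h1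
    linarith

lemma balanced_shiftBy (d : ℤ) (ω : ℤ → Bracket m) (r : ℤ) (n : ℕ) :
    Balanced (shiftBy d ω) r n ↔ Balanced ω (r + d) n := by
  simp only [Balanced, StaysAbove, height_shiftBy]
  have : ∀ k : ℕ, r + (k : ℤ) + d = r + d + k := fun k => by ring
  simp only [this, sub_le_sub_iff_right, sub_left_inj]

variable [NeZero m]

/-- The bracket sequence in which every right bracket gets the same subscript. -/
def arbitraryFill (η : ℤ → Fin m ⊕ Unit) : ℤ → Bracket m :=
  fun i => Sum.map id (fun _ => 0) (η i)

/-- The position `i` is matched to a left bracket with subscript `l`. -/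
def IsMatchLabel (η : ℤ → Fin m ⊕ Unit) (i : ℤ) (l : Fin m) : Prop :=
  ∃ k : ℕ, Balanced (arbitraryFill η) (i - k) k ∧ η (i - k - 1) = Sum.inl l

open Classical in
/-- The bracket sequence in which every right bracket gets the subscript of the left bracket that
it is matched to, if there is one. -/
noncomputable def fill (η : ℤ → Fin m ⊕ Unit) (i : ℤ) : Bracket m :=
  match η i with
  | Sum.inl l => Sum.inl l
  | Sum.inr _ => if h : ∃ l, IsMatchLabel η i l then Sum.inr h.choose else Sum.inr 0

lemma arbitraryFill_of_inl {η : ℤ → Fin m ⊕ Unit} {i : ℤ} {l : Fin m} (h : η i = Sum.inl l) :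
    arbitraryFill η i = Sum.inl l := by simp [arbitraryFill, h]

lemma fill_of_inl {η : ℤ → Fin m ⊕ Unit} {i : ℤ} {l : Fin m} (h : η i = Sum.inl l) :
    fill η i = Sum.inl l := by simp [fill, h]

lemma exists_fill_of_inr {η : ℤ → Fin m ⊕ Unit} {i : ℤ} {u : Unit} (h : η i = Sum.inr u) :
    ∃ l, fill η i = Sum.inr l := by
  simp only [fill, h]
  split_ifs <;> exact ⟨_, rfl⟩

lemma forgetRight_fill (η : ℤ → Fin m ⊕ Unit) : forgetRight (fill η) = η := by
  funext i
  rcases h : η i with l | u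
  · simp [forgetRight, fill_of_inl h]
  · obtain ⟨l, hl⟩ := exists_fill_of_inr h
    simp [forgetRight, hl]

lemma fill_eq_inl_iff {η : ℤ → Fin m ⊕ Unit} {i : ℤ} {l : Fin m} :
    fill η i = Sum.inl l ↔ η i = Sum.inl l := by
  refine ⟨fun h => ?_, fill_of_inl⟩
  rw [← forgetRight_fill η]
  simp [forgetRight, h]

lemma fill_eq_inr {η : ℤ → Fin m ⊕ Unit} {i : ℤ} {l : Fin m} (h : fill η i = Sum.inr l) :
    η i = Sum.inr () := by
  rw [← forgetRight_fill η]
  simp [forgetRight, h]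

lemma height_fill (η : ℤ → Fin m ⊕ Unit) : height (fill η) = height (arbitraryFill η) := by
  refine height_congr fun i => ?_
  rcases h : η i with l | u
  · rw [fill_of_inl h, arbitraryFill_of_inl h]
  · obtain ⟨l, hl⟩ := exists_fill_of_inr h
    rw [hl]
    simp [arbitraryFill, h, sign]

lemma balanced_fill {η : ℤ → Fin m ⊕ Unit} {r : ℤ} {n : ℕ} :
    Balanced (fill η) r n ↔ Balanced (arbitraryFill η) r n := by
  simp only [Balanced, StaysAbove, height_fill]

lemma IsMatchLabel.unique {η : ℤ → Fin m ⊕ Unit} {i : ℤ} {l l' : Fin m} (h : IsMatchLabel η i l)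
    (h' : IsMatchLabel η i l') : l = l' := by
  obtain ⟨k, hk, hl⟩ := h
  obtain ⟨k', hk', hl'⟩ := h'
  exact match_unique hk (arbitraryFill_of_inl hl) hk' (arbitraryFill_of_inl hl')

lemma fill_of_isMatchLabel {η : ℤ → Fin m ⊕ Unit} {i : ℤ} {u : Unit} {l : Fin m}
    (h : η i = Sum.inr u) (hl : IsMatchLabel η i l) : fill η i = Sum.inr l := by
  have hex : ∃ l, IsMatchLabel η i l := ⟨l, hl⟩
  simp only [fill, h, dif_pos hex]
  rw [hex.choose_spec.unique hl]

lemma matched_fill (η : ℤ → Fin m ⊕ Unit) : Matched (fill η) := by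
  intro s n i j hb hi hj
  have h := fill_of_isMatchLabel (l := i) (fill_eq_inr hj) ⟨n, by
    rw [add_sub_cancel_right]; exact balanced_fill.1 hb, by
    rw [add_sub_cancel_right, add_sub_cancel_right]; exact fill_eq_inl_iff.1 hi⟩
  rw [hj] at h
  exact (Sum.inr.inj h).symm

lemma fill_mem_setBα {η : ℤ → Fin m ⊕ Unit} (h : Tendsto (height (fill η)) atBot atBot) :
    fill η ∈ setBα m := by
  refine ⟨(matched_fill η).mem_shift h, fun i => ?_⟩
  rcases hi : fill η i with l | l
  · exact Or.inl ⟨l, rfl⟩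
  · refine Or.inr ⟨⟨l, rfl⟩, ?_⟩
    obtain ⟨j, hj1, hj2⟩ := ((eventually_le_atBot i).and
      (h.eventually_lt_atBot (height (fill η) i))).exists
    obtain ⟨k, l', hb, hl'⟩ := exists_match_of_le hj1 hj2
    refine ⟨k + 2, by omega, ?_⟩
    have h1 := height_succ_of_inr hi
    have h2 := height_succ_of_inl hl'
    have h3 := hb.2
    rw [sub_add_cancel] at h2 h3
    rw [show i - ((k + 2 : ℕ) : ℤ) + 1 = i - k - 1 by push_cast; ring]
    omega

lemma fill_forgetRight {ω : ℤ → Bracket m} (hω : ω ∈ setBα m) : fill (forgetRight ω) = ω := by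
  have hH : height (arbitraryFill (forgetRight ω)) = height ω := height_congr fun i => by
    rcases h : ω i with l | l <;> simp [arbitraryFill, forgetRight, h, sign]
  funext i
  rcases hω.2 i with ⟨l, hl⟩ | ⟨⟨l, hl⟩, k, hk, h⟩
  · rw [hl]
    exact fill_of_inl (by simp [forgetRight, hl])
  · have h1 := height_succ_of_inr hl
    have hk1 : 1 ≤ k := hk
    obtain ⟨n, l', hb, hl'⟩ := exists_match_of_le (ω := ω) (i := i) (j := i - k + 1) (by omega)
      (by omega)
    have hll : l' = l := matched_of_mem_shift hω.1 (i - n - 1) n l' l (by rwa [sub_add_cancel]) hl'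
      (by rwa [sub_add_cancel, sub_add_cancel])
    rw [hl]
    refine fill_of_isMatchLabel (u := ()) (by simp [forgetRight, hl]) ⟨n, ?_, ?_⟩
    · simp only [Balanced, StaysAbove, hH]
      exact hb
    · simp [forgetRight, hl', hll]

lemma fill_shiftBy (d : ℤ) (η : ℤ → Fin m ⊕ Unit) :
    fill (shiftBy d η) = shiftBy d (fill η) := by
  have hlab : ∀ i l, IsMatchLabel (shiftBy d η) i l ↔ IsMatchLabel η (i + d) l := by
    intro i l
    have e : arbitraryFill (shiftBy d η) = shiftBy d (arbitraryFill η) := rfl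
    simp only [IsMatchLabel, e, balanced_shiftBy, shiftBy]
    have h1 : ∀ k : ℕ, i - (k : ℤ) + d = i + d - k := fun k => by ring
    have h2 : ∀ k : ℕ, i - (k : ℤ) - 1 + d = i + d - k - 1 := fun k => by ring
    simp only [h1, h2]
  funext i
  rcases h : η (i + d) with l | u
  · have h' : shiftBy d η i = Sum.inl l := h
    exact (fill_of_inl h').trans (fill_of_inl h).symm
  · have h' : shiftBy d η i = Sum.inr u := h
    by_cases hex : ∃ l, IsMatchLabel η (i + d) l
    · obtain ⟨l, hl⟩ := hex
      exact (fill_of_isMatchLabel h' ((hlab i l).2 hl)).trans (fill_of_isMatchLabel h hl).symm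
    · have hex' : ¬ ∃ l, IsMatchLabel (shiftBy d η) i l := by simpa only [hlab] using hex
      have e1 : fill (shiftBy d η) i = Sum.inr 0 := by
        simp only [fill, h', dif_neg hex']
      have e2 : fill η (i + d) = Sum.inr 0 := by simp only [fill, h, dif_neg hex]
      exact e1.trans e2.symm

omit [NeZero m] in
lemma measurable_height (i : ℤ) : Measurable fun ω : ℤ → Bracket m => height ω i := by
  unfold height
  have h : ∀ j : ℤ, Measurable fun ω : ℤ → Bracket m => sign (ω j) := fun j =>
    (measurable_of_finite sign).comp (measurable_pi_apply j)
  exact (Finset.measurable_sum _ fun j _ => h j).sub (Finset.measurable_sum _ fun j _ => h j)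

lemma measurable_arbitraryFill : Measurable (arbitraryFill (m := m)) :=
  measurable_pi_lambda _ fun i =>
    (measurable_of_finite (Sum.map id fun _ : Unit => (0 : Fin m))).comp (measurable_pi_apply i)

lemma measurableSet_isMatchLabel (i : ℤ) (l : Fin m) :
    MeasurableSet {η : ℤ → Fin m ⊕ Unit | IsMatchLabel η i l} := by
  have hH : ∀ j, Measurable fun η : ℤ → Fin m ⊕ Unit => height (arbitraryFill η) j := fun j =>
    (measurable_height j).comp measurable_arbitraryFill
  have e : {η : ℤ → Fin m ⊕ Unit | IsMatchLabel η i l} = ⋃ k : ℕ,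
      ((⋂ j : ℕ, ⋂ _ : j ≤ k, {η | height (arbitraryFill η) (i - k)
          ≤ height (arbitraryFill η) (i - k + j)})
        ∩ {η | height (arbitraryFill η) (i - k + k) = height (arbitraryFill η) (i - k)})
      ∩ {η | η (i - k - 1) = Sum.inl l} := by
    ext η
    simp [IsMatchLabel, Balanced, StaysAbove]
  rw [e]
  refine MeasurableSet.iUnion fun k => ((MeasurableSet.iInter fun j => MeasurableSet.iInter fun _ =>
    measurableSet_le (hH _) (hH _)).inter (measurableSet_eq_fun (hH _) (hH _))).inter ?_
  exact (measurable_pi_apply (X := fun _ : ℤ => Fin m ⊕ Unit) (i - k - 1))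
    (measurableSet_singleton (Sum.inl l))

lemma measurable_fill : Measurable (fill (m := m)) := by
  refine measurable_pi_lambda _ fun i => measurable_to_countable' fun γ => ?_
  have hη : ∀ x, MeasurableSet {η : ℤ → Fin m ⊕ Unit | η i = x} := fun x =>
    (measurable_pi_apply (X := fun _ : ℤ => Fin m ⊕ Unit) i) (measurableSet_singleton x)
  rcases γ with l | l
  · convert hη (Sum.inl l) using 1
    ext η
    exact fill_eq_inl_iff
  · have e : (fun η : ℤ → Fin m ⊕ Unit => fill η i) ⁻¹' {Sum.inr l}
        = {η | η i = Sum.inr ()} ∩ ({η | IsMatchLabel η i l}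
          ∪ ((⋃ l', {η | IsMatchLabel η i l'})ᶜ ∩ {_η | l = 0})) := by
      ext η
      constructor
      · intro h
        have h' : fill η i = Sum.inr l := h
        refine ⟨fill_eq_inr h', ?_⟩
        by_cases hex : ∃ l', IsMatchLabel η i l'
        · obtain ⟨l', hl'⟩ := hex
          rw [fill_of_isMatchLabel (fill_eq_inr h') hl'] at h'
          rw [← Sum.inr.inj h']
          exact Or.inl hl'
        · refine Or.inr ⟨by simpa using hex, ?_⟩
          simp only [fill, fill_eq_inr h', dif_neg hex] at h'
          exact (Sum.inr.inj h').symm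
      · rintro ⟨h1, h2⟩
        have h1' : η i = Sum.inr () := h1
        rcases h2 with h2 | ⟨h2, h3⟩
        · exact fill_of_isMatchLabel h1' h2
        · have hex : ¬ ∃ l', IsMatchLabel η i l' := by simpa using h2
          have h3' : l = 0 := h3
          simp only [mem_preimage, fill, h1', dif_neg hex, h3', mem_singleton_iff]
    rw [e]
    exact (hη _).inter ((measurableSet_isMatchLabel i l).union
      ((MeasurableSet.iUnion fun l' => measurableSet_isMatchLabel i l').compl.inter
        (MeasurableSet.const _)))

/-! ### Typical sequences -/

/-- The height has linear growth in both directions, and there are right brackets arbitrarily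
late and early. -/
structure Typical (ω : ℤ → Bracket m) : Prop where
  drift : ∃ c > (0 : ℝ), (∀ᶠ k : ℕ in atTop, c * k ≤ height ω k) ∧
    ∀ᶠ k : ℕ in atTop, (height ω (-k) : ℝ) ≤ -(c * k)
  inr_after : ∀ N, ∃ j ≥ N, ∃ l, ω j = Sum.inr l
  inr_before : ∀ N, ∃ j ≤ N, ∃ l, ω j = Sum.inr l

omit [NeZero m] in
lemma sum_range_sign (ω : ℤ → Bracket m) (n : ℕ) :
    ∑ i ∈ Finset.range n, (sign (ω i) : ℝ) = height ω n := by
  induction n with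
  | zero => simp
  | succ n ih => rw [Finset.sum_range_succ, ih]; push_cast; rw [height_succ]; push_cast; rfl

omit [NeZero m] in
lemma sum_range_sign_neg (ω : ℤ → Bracket m) (n : ℕ) :
    ∑ i ∈ Finset.range n, (sign (ω (-1 - i)) : ℝ) = -height ω (-n) := by
  induction n with
  | zero => simp
  | succ n ih =>
    have := height_succ ω (-1 - n)
    rw [show (-1 - (n : ℤ)) + 1 = -n by ring] at this
    rw [Finset.sum_range_succ, ih, this, show -((n + 1 : ℕ) : ℤ) = -1 - n by push_cast; ring]
    push_cast
    ring

lemma tendsto_toNat_atTop : Tendsto Int.toNat atTop atTop :=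
  tendsto_atTop.2 fun n => (eventually_ge_atTop (n : ℤ)).mono fun i hi => by omega

/-- If the averages of a sequence of signs have a limit less than `1` then `-1` recurs. -/
lemma exists_ge_of_tendsto_average {s : ℕ → ℝ} {c : ℝ} (hc : c < 1)
    (h : Tendsto (fun n : ℕ => (∑ i ∈ Finset.range n, s i) / n) atTop (𝓝 c)) (N : ℕ) :
    ∃ j ≥ N, s j ≠ 1 := by
  by_contra! hN
  have h1 : ∀ n, ∑ i ∈ Finset.range (N + n), s i = ∑ i ∈ Finset.range N, s i + n := by
    intro n
    induction n with
    | zero => simp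
    | succ n ih => rw [← add_assoc, Finset.sum_range_succ, ih, hN _ (by omega)]; push_cast; ring
  have h2 : Tendsto (fun n : ℕ => (∑ i ∈ Finset.range n, s i) / n) atTop (𝓝 1) := by
    have h3 : Tendsto (fun n : ℕ => 1 + (∑ i ∈ Finset.range N, s i - N) / (n : ℝ)) atTop
        (𝓝 (1 + 0)) :=
      tendsto_const_nhds.add (tendsto_const_nhds.div_atTop tendsto_natCast_atTop_atTop)
    rw [add_zero] at h3
    refine h3.congr' ?_
    filter_upwards [eventually_ge_atTop (N + 1)] with n hn
    obtain ⟨k, rfl⟩ := Nat.exists_eq_add_of_le (show N ≤ n by omega)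
    have : ((N + k : ℕ) : ℝ) ≠ 0 := by
      have : N + k ≠ 0 := by omega
      exact_mod_cast this
    rw [h1]
    field_simp
    push_cast; ring
  exact hc.ne (tendsto_nhds_unique h h2)

instance : IsProbabilityMeasure (bernoulli (Fin m ⊕ Unit)) := by
  unfold bernoulli; infer_instance

lemma integral_uniform {S : Type} [Fintype S] [Nonempty S] [MeasurableSpace S]
    [MeasurableSingletonClass S] (s : S → ℝ) :
    ∫ x, s x ∂(PMF.uniformOfFintype S).toMeasure = (∑ x, s x) / Fintype.card S := by
  rw [integral_fintype (.of_finite)]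
  rw [Finset.sum_div]
  refine Finset.sum_congr rfl fun x _ => ?_
  rw [measureReal_def, PMF.toMeasure_apply_singleton _ _ (measurableSet_singleton x)]
  simp [div_eq_inv_mul]

/-- The sign of a symbol in the alphabet with a single right bracket. -/
def symbolSign : Fin m ⊕ Unit → ℝ := Sum.elim (fun _ => 1) (fun _ => -1)

lemma symbolSign_eq (η : ℤ → Fin m ⊕ Unit) (i : ℤ) : symbolSign (η i) = sign (fill η i) := by
  rcases h : η i with l | u
  · rw [fill_of_inl h]; simp [symbolSign, sign]
  · obtain ⟨l, hl⟩ := exists_fill_of_inr h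
    rw [hl]; simp [symbolSign, sign]

lemma ae_typical_fill (hm : 2 ≤ m) : ∀ᵐ η ∂bernoulli (Fin m ⊕ Unit), Typical (fill η) := by
  have hm' : (2 : ℝ) ≤ m := by exact_mod_cast hm
  have hint : ∫ x, symbolSign x ∂(PMF.uniformOfFintype (Fin m ⊕ Unit)).toMeasure
      = (m - 1) / (m + 1) := by
    rw [integral_uniform]
    simp [symbolSign, sub_eq_add_neg]
  have hc0 : (0 : ℝ) < (m - 1) / (m + 1) := div_pos (by linarith) (by linarith)
  have hc1 : ((m : ℝ) - 1) / (m + 1) < 1 := by rw [div_lt_one (by linarith)]; linarith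
  set c : ℝ := (m - 1) / (m + 1)
  have h1 := ae_tendsto_average (PMF.uniformOfFintype (Fin m ⊕ Unit)).toMeasure
    (e := fun i => (i : ℤ)) (fun _ _ h => Int.ofNat_injective h) (s := symbolSign)
    (measurable_of_finite _) .of_finite
  have h2 := ae_tendsto_average (PMF.uniformOfFintype (Fin m ⊕ Unit)).toMeasure
    (e := fun i => -1 - (i : ℤ)) (fun i j h => by simp only at h; omega) (s := symbolSign)
    (measurable_of_finite _) .of_finite
  rw [hint] at h1 h2
  filter_upwards [h1, h2] with η h1 h2
  simp only [symbolSign_eq] at h1 h2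
  have hinr : ∀ i, (sign (fill η i) : ℝ) ≠ 1 → ∃ l, fill η i = Sum.inr l := by
    intro i hi
    rcases h : fill η i with l | l
    · rw [h] at hi; simp [sign] at hi
    · exact ⟨l, rfl⟩
  refine ⟨⟨c / 2, half_pos hc0, ?_, ?_⟩, fun N => ?_, fun N => ?_⟩
  · filter_upwards [h1.eventually_const_lt (half_lt_self hc0), eventually_gt_atTop 0] with k hk h0
    have h0' : (0 : ℝ) < k := by exact_mod_cast h0
    rw [sum_range_sign, lt_div_iff₀ h0'] at hk
    exact hk.le
  · filter_upwards [h2.eventually_const_lt (half_lt_self hc0), eventually_gt_atTop 0] with k hk h0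
    have h0' : (0 : ℝ) < k := by exact_mod_cast h0
    rw [sum_range_sign_neg, lt_div_iff₀ h0'] at hk
    linarith
  · obtain ⟨j, hj, hs⟩ := exists_ge_of_tendsto_average hc1 h1 N.toNat
    exact ⟨j, by omega, hinr _ hs⟩
  · obtain ⟨j, hj, hs⟩ := exists_ge_of_tendsto_average hc1 h2 (-N).toNat
    exact ⟨-1 - j, by omega, hinr _ hs⟩

omit [NeZero m] in
lemma Typical.tendsto_atTop {ω : ℤ → Bracket m} (h : Typical ω) :
    Tendsto (height ω) atTop atTop := by
  obtain ⟨c, hc, h1, -⟩ := h.drift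
  have h2 : Tendsto (fun k : ℕ => height ω k) atTop atTop := by
    rw [← tendsto_intCast_atTop_iff (R := ℝ)]
    exact tendsto_atTop_mono' _ h1 (tendsto_natCast_atTop_atTop.const_mul_atTop hc)
  refine (h2.comp tendsto_toNat_atTop).congr' ?_
  filter_upwards [eventually_ge_atTop 0] with i hi
  simp [hi]

omit [NeZero m] in
lemma Typical.tendsto_atBot {ω : ℤ → Bracket m} (h : Typical ω) :
    Tendsto (height ω) atBot atBot := by
  obtain ⟨c, hc, -, h1⟩ := h.drift
  have h2 : Tendsto (fun k : ℕ => height ω (-k)) atTop atBot := by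
    rw [← tendsto_intCast_atBot_iff (R := ℝ)]
    refine tendsto_atBot_mono' _ h1 (tendsto_neg_atTop_atBot.comp
      (tendsto_natCast_atTop_atTop.const_mul_atTop hc))
  refine (h2.comp (tendsto_toNat_atTop.comp tendsto_neg_atBot_atTop)).congr' ?_
  filter_upwards [eventually_le_atBot 0] with i hi
  simp [hi]

omit [NeZero m] in
lemma exists_inl_of_tendsto {ω : ℤ → Bracket m} (h : Tendsto (height ω) atTop atTop) (N : ℤ) :
    ∃ j ≥ N, ∃ l, ω j = Sum.inl l := by
  by_contra! hN
  have h1 : ∀ k : ℕ, height ω (N + k) ≤ height ω N := by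
    intro k
    induction k with
    | zero => simp
    | succ k ih =>
      rcases hω : ω (N + k) with l | l
      · exact absurd hω (hN _ (by omega) l)
      · have := height_succ_of_inr hω
        push_cast
        rw [← add_assoc]
        omega
  obtain ⟨i, hi1, hi2⟩ := ((h.eventually_gt_atTop (height ω N)).and (eventually_ge_atTop N)).exists
  have := h1 (i - N).toNat
  rw [show N + ((i - N).toNat : ℤ) = i by omega] at this
  omega

omit [NeZero m] in
lemma exists_inl_of_tendsto_atBot {ω : ℤ → Bracket m} (h : Tendsto (height ω) atBot atBot)
    (N : ℤ) : ∃ j ≤ N, ∃ l, ω j = Sum.inl l := by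
  by_contra! hN
  have h1 : ∀ k : ℕ, height ω (N + 1) ≤ height ω (N + 1 - k) := by
    intro k
    induction k with
    | zero => simp
    | succ k ih =>
      rcases hω : ω (N + 1 - (k + 1 : ℕ)) with l | l
      · exact absurd hω (hN _ (by omega) l)
      · have := height_succ_of_inr hω
        rw [show N + 1 - ((k + 1 : ℕ) : ℤ) + 1 = N + 1 - k by push_cast; ring] at this
        omega
  obtain ⟨i, hi1, hi2⟩ := ((h.eventually_lt_atBot (height ω (N + 1))).and
    (eventually_le_atBot N)).exists
  have := h1 (N + 1 - i).toNat
  rw [show N + 1 - ((N + 1 - i).toNat : ℤ) = i by omega] at this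
  omega

omit [NeZero m] in
lemma Typical.mem_setAα {ω : ℤ → Bracket m} (h : Typical ω) (hs : ω ∈ shift m) : ω ∈ setAα m :=
  ⟨hs, h.tendsto_atTop, h.tendsto_atBot⟩

/-! ### The two measures as images of the Bernoulli measure -/

/-- Forgetting the subscripts of the right brackets is inverse to filling them in, up to null sets. -/
theorem nuα_eq (hm : 2 ≤ m) : nuα m = (bernoulli (Fin m ⊕ Unit)).map fill := by
  refine Measure.map_comap_eq_map measurable_subtype_coe Subtype.val_injective
    (fun E hE => hE) measurable_fill (fun ω => fill_forgetRight ω.2) ?_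
  filter_upwards [ae_typical_fill hm] with η hη
  exact ⟨⟨fill η, fill_mem_setBα hη.tendsto_atBot⟩, forgetRight_fill η⟩

/-- Time reversal for the alphabets with only one left, or only one right, bracket. -/
def revSymbols (η : ℤ → Unit ⊕ Fin m) : ℤ → Fin m ⊕ Unit := fun k => (η (-1 - k)).swap

lemma measurePreserving_revSymbols :
    MeasurePreserving (revSymbols (m := m)) (bernoulli (Unit ⊕ Fin m))
      (bernoulli (Fin m ⊕ Unit)) := by
  have h1 : MeasurePreserving (fun (η : ℤ → Unit ⊕ Fin m) k => η (-1 - k))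
      (bernoulli (Unit ⊕ Fin m)) (bernoulli (Unit ⊕ Fin m)) :=
    measurePreserving_reindex _ (e := fun k => -1 - k) sub_right_injective
  have h2 : MeasurePreserving (fun (η : ℤ → Unit ⊕ Fin m) k => (η k).swap)
      (bernoulli (Unit ⊕ Fin m)) (bernoulli (Fin m ⊕ Unit)) := by
    refine ⟨measurable_pi_lambda _ fun k =>
      (measurable_of_finite Sum.swap).comp (measurable_pi_apply k), ?_⟩
    have := Measure.infinitePi_map_pi (fun _ : ℤ => (PMF.uniformOfFintype (Unit ⊕ Fin m)).toMeasure)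
      (f := fun _ => Sum.swap) fun _ => measurable_of_finite _
    refine this.trans ?_
    unfold bernoulli
    congr 1
    funext _
    ext s hs
    rw [Measure.map_apply (measurable_of_finite _) hs,
      PMF.toMeasure_apply_fintype, PMF.toMeasure_apply_fintype,
      ← (Equiv.sumComm Unit (Fin m)).sum_comp]
    refine Finset.sum_congr rfl fun x _ => ?_
    have hc : Fintype.card (Unit ⊕ Fin m) = Fintype.card (Fin m ⊕ Unit) :=
      Fintype.card_congr (Equiv.sumComm _ _)
    simp only [indicator, PMF.uniformOfFintype_apply, hc]
    rfl
  exact h2.comp h1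

omit [NeZero m] in
lemma revSymbols_forgetLeft (ω : ℤ → Bracket m) :
    revSymbols (forgetLeft ω) = forgetRight (rev ω) := by
  funext k
  rcases h : ω (-1 - k) with l | l <;> simp [revSymbols, forgetLeft, forgetRight, rev, h]

omit [NeZero m] in
lemma revSymbols_injective : Function.Injective (revSymbols (m := m)) := by
  intro η η' h
  funext k
  have := congrFun h (-1 - k)
  simp only [revSymbols, sub_sub_cancel] at this
  exact Sum.swap_leftInverse.injective this

/-- Time reversal of `nuα_eq`. -/
theorem nuβ_eq (hm : 2 ≤ m) :
    nuβ m = (bernoulli (Fin m ⊕ Unit)).map fun η => rev (fill η) := by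
  have hmeas : Measurable fun η : ℤ → Fin m ⊕ Unit => rev (fill η) :=
    measurable_rev.comp measurable_fill
  have hrev := measurePreserving_revSymbols (m := m)
  rw [← hrev.map_eq, Measure.map_map hmeas hrev.measurable]
  refine Measure.map_comap_eq_map measurable_subtype_coe Subtype.val_injective
    (fun E hE => hE) (hmeas.comp hrev.measurable) (fun ω => ?_) ?_
  · simp only [Function.comp, revSymbols_forgetLeft]
    rw [fill_forgetRight (rev_mem_setBα ω.2), rev_rev]
  · filter_upwards [hrev.quasiMeasurePreserving.ae (ae_typical_fill hm)]
      with η hη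
    refine ⟨⟨rev (fill (revSymbols η)), rev_mem_setBβ (fill_mem_setBα hη.tendsto_atBot)⟩, ?_⟩
    refine revSymbols_injective ?_
    simp only [revSymbols_forgetLeft, rev_rev, forgetRight_fill]

end Dyck

/-! ### Iterated affine maps -/

namespace Affine

variable {Γ : Type*} (A B : Γ → ℝ)

/-- The product of the slopes of the first `n` maps `t ↦ A (u j) t + B (u j)`. -/
def slope (u : ℕ → Γ) (n : ℕ) : ℝ := ∏ i ∈ Finset.range n, A (u i)

/-- The value at `0` of the composition of the maps number `0, 1, …, n - 1` (the map number `0` is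
the outermost one). -/
def offset (u : ℕ → Γ) (n : ℕ) : ℝ := ∑ j ∈ Finset.range n, slope A u j * B (u j)

/-- The limit of the compositions of the maps number `0, 1, …, n - 1` as `n → ∞`. -/
noncomputable def value (u : ℕ → Γ) : ℝ := limsup (offset A B u) atTop

variable {A B}

lemma eq_slope_mul_add_offset {u : ℕ → Γ} {t : ℕ → ℝ}
    (h : ∀ j, t j = A (u j) * t (j + 1) + B (u j)) (n : ℕ) :
    t 0 = slope A u n * t n + offset A B u n := by
  induction n with
  | zero => simp [slope, offset]
  | succ n ih =>
    rw [ih, h n]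
    simp only [slope, offset, Finset.sum_range_succ, Finset.prod_range_succ]
    ring

lemma offset_succ (u : ℕ → Γ) (n : ℕ) :
    offset A B u (n + 1) = A (u 0) * offset A B (fun j => u (j + 1)) n + B (u 0) := by
  simp only [offset, slope]
  rw [Finset.sum_range_succ', Finset.mul_sum]
  simp only [Finset.prod_range_zero, one_mul]
  congr 1
  refine Finset.sum_congr rfl fun j _ => ?_
  rw [Finset.prod_range_succ', mul_comm (∏ k ∈ Finset.range j, A (u (k + 1))), mul_assoc]

lemma measurable_value [MeasurableSpace Γ] [Finite Γ] [DiscreteMeasurableSpace Γ] :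
    Measurable (value A B) := by
  refine Measurable.limsup fun n => ?_
  unfold offset slope
  have h : ∀ (F : Γ → ℝ) (j : ℕ), Measurable fun u : ℕ → Γ => F (u j) := fun F j =>
    (measurable_of_finite F).comp (measurable_pi_apply j)
  exact Finset.measurable_sum _ fun j _ => (Finset.measurable_prod _ fun i _ => h A i).mul (h B j)

/-- A bounded orbit is determined by the sequence of maps if the slopes tend to `0`. -/
lemma value_eq_of_tendsto_slope {u : ℕ → Γ} {t : ℕ → ℝ}
    (h : ∀ j, t j = A (u j) * t (j + 1) + B (u j)) (ht : ∀ j, t j ∈ Icc (0 : ℝ) 1)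
    (hs : Tendsto (slope A u) atTop (𝓝 0)) : value A B u = t 0 := by
  have h1 : Tendsto (fun n => slope A u n * t n) atTop (𝓝 0) := by
    refine squeeze_zero_norm (a := fun n => ‖slope A u n‖) (fun n => ?_) (by simpa using hs.norm)
    rw [norm_mul]
    refine mul_le_of_le_one_right (norm_nonneg _) ?_
    rw [Real.norm_eq_abs, abs_of_nonneg (ht n).1]
    exact (ht n).2
  have h2 : Tendsto (offset A B u) atTop (𝓝 (t 0)) := by
    have : offset A B u = fun n => t 0 - slope A u n * t n := by
      funext n
      rw [eq_slope_mul_add_offset h n]; ring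
    rw [this]
    simpa using h1.const_sub (t 0)
  exact h2.limsup_eq

lemma value_eq_of_tendsto {u : ℕ → Γ} {v : ℝ}
    (h : Tendsto (offset A B (fun j => u (j + 1))) atTop (𝓝 v)) :
    Tendsto (offset A B u) atTop (𝓝 (A (u 0) * v + B (u 0))) := by
  rw [← tendsto_add_atTop_iff_nat 1]
  simp only [offset_succ]
  exact (h.const_mul _).add_const _

/-- The maps `t ↦ A γ t + B γ` are increasing contractions of the unit interval into itself. -/
structure Contracting (A B : Γ → ℝ) (θ : ℝ) : Prop where
  pos : ∀ γ, 0 < A γ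
  le : ∀ γ, A γ ≤ θ
  lt_one : θ < 1
  nonneg : ∀ γ, 0 ≤ B γ
  add_le : ∀ γ, A γ + B γ ≤ 1

namespace Contracting

variable {θ : ℝ} (h : Contracting A B θ)
include h

lemma slope_pos (u : ℕ → Γ) (n : ℕ) : 0 < slope A u n := Finset.prod_pos fun _ _ => h.pos _

lemma slope_le (u : ℕ → Γ) (n : ℕ) : slope A u n ≤ θ ^ n := by
  unfold slope
  refine (Finset.prod_le_prod (fun _ _ => (h.pos _).le) fun _ _ => h.le _).trans_eq ?_
  simp

lemma tendsto_slope (u : ℕ → Γ) : Tendsto (slope A u) atTop (𝓝 0) :=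
  squeeze_zero (fun n => (h.slope_pos u n).le) (h.slope_le u)
    (tendsto_pow_atTop_nhds_zero_of_lt_one ((h.pos (u 0)).le.trans (h.le _)) h.lt_one)

lemma offset_mem (u : ℕ → Γ) (n : ℕ) : offset A B u n ∈ Icc (0 : ℝ) 1 := by
  induction n generalizing u with
  | zero => simp [offset]
  | succ n ih =>
    rw [offset_succ]
    obtain ⟨h0, h1⟩ := ih fun j => u (j + 1)
    have ha := h.pos (u 0)
    have hb := h.nonneg (u 0)
    have hab := h.add_le (u 0)
    constructor <;> nlinarith

lemma tendsto_offset (u : ℕ → Γ) : Tendsto (offset A B u) atTop (𝓝 (value A B u)) := by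
  have hmono : Monotone (offset A B u) := monotone_nat_of_le_succ fun n => by
    simp only [offset, Finset.sum_range_succ]
    have := mul_nonneg (h.slope_pos u n).le (h.nonneg (u n))
    linarith
  have := tendsto_atTop_ciSup hmono ⟨1, by rintro _ ⟨n, rfl⟩; exact (h.offset_mem u n).2⟩
  rwa [value, this.limsup_eq]

lemma value_mem (u : ℕ → Γ) : value A B u ∈ Icc (0 : ℝ) 1 :=
  isClosed_Icc.mem_of_tendsto (h.tendsto_offset u) (Eventually.of_forall (h.offset_mem u))

lemma value_eq (u : ℕ → Γ) :
    value A B u = A (u 0) * value A B (fun j => u (j + 1)) + B (u 0) :=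
  tendsto_nhds_unique (h.tendsto_offset u) (value_eq_of_tendsto (h.tendsto_offset _))

lemma value_pos {u : ℕ → Γ} (hu : ∃ j, 0 < B (u j)) : 0 < value A B u := by
  obtain ⟨j, hj⟩ := hu
  induction j generalizing u with
  | zero =>
    rw [h.value_eq]
    have := mul_nonneg (h.pos (u 0)).le (h.value_mem fun j => u (j + 1)).1
    linarith
  | succ j ih =>
    rw [h.value_eq]
    have := mul_pos (h.pos (u 0)) (ih (u := fun j => u (j + 1)) hj)
    linarith [h.nonneg (u 0)]

lemma value_lt_one {u : ℕ → Γ} (hu : ∃ j, A (u j) + B (u j) < 1) : value A B u < 1 := by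
  obtain ⟨j, hj⟩ := hu
  induction j generalizing u with
  | zero =>
    rw [h.value_eq]
    have := mul_le_mul_of_nonneg_left (h.value_mem fun j => u (j + 1)).2 (h.pos (u 0)).le
    linarith
  | succ j ih =>
    rw [h.value_eq]
    have := mul_lt_mul_of_pos_left (ih (u := fun j => u (j + 1)) hj) (h.pos (u 0))
    linarith [h.add_le (u 0)]

/-- Sequences that agree in the first `k` places have exponentially close values. -/
lemma abs_value_sub_le {u v : ℕ → Γ} {k : ℕ} (huv : ∀ j < k, u j = v j) :
    |value A B u - value A B v| ≤ θ ^ k := by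
  have key : ∀ u : ℕ → Γ, value A B u
      = slope A u k * value A B (fun j => u (k + j)) + offset A B u k := fun u => by
    have := eq_slope_mul_add_offset (A := A) (B := B) (u := u)
      (t := fun n => value A B fun j => u (n + j)) (fun j => ?_) k
    · simpa using this
    · have := h.value_eq fun i => u (j + i)
      simp only [add_zero] at this
      rw [this]
      congr 3
      funext i
      congr 1; ring
  have e1 : slope A u k = slope A v k :=
    Finset.prod_congr rfl fun j hj => by rw [huv j (Finset.mem_range.1 hj)]
  have e2 : offset A B u k = offset A B v k := by
    refine Finset.sum_congr rfl fun j hj => ?_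
    have hj' := Finset.mem_range.1 hj
    rw [huv j hj']
    congr 1
    exact Finset.prod_congr rfl fun i hi => by rw [huv i ((Finset.mem_range.1 hi).trans hj')]
  rw [key u, key v, e1, e2, add_sub_add_right_eq_sub, ← mul_sub, abs_mul,
    abs_of_pos (h.slope_pos v k)]
  have h1 := h.value_mem fun j => u (k + j)
  have h2 := h.value_mem fun j => v (k + j)
  have h3 : |value A B (fun j => u (k + j)) - value A B (fun j => v (k + j))| ≤ 1 := by
    rw [abs_le]; constructor <;> linarith [h1.1, h1.2, h2.1, h2.2]
  calc _ ≤ θ ^ k * 1 := mul_le_mul (h.slope_le v k) h3 (abs_nonneg _)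
        ((h.slope_pos v k).le.trans (h.slope_le v k))
    _ = _ := mul_one _

end Contracting

end Affine

/-! ### Orbits of the baker map through the interiors of the pieces -/

namespace Baker

open Dyck (Bracket)
open Affine

variable {m : ℕ} {a b : ℝ}

lemma isCompact_cube : IsCompact cube := isCompact_Icc.prod (isCompact_Icc.prod isCompact_Icc)

instance : CompactSpace cube := isCompact_iff_compactSpace.1 isCompact_cube

/-- The open boxes that are the interiors of the pieces. -/
def box (a : ℝ) : Bracket m → Set (ℝ × ℝ × ℝ)
  | Sum.inl i => Ioo ((i : ℕ) * a) (((i : ℕ) + 1) * a) ×ˢ Ioo 0 1 ×ˢ Ioo 0 1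
  | Sum.inr i => Ioo (m * a) 1 ×ˢ Ioo (((i : ℕ) : ℝ) / m) (((i : ℕ) + 1) / m) ×ˢ Ioo 0 1

lemma interior_Ω (ha : a ∈ Ioo (0 : ℝ) (1 / m)) (γ : Bracket m) :
    interior (Ω a γ) = box a γ := by
  obtain ⟨hm, hma⟩ := pos_of_mem ha
  have ha0 := ha.1
  rcases γ with i | i
  · have hi : ((i : ℕ) : ℝ) + 1 ≤ m := by exact_mod_cast i.2
    refine Subset.antisymm ?_ (interior_maximal ?_ (isOpen_Ioo.prod (isOpen_Ioo.prod isOpen_Ioo)))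
    · have hsub : Ω a (Sum.inl i : Bracket m)
          ⊆ Icc ((i : ℕ) * a) (((i : ℕ) + 1) * a) ×ˢ Icc 0 1 ×ˢ Icc 0 1 :=
        fun p hp => ⟨⟨hp.2.1, hp.2.2.le⟩, hp.1.2⟩
      refine (interior_mono hsub).trans_eq ?_
      rw [interior_prod_eq, interior_prod_eq, interior_Icc, interior_Icc]
      rfl
    · rintro ⟨x, y, z⟩ ⟨⟨hx0, hx1⟩, ⟨hy0, hy1⟩, hz0, hz1⟩
      simp only at hx0 hx1 hy0 hy1 hz0 hz1
      have h1 : 0 ≤ ((i : ℕ) : ℝ) * a := by positivity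
      have h2 : (((i : ℕ) : ℝ) + 1) * a ≤ m * a := by gcongr
      exact ⟨⟨⟨by simp only; linarith, by simp only; linarith⟩, ⟨hy0.le, hy1.le⟩, hz0.le, hz1.le⟩,
        hx0.le, hx1⟩
  · have hi : ((i : ℕ) : ℝ) + 1 ≤ m := by exact_mod_cast i.2
    refine Subset.antisymm ?_ (interior_maximal ?_ (isOpen_Ioo.prod (isOpen_Ioo.prod isOpen_Ioo)))
    · have hsub : Ω a (Sum.inr i : Bracket m)
          ⊆ Icc (m * a) 1 ×ˢ Icc (((i : ℕ) : ℝ) / m) (((i : ℕ) + 1) / m) ×ˢ Icc 0 1 := by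
        rintro p ⟨hp, h1, h2, h3⟩
        refine ⟨⟨h1, hp.1.2⟩, ⟨h2, ?_⟩, hp.2.2⟩
        rcases h3 with h3 | ⟨h3, h4⟩
        · exact h3.le
        · have : ((i : ℕ) : ℝ) + 1 = m := by exact_mod_cast h3
          rw [h4, this, div_self hm.ne']
      refine (interior_mono hsub).trans_eq ?_
      rw [interior_prod_eq, interior_prod_eq, interior_Icc, interior_Icc, interior_Icc]
      rfl
    · rintro ⟨x, y, z⟩ ⟨⟨hx0, hx1⟩, ⟨hy0, hy1⟩, hz0, hz1⟩
      simp only at hx0 hx1 hy0 hy1 hz0 hz1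
      have h1 : 0 ≤ (m : ℝ) * a := by positivity
      have h2 : 0 ≤ ((i : ℕ) : ℝ) / m := by positivity
      have h3 : (((i : ℕ) : ℝ) + 1) / m ≤ 1 := (div_le_one hm).2 hi
      exact ⟨⟨⟨by simp only; linarith, hx1.le⟩, ⟨by simp only; linarith, by simp only; linarith⟩,
        hz0.le, hz1.le⟩, hx0.le, hy0.le, Or.inl hy1⟩

/-- The slopes of the inverse branches in the direction of `x`. -/
def xSlope (m : ℕ) (a : ℝ) : Bracket m → ℝ := Sum.elim (fun _ => a) (fun _ => 1 - m * a)

/-- The values at `0` of the inverse branches in the direction of `x`. -/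
def xOffset (m : ℕ) (a : ℝ) : Bracket m → ℝ := Sum.elim (fun i => (i : ℕ) * a) (fun _ => m * a)

/-- The slopes of the branches in the direction of `z`. -/
def zSlope (m : ℕ) (b : ℝ) : Bracket m → ℝ := Sum.elim (fun _ => 1 - m * b) (fun _ => b)

/-- The values at `0` of the branches in the direction of `z`. -/
def zOffset (m : ℕ) (b : ℝ) : Bracket m → ℝ :=
  Sum.elim (fun _ => 0) (fun i => 1 - m * b + b * (i : ℕ))

/-- The slopes of the branches in the direction of `y`. -/
noncomputable def ySlope (m : ℕ) : Bracket m → ℝ := Sum.elim (fun _ => (m : ℝ)⁻¹) (fun _ => m)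

/-- The values at `0` of the branches in the direction of `y`. -/
noncomputable def yOffset (m : ℕ) : Bracket m → ℝ :=
  Sum.elim (fun i => ((i : ℕ) : ℝ) / m) (fun i => -((i : ℕ) : ℝ))

/-- A common bound for the contraction rates in the directions of `x` and `z`. -/
noncomputable def rate (m : ℕ) (a b : ℝ) : ℝ := max (max a (1 - m * a)) (max b (1 - m * b))

lemma lt_one_of_mem (ha : a ∈ Ioo (0 : ℝ) (1 / m)) : a < 1 := by
  obtain ⟨hm, hma⟩ := pos_of_mem ha
  have h1 : (1 : ℝ) ≤ m := by
    have : 0 < m := by exact_mod_cast hm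
    exact_mod_cast this
  nlinarith [ha.1]

lemma rate_lt_one (ha : a ∈ Ioo (0 : ℝ) (1 / m)) (hb : b ∈ Ioo (0 : ℝ) (1 / m)) :
    rate m a b < 1 := by
  obtain ⟨hm, -⟩ := pos_of_mem ha
  have h1 := mul_pos hm ha.1
  have h2 := mul_pos hm hb.1
  exact max_lt (max_lt (lt_one_of_mem ha) (by linarith)) (max_lt (lt_one_of_mem hb) (by linarith))

lemma contracting_x (ha : a ∈ Ioo (0 : ℝ) (1 / m)) (hb : b ∈ Ioo (0 : ℝ) (1 / m)) :
    Contracting (xSlope m a) (xOffset m a) (rate m a b) := by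
  obtain ⟨hm, hma⟩ := pos_of_mem ha
  have ha0 := ha.1
  have h1 := mul_pos hm ha.1
  refine ⟨?_, ?_, rate_lt_one ha hb, ?_, ?_⟩
  · rintro (i | i) <;> simp [xSlope, ha0, hma]
  · rintro (i | i) <;> simp [xSlope, rate]
  · rintro (i | i) <;> simp only [xOffset, Sum.elim_inl, Sum.elim_inr] <;> positivity
  · rintro (i | i) <;> simp only [xSlope, xOffset, Sum.elim_inl, Sum.elim_inr]
    · have hi : ((i : ℕ) : ℝ) + 1 ≤ m := by exact_mod_cast i.2
      nlinarith
    · linarith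

lemma contracting_z (ha : a ∈ Ioo (0 : ℝ) (1 / m)) (hb : b ∈ Ioo (0 : ℝ) (1 / m)) :
    Contracting (zSlope m b) (zOffset m b) (rate m a b) := by
  obtain ⟨hm, hmb⟩ := pos_of_mem hb
  have hb0 := hb.1
  have h1 := mul_pos hm hb.1
  refine ⟨?_, ?_, rate_lt_one ha hb, ?_, ?_⟩
  · rintro (i | i) <;> simp [zSlope, hb0, hmb]
  · rintro (i | i) <;> simp [zSlope, rate]
  · rintro (i | i) <;> simp only [zOffset, Sum.elim_inl, Sum.elim_inr]
    · exact le_rfl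
    · have : 0 ≤ b * ((i : ℕ) : ℝ) := by positivity
      linarith
  · rintro (i | i) <;> simp only [zSlope, zOffset, Sum.elim_inl, Sum.elim_inr]
    · linarith
    · have hi : ((i : ℕ) : ℝ) + 1 ≤ m := by exact_mod_cast i.2
      nlinarith

/-- The letters from time `n` on. -/
def future (ω : ℤ → Bracket m) (n : ℤ) : ℕ → Bracket m := fun j => ω (n + j)

/-- The letters before time `n`, read backwards. -/
def past (ω : ℤ → Bracket m) (n : ℤ) : ℕ → Bracket m := fun j => ω (n - 1 - j)

/-- The coordinate `x` at time `n` of an orbit with itinerary `ω`. -/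
noncomputable def xCoord (a : ℝ) (ω : ℤ → Bracket m) (n : ℤ) : ℝ :=
  value (xSlope m a) (xOffset m a) (future ω n)

/-- The coordinate `z` at time `n` of an orbit with itinerary `ω`. -/
noncomputable def zCoord (b : ℝ) (ω : ℤ → Bracket m) (n : ℤ) : ℝ :=
  value (zSlope m b) (zOffset m b) (past ω n)

/-- The coordinate `y` at time `n` of an orbit with itinerary `ω` whose height tends to `-∞` in
the past: the stack of the unmatched left brackets, read as an expansion to the base `m`. -/
noncomputable def yCoord (ω : ℤ → Bracket m) (n : ℤ) : ℝ :=
  value (ySlope m) (yOffset m) (past ω n)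

/-- `y` runs through the stacks (read as expansions to the base `m`) of an automaton that is driven
by `ω`: `α_i` pushes the digit `i`, and `β_i` pops it. -/
def IsStackPath (ω : ℤ → Bracket m) (y : ℤ → ℝ) : Prop :=
  ∀ n, (∀ i : Fin m, ω n = Sum.inl i → y (n + 1) = (y n + (i : ℕ)) / m) ∧
    ∀ i : Fin m, ω n = Sum.inr i → y n = (y (n + 1) + (i : ℕ)) / m

lemma IsStackPath.rev {ω : ℤ → Bracket m} {y : ℤ → ℝ} (h : IsStackPath ω y) :
    IsStackPath (Dyck.rev ω) fun k => y (-k) := by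
  intro n
  have h' := h (-1 - n)
  rw [show -1 - n + 1 = -n by ring, show -1 - n = -(n + 1) by ring] at h'
  refine ⟨fun i hi => h'.2 i ?_, fun i hi => h'.1 i ?_⟩ <;>
  · have e : ω (-(n + 1)) = (Dyck.rev ω n).swap := by
      simp only [Dyck.rev, Sum.swap_swap]; congr 1; ring
    rw [e, hi]; rfl

lemma past_succ (ω : ℤ → Bracket m) (n : ℤ) : (fun j => past ω (n + 1) (j + 1)) = past ω n := by
  funext j
  simp only [past]
  congr 1
  push_cast; ring

lemma past_succ_zero (ω : ℤ → Bracket m) (n : ℤ) : past ω (n + 1) 0 = ω n := by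
  simp [past]

lemma future_succ (ω : ℤ → Bracket m) (n : ℤ) :
    (fun j => future ω n (j + 1)) = future ω (n + 1) := by
  funext j
  simp only [future]
  congr 1
  push_cast; ring

lemma future_zero (ω : ℤ → Bracket m) (n : ℤ) : future ω n 0 = ω n := by
  simp [future]

section Existence

variable (ha : a ∈ Ioo (0 : ℝ) (1 / m)) (hb : b ∈ Ioo (0 : ℝ) (1 / m))
include ha hb

lemma xCoord_eq (ω : ℤ → Bracket m) (n : ℤ) :
    xCoord a ω n = xSlope m a (ω n) * xCoord a ω (n + 1) + xOffset m a (ω n) := by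
  have := (contracting_x ha hb).value_eq (future ω n)
  rw [future_succ, future_zero] at this
  exact this

lemma zCoord_eq (ω : ℤ → Bracket m) (n : ℤ) :
    zCoord b ω (n + 1) = zSlope m b (ω n) * zCoord b ω n + zOffset m b (ω n) := by
  have := (contracting_z ha hb).value_eq (past ω (n + 1))
  rw [past_succ, past_succ_zero] at this
  exact this

omit hb ha in
lemma exists_future {ω : ℤ → Bracket m} {n : ℤ} {P : Bracket m → Prop} (h : ∃ j ≥ n, P (ω j)) :
    ∃ j, P (future ω n j) := by
  obtain ⟨j, hj, hP⟩ := h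
  refine ⟨(j - n).toNat, ?_⟩
  simp only [future]
  rwa [show n + ((j - n).toNat : ℤ) = j by omega]

omit hb ha in
lemma exists_past {ω : ℤ → Bracket m} {n : ℤ} {P : Bracket m → Prop} (h : ∃ j ≤ n - 1, P (ω j)) :
    ∃ j, P (past ω n j) := by
  obtain ⟨j, hj, hP⟩ := h
  refine ⟨(n - 1 - j).toNat, ?_⟩
  simp only [past]
  rwa [show n - 1 - ((n - 1 - j).toNat : ℤ) = j by omega]

/-- Both kinds of brackets occur arbitrarily late and arbitrarily early. -/
structure _root_.Dyck.Recurrent (ω : ℤ → Bracket m) : Prop where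
  inl_after : ∀ N, ∃ j ≥ N, ∃ l, ω j = Sum.inl l
  inr_after : ∀ N, ∃ j ≥ N, ∃ l, ω j = Sum.inr l
  inl_before : ∀ N, ∃ j ≤ N, ∃ l, ω j = Sum.inl l
  inr_before : ∀ N, ∃ j ≤ N, ∃ l, ω j = Sum.inr l

lemma xCoord_mem {ω : ℤ → Bracket m} (hω : Dyck.Recurrent ω) (n : ℤ) :
    xCoord a ω n ∈ Ioo (0 : ℝ) 1 := by
  obtain ⟨hm, hma⟩ := pos_of_mem ha
  have ha0 := ha.1
  constructor
  · refine (contracting_x ha hb).value_pos (exists_future (P := fun γ => 0 < xOffset m a γ) ?_)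
    obtain ⟨j, hj, l, hl⟩ := hω.inr_after n
    exact ⟨j, hj, by rw [hl]; simp only [xOffset, Sum.elim_inr]; positivity⟩
  · refine (contracting_x ha hb).value_lt_one
      (exists_future (P := fun γ => xSlope m a γ + xOffset m a γ < 1) ?_)
    obtain ⟨j, hj, l, hl⟩ := hω.inl_after n
    refine ⟨j, hj, ?_⟩
    rw [hl]
    simp only [xOffset, xSlope, Sum.elim_inl]
    have hi : ((l : ℕ) : ℝ) + 1 ≤ m := by exact_mod_cast l.2
    nlinarith

lemma zCoord_mem {ω : ℤ → Bracket m} (hω : Dyck.Recurrent ω) (n : ℤ) :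
    zCoord b ω n ∈ Ioo (0 : ℝ) 1 := by
  obtain ⟨hm, hmb⟩ := pos_of_mem hb
  have hb0 := hb.1
  constructor
  · refine (contracting_z ha hb).value_pos (exists_past (P := fun γ => 0 < zOffset m b γ) ?_)
    obtain ⟨j, hj, l, hl⟩ := hω.inr_before (n - 1)
    refine ⟨j, hj, ?_⟩
    rw [hl]
    simp only [zOffset, Sum.elim_inr]
    have : 0 ≤ b * ((l : ℕ) : ℝ) := by positivity
    linarith
  · refine (contracting_z ha hb).value_lt_one
      (exists_past (P := fun γ => zSlope m b γ + zOffset m b γ < 1) ?_)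
    obtain ⟨j, hj, l, hl⟩ := hω.inl_before (n - 1)
    refine ⟨j, hj, ?_⟩
    rw [hl]
    simp only [zOffset, zSlope, Sum.elim_inl]
    have := mul_pos hm hb0
    linarith

/-- The itinerary and a stack path in the open unit interval determine an orbit. -/
theorem exists_orbit {ω : ℤ → Bracket m} (hω : Dyck.Recurrent ω) {y : ℤ → ℝ}
    (hy : ∀ n, y n ∈ Ioo (0 : ℝ) 1) (hstep : IsStackPath ω y) :
    ∃ q : ℤ → cube, (∀ n, (q n : ℝ × ℝ × ℝ) = (xCoord a ω n, y n, zCoord b ω n)) ∧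
      ∀ n, (q n : ℝ × ℝ × ℝ) ∈ interior (Ω a (ω n)) ∧ map ha hb (q n) = q (n + 1) := by
  obtain ⟨hm, hma⟩ := pos_of_mem ha
  have ha0 := ha.1
  have hx := xCoord_mem ha hb hω
  have hz := zCoord_mem ha hb hω
  let q : ℤ → cube := fun n => ⟨(xCoord a ω n, y n, zCoord b ω n),
    ⟨(hx n).1.le, (hx n).2.le⟩, ⟨(hy n).1.le, (hy n).2.le⟩, (hz n).1.le, (hz n).2.le⟩
  have hint : ∀ n, (q n : ℝ × ℝ × ℝ) ∈ interior (Ω a (ω n)) := by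
    intro n
    rw [interior_Ω ha]
    have h1 := xCoord_eq ha hb ω n
    obtain ⟨hx0, hx1⟩ := hx (n + 1)
    rcases hγ : ω n with i | i
    · rw [hγ] at h1
      simp only [xSlope, xOffset, Sum.elim_inl] at h1
      refine ⟨⟨?_, ?_⟩, hy n, hz n⟩ <;> simp only [q, h1] <;> nlinarith
    · rw [hγ] at h1
      simp only [xSlope, xOffset, Sum.elim_inr] at h1
      have h2 := (hstep n).2 i hγ
      obtain ⟨hy0, hy1⟩ := hy (n + 1)
      refine ⟨⟨?_, ?_⟩, ⟨?_, ?_⟩, hz n⟩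
      · simp only [q, h1]; nlinarith
      · exact (hx n).2
      · simp only [q]; rw [h2]; gcongr; linarith
      · simp only [q]; rw [h2]; gcongr ?_ / _; linarith
  refine ⟨q, fun n => rfl, fun n => ⟨hint n, Subtype.ext ?_⟩⟩
  rw [map_of_mem ha hb (q n) (ω n) (interior_subset (hint n))]
  have h1 := xCoord_eq ha hb ω n
  have h3 := zCoord_eq ha hb ω n
  rcases hγ : ω n with i | i
  · rw [hγ] at h1 h3
    simp only [xSlope, xOffset, zSlope, zOffset, Sum.elim_inl] at h1 h3
    simp only [branch, q]
    rw [(hstep n).1 i hγ, h1, h3]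
    refine Prod.ext ?_ (Prod.ext ?_ ?_) <;> simp only
    · field_simp; ring
    · ring
    · ring
  · rw [hγ] at h1 h3
    simp only [xSlope, xOffset, zSlope, zOffset, Sum.elim_inr] at h1 h3
    simp only [branch, q]
    have h2 := (hstep n).2 i hγ
    have h4 : 1 - m * a ≠ 0 := by linarith
    rw [h2, h1, h3]
    refine Prod.ext ?_ (Prod.ext ?_ ?_) <;> simp only
    · field_simp; ring
    · field_simp; ring
    · ring

end Existence

end Baker

/-! ### The stack of a typical sequence -/

namespace Dyck
open Affine Baker
variable {m : ℕ}

/-- One step of the stack automaton, as an affine map. -/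
def IsAffinePath (ω : ℤ → Bracket m) (r : ℤ) (t : ℤ → ℝ) : Prop :=
  ∀ j ≥ r, t (j + 1) = ySlope m (ω j) * t j + yOffset m (ω j)

lemma Balanced.affinePath_eq [NeZero m] {ω : ℤ → Bracket m} (hω : Matched ω) {r : ℤ} {n : ℕ}
    (h : Balanced ω r n) : ∀ t : ℤ → ℝ, IsAffinePath ω r t → t (r + n) = t r := by
  have hm : (m : ℝ) ≠ 0 := NeZero.ne _
  refine Balanced.induction (motive := fun r n => ∀ t : ℤ → ℝ, IsAffinePath ω r t →
    t (r + n) = t r) (fun r t _ => by simp) ?_ h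
  · intro r s k i j hs hk hi hj ihs ihk t ht
    have hij : i = j := hω _ _ _ _ hk hi hj
    subst hij
    have h1 := ihs t ht
    have h2 := ihk t fun l hl => ht l (by omega)
    have h3 := ht (r + s) (by omega)
    have h4 := ht (r + s + 1 + k) (by omega)
    rw [hi] at h3
    rw [hj] at h4
    simp only [ySlope, yOffset, Sum.elim_inl, Sum.elim_inr] at h3 h4
    have e : r + ((s + k + 2 : ℕ) : ℤ) = r + s + 1 + k + 1 := by push_cast; ring
    rw [e, h4, h2, h3, h1]
    field_simp
    ring

/-- As long as the height stays above its initial value, the stack automaton only adds digits on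
top of the initial stack. -/
lemma StaysAbove.exists_affine [NeZero m] {ω : ℤ → Bracket m} (hω : Matched ω) {r : ℤ} {n : ℕ}
    (h : StaysAbove ω r n) : ∃ s c : ℝ, 0 < s ∧ 0 ≤ c ∧ s + c ≤ 1 ∧
      ∀ t : ℤ → ℝ, IsAffinePath ω r t → t (r + n) = s * t r + c := by
  have hm : (0 : ℝ) < m := by exact_mod_cast NeZero.pos m
  refine StaysAbove.induction (motive := fun n => ∃ s c : ℝ, 0 < s ∧ 0 ≤ c ∧ s + c ≤ 1 ∧
    ∀ t : ℤ → ℝ, IsAffinePath ω r t → t (r + n) = s * t r + c)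
    ⟨1, 0, one_pos, le_rfl, by norm_num, fun t _ => by simp⟩ ?_ ?_ h
  · intro n i _ hi ih
    obtain ⟨s, c, hs, hc, hsc, ht⟩ := ih
    have hi' : ((i : ℕ) : ℝ) + 1 ≤ m := by exact_mod_cast i.2
    refine ⟨s / m, (c + (i : ℕ)) / m, by positivity, by positivity, ?_, fun t htp => ?_⟩
    · rw [← add_div, div_le_one hm]; linarith
    · have h3 := htp (r + n) (by omega)
      rw [hi, ht t htp] at h3
      simp only [ySlope, yOffset, Sum.elim_inl] at h3
      push_cast
      rw [← add_assoc, h3]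
      field_simp
      ring
  · intro s k _ hb ih
    obtain ⟨σ, c, hs, hc, hsc, ht⟩ := ih
    refine ⟨σ, c, hs, hc, hsc, fun t htp => ?_⟩
    have := hb.affinePath_eq hω t fun l hl => htp l (by omega)
    push_cast
    rw [← add_assoc, this, ht t htp]

lemma isStackPath_iff [NeZero m] {ω : ℤ → Bracket m} {y : ℤ → ℝ} :
    IsStackPath ω y ↔ ∀ n, y (n + 1) = ySlope m (ω n) * y n + yOffset m (ω n) := by
  have hm : (m : ℝ) ≠ 0 := NeZero.ne _
  refine forall_congr' fun n => ?_
  rcases h : ω n with i | i <;>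
    simp only [Sum.inl.injEq, Sum.inr.injEq, forall_eq', reduceCtorEq, false_imp_iff, implies_true,
      and_true, true_and, ySlope, yOffset, Sum.elim_inl, Sum.elim_inr]
  · rw [add_div, div_eq_inv_mul]
  · rw [eq_div_iff hm]
    constructor <;> intro h <;> linarith

lemma slope_past [NeZero m] (ω : ℤ → Bracket m) (n : ℤ) (k : ℕ) :
    Affine.slope (ySlope m) (past ω n) k = (m : ℝ) ^ (height ω (n - k) - height ω n) := by
  have hm : (m : ℝ) ≠ 0 := NeZero.ne _
  induction k with
  | zero => simp [Affine.slope]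
  | succ k ih =>
    have h1 := height_succ ω (n - 1 - k)
    rw [show n - 1 - (k : ℤ) + 1 = n - k by ring] at h1
    have e : n - ((k + 1 : ℕ) : ℤ) = n - 1 - k := by push_cast; ring
    rw [Affine.slope, Finset.prod_range_succ, ← Affine.slope, ih, h1, e]
    simp only [past]
    rcases ω (n - 1 - k) with i | i <;> simp only [sign, ySlope, Sum.elim_inl, Sum.elim_inr]
    · rw [show height ω (n - 1 - k) - height ω n
        = height ω (n - 1 - k) + 1 - height ω n - 1 by ring, zpow_sub_one₀ hm]
    · rw [show height ω (n - 1 - k) - height ω n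
        = height ω (n - 1 - k) + -1 - height ω n + 1 by ring, zpow_add_one₀ hm]

lemma tendsto_slope_past (hm : 2 ≤ m) {ω : ℤ → Bracket m} (hω : Tendsto (height ω) atBot atBot)
    (n : ℤ) : Tendsto (Affine.slope (ySlope m) (past ω n)) atTop (𝓝 0) := by
  have : NeZero m := ⟨by omega⟩
  have hm1 : (1 : ℝ) < m := by exact_mod_cast hm
  have h1 : Tendsto (fun k : ℕ => height ω (n - k) - height ω n) atTop atBot :=
    by
    refine tendsto_atBot_add_const_right _ _ (hω.comp ?_)
    simp only [sub_eq_add_neg]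
    exact tendsto_atBot_add_const_left _ _
      (tendsto_neg_atTop_atBot.comp (tendsto_natCast_atTop_atTop (R := ℤ)))
  have h2 : Tendsto (fun e : ℤ => (m : ℝ) ^ e) atBot (𝓝 0) := by
    have h3 : Tendsto (fun e : ℕ => ((m : ℝ)⁻¹) ^ e) atTop (𝓝 0) :=
      tendsto_pow_atTop_nhds_zero_of_lt_one (by positivity) (inv_lt_one_of_one_lt₀ hm1)
    have h4 : Tendsto (fun e : ℤ => (-e).toNat) atBot atTop :=
      tendsto_toNat_atTop.comp tendsto_neg_atBot_atTop
    refine (h3.comp h4).congr' ?_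
    filter_upwards [eventually_le_atBot 0] with e he
    simp only [Function.comp, inv_pow]
    rw [← zpow_natCast, ← zpow_neg]
    congr 1
    omega
  exact (h2.comp h1).congr fun k => (slope_past ω n k).symm

/-- A bounded stack path is given by the stack of the unmatched left brackets. -/
lemma yCoord_eq_of_isStackPath (hm : 2 ≤ m) {ω : ℤ → Bracket m}
    (hω : Tendsto (height ω) atBot atBot) {y : ℤ → ℝ} (hy : IsStackPath ω y)
    (hy01 : ∀ n, y n ∈ Icc (0 : ℝ) 1) (n : ℤ) : yCoord ω n = y n := by
  have : NeZero m := ⟨by omega⟩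
  have := value_eq_of_tendsto_slope (A := ySlope m) (B := yOffset m) (u := past ω n)
    (t := fun j => y (n - j)) (fun j => ?_) (fun j => hy01 _) (tendsto_slope_past hm hω n)
  · simpa [yCoord] using this
  · have h := isStackPath_iff.1 hy (n - 1 - j)
    rw [show n - 1 - (j : ℤ) + 1 = n - j by ring] at h
    rw [h]
    simp only [past]
    push_cast
    rw [show n - ((j : ℤ) + 1) = n - 1 - j by ring]

lemma Typical.tendsto_offset (hm : 2 ≤ m) {ω : ℤ → Bracket m} (h : Typical ω) (n : ℤ) :
    Tendsto (offset (ySlope m) (yOffset m) (past ω n)) atTop (𝓝 (yCoord ω n)) := by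
  have : NeZero m := ⟨by omega⟩
  have hm1 : (1 : ℝ) < m := by exact_mod_cast hm
  have hm0 : (0 : ℝ) < m := by linarith
  obtain ⟨c, hc, -, hd⟩ := h.drift
  have hsum : Summable fun k => Affine.slope (ySlope m) (past ω n) k * yOffset m (past ω n k) := by
    set ρ : ℝ := Real.exp (-(c * Real.log m)) with hρ
    have hρ1 : ρ < 1 := by
      rw [hρ, Real.exp_lt_one_iff]
      have := mul_pos hc (Real.log_pos hm1)
      linarith
    have hgeo : Summable fun k : ℕ =>
        (Real.exp ((c * n - height ω n) * Real.log m) * m) * ρ ^ k :=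
      (summable_geometric_of_lt_one (Real.exp_pos _).le hρ1).mul_left _
    refine Summable.of_norm_bounded_eventually_nat hgeo ?_
    have ht : Tendsto (fun k : ℕ => ((k : ℤ) - n).toNat) atTop atTop :=
      tendsto_toNat_atTop.comp
        (tendsto_atTop_add_const_right _ _ (tendsto_natCast_atTop_atTop (R := ℤ)))
    filter_upwards [ht.eventually hd, eventually_ge_atTop n.toNat] with k hk hkn
    have e1 : (((k : ℤ) - n).toNat : ℤ) = k - n := by omega
    have e2 : ((((k : ℤ) - n).toNat : ℕ) : ℝ) = k - n := by exact_mod_cast congrArg (Int.cast (R := ℝ)) e1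
    rw [e1, e2, show -((k : ℤ) - n) = n - k by ring] at hk
    rw [norm_mul, slope_past]
    have hB : ‖yOffset m (past ω n k)‖ ≤ m := by
      rcases past ω n k with i | i <;> simp only [yOffset, Sum.elim_inl, Sum.elim_inr]
      · have hi' : ((i : ℕ) : ℝ) + 1 ≤ m := by exact_mod_cast i.2
        rw [Real.norm_of_nonneg (by positivity), div_le_iff₀ hm0]
        nlinarith
      · have hi' : ((i : ℕ) : ℝ) + 1 ≤ m := by exact_mod_cast i.2
        rw [norm_neg, Real.norm_of_nonneg (by positivity)]
        linarith
    have hA : ‖(m : ℝ) ^ (height ω (n - k) - height ω n)‖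
        ≤ Real.exp ((c * n - height ω n) * Real.log m) * ρ ^ k := by
      rw [Real.norm_of_nonneg (by positivity), ← Real.rpow_intCast, Real.rpow_def_of_pos hm0, hρ,
        ← Real.exp_nat_mul, ← Real.exp_add]
      refine Real.exp_le_exp.2 ?_
      push_cast
      have := mul_le_mul_of_nonneg_right hk (Real.log_pos hm1).le
      nlinarith
    calc _ ≤ (Real.exp ((c * n - height ω n) * Real.log m) * ρ ^ k) * m :=
          mul_le_mul hA hB (norm_nonneg _) (by positivity)
      _ = _ := by ring
  have := hsum.hasSum.tendsto_sum_nat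
  unfold yCoord value
  have h2 : Tendsto (offset (ySlope m) (yOffset m) (past ω n)) atTop _ := this
  rwa [h2.limsup_eq]

lemma Typical.isStackPath (hm : 2 ≤ m) {ω : ℤ → Bracket m} (h : Typical ω) :
    IsStackPath ω (yCoord ω) := by
  have : NeZero m := ⟨by omega⟩
  refine isStackPath_iff.2 fun n => ?_
  have h1 := h.tendsto_offset hm n
  rw [← past_succ] at h1
  have h2 := value_eq_of_tendsto h1
  rw [past_succ_zero] at h2
  exact tendsto_nhds_unique (h.tendsto_offset hm (n + 1)) h2

/-- The value of a stack is a limit of values of finite stacks. -/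
lemma Typical.yCoord_mem (hm : 2 ≤ m) {ω : ℤ → Bracket m} (h : Typical ω) (hω : Matched ω)
    (n : ℤ) : yCoord ω n ∈ Icc (0 : ℝ) 1 := by
  have : NeZero m := ⟨by omega⟩
  refine isClosed_Icc.mem_of_frequently_of_tendsto ?_ (h.tendsto_offset hm n)
  refine frequently_atTop.2 fun N => ?_
  obtain ⟨r, hr, hrec⟩ := exists_record h.tendsto_atBot (n - N) n
  have hst : StaysAbove ω r (n - r).toNat := fun k hk => hrec _ (by omega) (by omega)
  obtain ⟨s, c, hs, hc, hsc, ht⟩ := hst.exists_affine hω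
  refine ⟨(n - r).toNat, by omega, ?_⟩
  have := ht (fun j => offset (ySlope m) (yOffset m) (past ω j) (j - r).toNat) fun j hj => by
    beta_reduce
    rw [show (j + 1 - r).toNat = (j - r).toNat + 1 by omega, offset_succ, past_succ,
      past_succ_zero]
  beta_reduce at this
  rw [show r + ((n - r).toNat : ℤ) = n by omega] at this
  rw [this]
  simp only [sub_self, Int.toNat_zero, offset, Finset.range_zero, Finset.sum_empty, mul_zero,
    zero_add, mem_Icc]
  exact ⟨hc, by linarith⟩

/-- If the stack has the value `0` at some time, then it already has this value at suitable
arbitrarily early times; similarly for the value `1`. The same early time serves two events. -/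
lemma Typical.not_zero_and_one (hm : 2 ≤ m) {ω : ℤ → Bracket m} (h : Typical ω) (hω : Matched ω)
    {n n' : ℤ} (h0 : yCoord ω n = 0) (h1 : yCoord ω n' = 1) : False := by
  have : NeZero m := ⟨by omega⟩
  obtain ⟨r, hr, hrec⟩ := exists_record h.tendsto_atBot (min n n') (max n n')
  have hp : IsAffinePath ω r (yCoord ω) := fun j _ => isStackPath_iff.1 (h.isStackPath hm) j
  have hr01 := h.yCoord_mem hm hω r
  have key : ∀ k ≥ r, k ≤ max n n' → ∃ s c : ℝ, 0 < s ∧ 0 ≤ c ∧ s + c ≤ 1 ∧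
      yCoord ω k = s * yCoord ω r + c := by
    intro k hk hk'
    have hst : StaysAbove ω r (k - r).toNat := fun l hl => hrec _ (by omega) (by omega)
    obtain ⟨s, c, hs, hc, hsc, ht⟩ := hst.exists_affine hω
    refine ⟨s, c, hs, hc, hsc, ?_⟩
    rw [← ht _ hp]
    congr 1; omega
  obtain ⟨s, c, hs, hc, -, e0⟩ := key n (hr.trans (min_le_left _ _)) (le_max_left _ _)
  obtain ⟨s', c', hs', hc', hsc', e1⟩ := key n' (hr.trans (min_le_right _ _)) (le_max_right _ _)
  have hy0 : yCoord ω r = 0 := by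
    have := mul_nonneg hs.le hr01.1
    have : s * yCoord ω r = 0 := by linarith
    exact (mul_eq_zero.1 this).resolve_left hs.ne'
  rw [hy0] at e1
  linarith

/-- Replace every subscript `i` by `m - 1 - i`. -/
def mirror (ω : ℤ → Bracket m) : ℤ → Bracket m := fun k => Sum.map Fin.rev Fin.rev (ω k)

lemma sign_mirror (ω : ℤ → Bracket m) (k : ℤ) : sign (mirror ω k) = sign (ω k) := by
  unfold mirror
  rcases ω k with i | i <;> rfl

lemma height_mirror (ω : ℤ → Bracket m) : height (mirror ω) = height ω :=
  height_congr (sign_mirror ω)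

lemma mirror_eq_inl {ω : ℤ → Bracket m} {k : ℤ} {i : Fin m} :
    mirror ω k = Sum.inl i ↔ ω k = Sum.inl i.rev := by
  unfold mirror
  rcases ω k with j | j <;> simp [Fin.rev_eq_iff]

lemma mirror_eq_inr {ω : ℤ → Bracket m} {k : ℤ} {i : Fin m} :
    mirror ω k = Sum.inr i ↔ ω k = Sum.inr i.rev := by
  unfold mirror
  rcases ω k with j | j <;> simp [Fin.rev_eq_iff]

lemma Matched.mirror {ω : ℤ → Bracket m} (h : Matched ω) : Matched (mirror ω) := by
  intro s n i j hb hi hj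
  have hb' : Balanced ω (s + 1) n := by
    simpa only [Balanced, StaysAbove, height_mirror] using hb
  exact Fin.rev_injective (h s n _ _ hb' (mirror_eq_inl.1 hi) (mirror_eq_inr.1 hj))

lemma IsStackPath.mirror {ω : ℤ → Bracket m} {y : ℤ → ℝ} (h : IsStackPath ω y) :
    IsStackPath (mirror ω) fun n => 1 - y n := by
  intro n
  have key : ∀ i : Fin m, ((i.rev : ℕ) : ℝ) = m - 1 - (i : ℕ) := fun i => by
    rw [Fin.val_rev, Nat.cast_sub (by omega)]; push_cast; ring
  have hm : ∀ _ : Fin m, (m : ℝ) ≠ 0 := fun i => by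
    have := i.2
    exact_mod_cast (by omega : m ≠ 0)
  refine ⟨fun i hi => ?_, fun i hi => ?_⟩
  · have := (h n).1 _ (mirror_eq_inl.1 hi)
    beta_reduce
    rw [this, key]
    have := hm i
    field_simp
    ring
  · have := (h n).2 _ (mirror_eq_inr.1 hi)
    beta_reduce
    rw [this, key]
    have := hm i
    field_simp
    ring

open BernoulliShift

/-- Replace every subscript `i` by `m - 1 - i`. -/
def mirrorSymbols (η : ℤ → Fin m ⊕ Unit) : ℤ → Fin m ⊕ Unit := fun k => Sum.map Fin.rev id (η k)

lemma measurePreserving_mirrorSymbols [NeZero m] :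
    MeasurePreserving (mirrorSymbols (m := m)) (bernoulli (Fin m ⊕ Unit))
      (bernoulli (Fin m ⊕ Unit)) := by
  refine ⟨measurable_pi_lambda _ fun k =>
    (measurable_of_finite (Sum.map Fin.rev id)).comp (measurable_pi_apply k), ?_⟩
  have := Measure.infinitePi_map_pi (fun _ : ℤ => (PMF.uniformOfFintype (Fin m ⊕ Unit)).toMeasure)
    (f := fun _ => Sum.map Fin.rev id) fun _ => measurable_of_finite _
  refine this.trans ?_
  unfold bernoulli
  congr 1
  funext _
  ext s hs
  rw [Measure.map_apply (measurable_of_finite _) hs,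
    PMF.toMeasure_apply_fintype, PMF.toMeasure_apply_fintype,
    ← (Equiv.sumCongr Fin.revPerm (Equiv.refl Unit)).sum_comp (indicator s _)]
  refine Finset.sum_congr rfl fun x _ => ?_
  simp only [indicator, PMF.uniformOfFintype_apply]
  rfl

lemma fill_mirrorSymbols [NeZero m] {η : ℤ → Fin m ⊕ Unit}
    (h : Tendsto (height (fill η)) atBot atBot) :
    fill (mirrorSymbols η) = mirror (fill η) := by
  have hH := height_mirror (fill η)
  have h1 := fill_mem_setBα h
  have h2 : mirror (fill η) ∈ setBα m := by
    refine ⟨(matched_fill η).mirror.mem_shift (by rwa [hH]), fun i => ?_⟩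
    rw [hH]
    rcases h1.2 i with ⟨l, hl⟩ | ⟨⟨l, hl⟩, hk⟩
    · exact Or.inl ⟨l.rev, mirror_eq_inl.2 (by rwa [Fin.rev_rev])⟩
    · exact Or.inr ⟨⟨l.rev, mirror_eq_inr.2 (by rwa [Fin.rev_rev])⟩, hk⟩
  have h3 : forgetRight (mirror (fill η)) = mirrorSymbols η := by
    funext k
    have := congrFun (forgetRight_fill η) k
    simp only [mirrorSymbols, ← this, forgetRight, mirror]
    rcases fill η k with i | i <;> rfl
  rw [← h3, fill_forgetRight h2]

lemma measurable_yCoord (n : ℤ) : Measurable fun ω : ℤ → Bracket m => yCoord ω n :=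
  measurable_value.comp (measurable_pi_lambda _ fun _ => measurable_pi_apply _)

lemma yCoord_shiftBy (d n : ℤ) (ω : ℤ → Bracket m) :
    yCoord (shiftBy d ω) n = yCoord ω (n + d) := by
  unfold yCoord
  congr 1
  funext j
  simp only [past, shiftBy]
  congr 1; ring

/-- The sequences that are the itinerary of a point whose stack is `yCoord`. -/
structure Regular (ω : ℤ → Bracket m) : Prop extends Typical ω where
  matched : Matched ω
  isStackPath : IsStackPath ω (yCoord ω)
  yCoord_mem : ∀ n, yCoord ω n ∈ Ioo (0 : ℝ) 1

/-- The stack of a typical sequence does not consist of zeros only, since by ergodicity and by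
symmetry it would then also consist of the digit `m - 1` only. -/
theorem ae_regular_fill [NeZero m] (hm : 2 ≤ m) :
    ∀ᵐ η ∂bernoulli (Fin m ⊕ Unit), Regular (fill η) := by
  set lam := bernoulli (Fin m ⊕ Unit) with hlam
  have herg : Ergodic (shiftBy 1) lam := ergodic_shiftBy _ one_ne_zero
  have hmir := measurePreserving_mirrorSymbols (m := m)
  set E : Set (ℤ → Fin m ⊕ Unit) := {η | ∃ n, yCoord (fill η) n = 0} with hE
  have hEm : MeasurableSet E := by
    rw [hE, ofPred_exists]
    exact MeasurableSet.iUnion fun n =>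
      (measurable_yCoord n).comp measurable_fill (measurableSet_singleton 0)
  have hEinv : shiftBy 1 ⁻¹' E = E := by
    ext η
    simp only [hE, mem_preimage, mem_ofPred_eq, fill_shiftBy, yCoord_shiftBy]
    exact ⟨fun ⟨n, hn⟩ => ⟨n + 1, hn⟩, fun ⟨n, hn⟩ => ⟨n - 1, by rwa [sub_add_cancel]⟩⟩
  have hmirror : ∀ᵐ η ∂lam, ∀ n, yCoord (fill (mirrorSymbols η)) n = 1 - yCoord (fill η) n := by
    filter_upwards [ae_typical_fill hm] with η hη n
    have hH := hη.tendsto_atBot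
    rw [fill_mirrorSymbols hH]
    refine yCoord_eq_of_isStackPath hm (by rwa [height_mirror])
      (IsStackPath.mirror (hη.isStackPath hm)) (fun n => ?_) n
    have := hη.yCoord_mem hm (matched_fill η) n
    exact ⟨by linarith [this.2], by linarith [this.1]⟩
  have hE0 : ∀ᵐ η ∂lam, η ∉ E := by
    rcases herg.toPreErgodic.ae_empty_or_univ hEm hEinv with h | h
    · exact eventuallyEq_empty.1 h
    · have h1 : ∀ᵐ η ∂lam, η ∈ E := eventuallyEq_univ.1 h
      have h2 : ∀ᵐ η ∂lam, mirrorSymbols η ∈ E := hmir.quasiMeasurePreserving.ae h1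
      have : ∀ᵐ η ∂lam, False := by
        filter_upwards [h1, h2, hmirror, ae_typical_fill hm] with η h1 h2 h3 h4
        obtain ⟨n, hn⟩ := h1
        obtain ⟨n', hn'⟩ := h2
        rw [h3] at hn'
        exact h4.not_zero_and_one hm (matched_fill η) hn (n' := n') (by linarith)
      filter_upwards [this] with η h using h.elim
  filter_upwards [hE0, hmir.quasiMeasurePreserving.ae hE0, hmirror, ae_typical_fill hm]
    with η h0 h1 h2 h3
  refine ⟨h3, matched_fill η, h3.isStackPath hm, fun n => ?_⟩
  have h4 := h3.yCoord_mem hm (matched_fill η) n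
  refine ⟨h4.1.lt_of_ne fun h => h0 ⟨n, h.symm⟩, h4.2.lt_of_ne fun h => h1 ⟨n, ?_⟩⟩
  rw [h2, h, sub_self]

lemma Regular.recurrent {ω : ℤ → Bracket m} (h : Regular ω) : Recurrent ω :=
  ⟨exists_inl_of_tendsto h.tendsto_atTop, h.inr_after,
    exists_inl_of_tendsto_atBot h.tendsto_atBot, h.inr_before⟩

lemma Recurrent.rev {ω : ℤ → Bracket m} (h : Recurrent ω) : Recurrent (rev ω) := by
  refine ⟨fun N => ?_, fun N => ?_, fun N => ?_, fun N => ?_⟩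
  · obtain ⟨j, hj, l, hl⟩ := h.inr_before (-1 - N)
    exact ⟨-1 - j, by omega, l, by simp [Dyck.rev, hl]⟩
  · obtain ⟨j, hj, l, hl⟩ := h.inl_before (-1 - N)
    exact ⟨-1 - j, by omega, l, by simp [Dyck.rev, hl]⟩
  · obtain ⟨j, hj, l, hl⟩ := h.inr_after (-1 - N)
    exact ⟨-1 - j, by omega, l, by simp [Dyck.rev, hl]⟩
  · obtain ⟨j, hj, l, hl⟩ := h.inl_after (-1 - N)
    exact ⟨-1 - j, by omega, l, by simp [Dyck.rev, hl]⟩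

end Dyck

/-! ### The coding map, and the two measures as images of the Bernoulli measure -/

namespace Baker
open Dyck Affine BernoulliShift
variable {m : ℕ} {a b : ℝ} {ha : a ∈ Ioo (0 : ℝ) (1 / m)} {hb : b ∈ Ioo (0 : ℝ) (1 / m)}

lemma HasCode.exists_path {p : cube} {ω : ℤ → Bracket m} (h : HasCode ha hb p ω) :
    ∃ y : ℤ → ℝ, IsStackPath ω y ∧ (∀ n, y n ∈ Ioo (0 : ℝ) 1) ∧
      (p : ℝ × ℝ × ℝ) = (xCoord a ω 0, y 0, zCoord b ω 0) := by
  obtain ⟨hm, hma⟩ := pos_of_mem ha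
  have ha0 := ha.1
  obtain ⟨q, rfl, hq⟩ := h
  have hstep : ∀ n, (q (n + 1) : ℝ × ℝ × ℝ) = branch a b (ω n) (q n) := fun n => by
    rw [← (hq n).2, map_of_mem ha hb _ _ (interior_subset (hq n).1)]
  have hbox : ∀ n, (q n : ℝ × ℝ × ℝ) ∈ box a (ω n) := fun n => by
    rw [← interior_Ω ha]; exact (hq n).1
  have hx : ∀ n, (q n).1.1 = xSlope m a (ω n) * (q (n + 1)).1.1 + xOffset m a (ω n) := by
    intro n
    rw [hstep n]
    have : 1 - m * a ≠ 0 := by linarith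
    rcases ω n with i | i <;> simp only [branch, xSlope, xOffset, Sum.elim_inl, Sum.elim_inr] <;>
      field_simp <;> ring
  have hz : ∀ n, (q (n + 1)).1.2.2 = zSlope m b (ω n) * (q n).1.2.2 + zOffset m b (ω n) := by
    intro n
    rw [hstep n]
    rcases ω n with i | i <;> simp only [branch, zSlope, zOffset, Sum.elim_inl, Sum.elim_inr] <;>
      ring
  refine ⟨fun n => (q n).1.2.1, fun n => ⟨fun i hi => ?_, fun i hi => ?_⟩, fun n => ?_, ?_⟩
  · beta_reduce
    rw [hstep n, hi]
    simp only [branch]; ring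
  · beta_reduce
    rw [hstep n, hi]
    simp only [branch]; field_simp; ring
  · have h := hbox n
    rcases hω : ω n with i | i
    · rw [hω] at h; exact h.2.1
    · rw [hω] at h
      have hi : ((i : ℕ) : ℝ) + 1 ≤ m := by exact_mod_cast i.2
      exact ⟨lt_of_le_of_lt (by positivity) h.2.1.1, h.2.1.2.trans_le ((div_le_one hm).2 hi)⟩
  · refine Prod.ext ?_ (Prod.ext rfl ?_)
    · have := value_eq_of_tendsto_slope (A := xSlope m a) (B := xOffset m a) (u := future ω 0)
        (t := fun j => (q j).1.1) (fun j => ?_) (fun j => (q j).2.1)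
        ((contracting_x ha hb).tendsto_slope _)
      · exact this.symm
      · have := hx j
        simpa [future] using this
    · have := value_eq_of_tendsto_slope (A := zSlope m b) (B := zOffset m b) (u := past ω 0)
        (t := fun j => (q (-j)).1.2.2) (fun j => ?_) (fun j => (q _).2.2.2)
        ((contracting_z ha hb).tendsto_slope _)
      · have e := this.symm
        simpa [zCoord] using e
      · have := hz (-1 - j)
        rw [show -1 - (j : ℤ) + 1 = -j by ring] at this
        rw [this]
        simp only [past]
        rw [show (0 : ℤ) - 1 - j = -1 - j by ring, show -((j + 1 : ℕ) : ℤ) = -1 - j by push_cast; ring]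

lemma branch_injective_of_mem_box (ha : a ∈ Ioo (0 : ℝ) (1 / m)) (hb : b ∈ Ioo (0 : ℝ) (1 / m))
    {γ δ : Bracket m} {p q : ℝ × ℝ × ℝ} (hp : p ∈ box a γ) (hq : q ∈ box a δ)
    (h : branch a b γ p = branch a b δ q) : γ = δ ∧ p = q := by
  obtain ⟨hm, hma⟩ := pos_of_mem ha
  obtain ⟨-, hmb⟩ := pos_of_mem hb
  have ha0 := ha.1
  have hb0 := hb.1
  obtain ⟨x, y, z⟩ := p
  obtain ⟨x', y', z'⟩ := q
  have key : ∀ (i j : Fin m), ((i : ℕ) : ℝ) < (j : ℕ) + 1 → ((j : ℕ) : ℝ) < (i : ℕ) + 1 → i = j := by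
    intro i j h1 h2
    have h1' : (i : ℕ) < (j : ℕ) + 1 := by exact_mod_cast h1
    have h2' : (j : ℕ) < (i : ℕ) + 1 := by exact_mod_cast h2
    exact Fin.ext (by omega)
  rcases γ with i | i <;> rcases δ with j | j <;>
    obtain ⟨hx, ⟨hy0, hy1⟩, hz0, hz1⟩ := hp <;> obtain ⟨hx', ⟨hy0', hy1'⟩, hz0', hz1'⟩ := hq <;>
    simp only at hy0 hy1 hz0 hz1 hy0' hy1' hz0' hz1' <;>
    simp only [branch, Prod.mk.injEq] at h <;> obtain ⟨h1, h2, h3⟩ := h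
  · have hij : i = j := by
      rw [← add_div, ← add_div, div_left_inj' hm.ne'] at h2
      exact key i j (by linarith) (by linarith)
    subst hij
    have e3 := mul_left_cancel₀ (by linarith : (1 - m * b) ≠ 0) h3
    have e2 := (div_left_inj' hm.ne').1 (add_right_cancel h2)
    have e1 := sub_left_injective ((div_left_inj' ha0.ne').1 h1)
    exact ⟨rfl, by rw [e1, e2, e3]⟩
  · have h4 : (1 - m * b) * z < 1 - m * b := mul_lt_of_lt_one_right (by linarith) hz1
    have h5 : 0 < b * z' := by positivity
    have h6 : 0 ≤ b * ((j : ℕ) : ℝ) := by positivity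
    linarith
  · have h4 : (1 - m * b) * z' < 1 - m * b := mul_lt_of_lt_one_right (by linarith) hz1'
    have h5 : 0 < b * z := by positivity
    have h6 : 0 ≤ b * ((i : ℕ) : ℝ) := by positivity
    linarith
  · have h4 : b * (z + (i : ℕ)) = b * (z' + (j : ℕ)) := by linarith
    have h5 := mul_left_cancel₀ hb0.ne' h4
    have hij : i = j := key i j (by linarith) (by linarith)
    subst hij
    have e3 : z = z' := by linarith
    have e2 : y = y' := mul_left_cancel₀ hm.ne' (by linarith)
    have e1 := sub_left_injective ((div_left_inj' (by linarith : 1 - m * a ≠ 0)).1 h1)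
    exact ⟨rfl, by rw [e1, e2, e3]⟩

/-- A point has at most one itinerary. -/
lemma HasCode.unique {p : cube} {ω ω' : ℤ → Bracket m} (h : HasCode ha hb p ω)
    (h' : HasCode ha hb p ω') : ω = ω' := by
  obtain ⟨q, hq0, hq⟩ := h
  obtain ⟨q', hq0', hq'⟩ := h'
  have letter : ∀ n, q n = q' n → ω n = ω' n := fun n hn => by
    have h1 := interior_subset (hq n).1
    rw [hn] at h1
    exact eq_of_mem_Ω ha h1 (interior_subset (hq' n).1)
  have hq_eq : ∀ n, q n = q' n := by
    intro n
    induction n using Int.induction_on with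
    | zero => rw [hq0, hq0']
    | succ n ih => rw [← (hq n).2, ← (hq' n).2, ih]
    | pred n ih =>
      have h1 := hq (-n - 1)
      have h2 := hq' (-n - 1)
      rw [sub_add_cancel] at h1 h2
      have h3 := congrArg Subtype.val (h1.2.trans (ih.trans h2.2.symm))
      rw [map_of_mem ha hb _ _ (interior_subset h1.1),
        map_of_mem ha hb _ _ (interior_subset h2.1)] at h3
      rw [interior_Ω ha] at h1 h2
      exact Subtype.ext (branch_injective_of_mem_box ha hb h1.1 h2.1 h3).2
  funext n
  exact letter n (hq_eq n)

lemma hasCode_code (p : codable ha hb) : HasCode ha hb p (code ha hb p) := p.2.choose_spec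

/-- The point of the cube with given coordinates (each coordinate is first projected to the unit
interval). -/
noncomputable def point (p : ℝ × ℝ × ℝ) : cube :=
  ⟨(projIcc 0 1 zero_le_one p.1, projIcc 0 1 zero_le_one p.2.1, projIcc 0 1 zero_le_one p.2.2),
    (projIcc 0 1 zero_le_one p.1).2, (projIcc 0 1 zero_le_one p.2.1).2,
    (projIcc 0 1 zero_le_one p.2.2).2⟩

lemma point_coe (p : cube) : point p = p := by
  obtain ⟨⟨x, y, z⟩, hx, hy, hz⟩ := p
  refine Subtype.ext (Prod.ext ?_ (Prod.ext ?_ ?_)) <;> simp only [point]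
  · rw [projIcc_of_mem _ hx]
  · rw [projIcc_of_mem _ hy]
  · rw [projIcc_of_mem _ hz]

lemma continuous_point : Continuous point := by
  refine Continuous.subtype_mk ?_ _
  have h := continuous_subtype_val.comp (continuous_projIcc (a := (0 : ℝ)) (b := 1) (h := zero_le_one))
  exact (h.comp continuous_fst).prodMk ((h.comp (continuous_fst.comp continuous_snd)).prodMk
    (h.comp (continuous_snd.comp continuous_snd)))

/-- The point with the itinerary `ω` if the height tends to `-∞` in the past. -/
noncomputable def pointα (a b : ℝ) (ω : ℤ → Bracket m) : cube :=
  point (xCoord a ω 0, yCoord ω 0, zCoord b ω 0)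

/-- The point with the itinerary `ω` if the height tends to `-∞` in the future. -/
noncomputable def pointβ (a b : ℝ) (ω : ℤ → Bracket m) : cube :=
  point (xCoord a ω 0, yCoord (rev ω) 0, zCoord b ω 0)

lemma measurable_xCoord (a : ℝ) (n : ℤ) : Measurable fun ω : ℤ → Bracket m => xCoord a ω n :=
  measurable_value.comp (measurable_pi_lambda _ fun _ => measurable_pi_apply _)

lemma measurable_zCoord (b : ℝ) (n : ℤ) : Measurable fun ω : ℤ → Bracket m => zCoord b ω n :=
  measurable_value.comp (measurable_pi_lambda _ fun _ => measurable_pi_apply _)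

lemma measurable_pointα (a b : ℝ) : Measurable (pointα (m := m) a b) :=
  continuous_point.measurable.comp ((measurable_xCoord a 0).prodMk
    ((measurable_yCoord 0).prodMk (measurable_zCoord b 0)))

lemma measurable_pointβ (a b : ℝ) : Measurable (pointβ (m := m) a b) :=
  continuous_point.measurable.comp ((measurable_xCoord a 0).prodMk
    (((measurable_yCoord 0).comp measurable_rev).prodMk (measurable_zCoord b 0)))

lemma HasCode.eq_pointα (hm : 2 ≤ m) {p : cube} {ω : ℤ → Bracket m} (h : HasCode ha hb p ω)
    (hω : ω ∈ setAα m) : pointα a b ω = p := by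
  obtain ⟨y, hy, hy01, hp⟩ := h.exists_path
  rw [pointα, yCoord_eq_of_isStackPath hm hω.2.2 hy fun n => Ioo_subset_Icc_self (hy01 n), ← hp,
    point_coe]

lemma HasCode.eq_pointβ (hm : 2 ≤ m) {p : cube} {ω : ℤ → Bracket m} (h : HasCode ha hb p ω)
    (hω : ω ∈ setAβ m) : pointβ a b ω = p := by
  obtain ⟨y, hy, hy01, hp⟩ := h.exists_path
  have := yCoord_eq_of_isStackPath hm (rev_mem_setAα hω).2.2 hy.rev
    (fun n => Ioo_subset_Icc_self (hy01 _)) 0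
  rw [pointβ, this, neg_zero, ← hp, point_coe]

lemma _root_.Dyck.Regular.mem_setAα {ω : ℤ → Bracket m} (h : Regular ω) : ω ∈ setAα m :=
  h.toTypical.mem_setAα (h.matched.mem_shift h.tendsto_atBot)

/-- An orbit of the baker map that is coded by `ω`. -/
lemma exists_orbitα (ha : a ∈ Ioo (0 : ℝ) (1 / m)) (hb : b ∈ Ioo (0 : ℝ) (1 / m))
    {ω : ℤ → Bracket m} (h : Regular ω) :
    ∃ q : ℤ → cube, (∀ n, q n = point (xCoord a ω n, yCoord ω n, zCoord b ω n)) ∧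
      ∀ n, (q n : ℝ × ℝ × ℝ) ∈ interior (Ω a (ω n)) ∧ map ha hb (q n) = q (n + 1) := by
  obtain ⟨q, h1, h2⟩ := exists_orbit ha hb h.recurrent h.yCoord_mem h.isStackPath
  exact ⟨q, fun n => by rw [← h1, point_coe], h2⟩

/-- An orbit of the baker map that is coded by `rev ω`. It has the stacks of `ω` in reverse order. -/
lemma exists_orbitβ (ha : a ∈ Ioo (0 : ℝ) (1 / m)) (hb : b ∈ Ioo (0 : ℝ) (1 / m))
    {ω : ℤ → Bracket m} (h : Regular ω) :
    ∃ q : ℤ → cube, (∀ n, q n = point (xCoord a (rev ω) n, yCoord ω (-n), zCoord b (rev ω) n)) ∧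
      ∀ n, (q n : ℝ × ℝ × ℝ) ∈ interior (Ω a (rev ω n)) ∧ map ha hb (q n) = q (n + 1) := by
  obtain ⟨q, h1, h2⟩ := exists_orbit ha hb h.recurrent.rev (y := fun n => yCoord ω (-n))
    (fun n => h.yCoord_mem _) h.isStackPath.rev
  exact ⟨q, fun n => by rw [← h1, point_coe], h2⟩

/-- The coding map is the inverse of a measurable map `P`, up to null sets. -/
lemma transfer_eq_map {A : Set (ℤ → Bracket m)} {ν : Measure (ℤ → Bracket m)}
    {P : (ℤ → Bracket m) → cube} (hP : Measurable P)
    (hA : ∀ p ω, HasCode ha hb p ω → ω ∈ A → P ω = p)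
    (hν : ∀ᵐ ω ∂ν, ω ∈ A ∧ ∃ p, HasCode ha hb p ω) : transfer ha hb A ν = ν.map P := by
  refine Measure.map_comap_eq_map (measurable_subtype_coe.comp measurable_subtype_coe)
    (Subtype.val_injective.comp Subtype.val_injective) ?_ hP
    (fun p => hA _ _ (hasCode_code p.1) p.2) ?_
  · rintro E ⟨E', ⟨F, hF, rfl⟩, rfl⟩
    exact ⟨F, hF, rfl⟩
  · filter_upwards [hν] with ω ⟨hω, p, hp⟩
    have hc : code ha hb ⟨p, ω, hp⟩ = ω := (hasCode_code ⟨p, ω, hp⟩).unique hp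
    exact ⟨⟨⟨p, ω, hp⟩, by rwa [hc]⟩, hc⟩

variable [NeZero m]

/-- The first measure is the law of the point that is coded by a Bernoulli sequence. -/
theorem muα_eq (hm : 2 ≤ m) :
    muα ha hb = (bernoulli (Fin m ⊕ Unit)).map fun η => pointα a b (fill η) := by
  have hinj : Function.Injective (fill (m := m)) := Function.LeftInverse.injective forgetRight_fill
  rw [muα, transfer_eq_map (measurable_pointα a b) (fun p ω h hω => h.eq_pointα hm hω), nuα_eq hm,
    Measure.map_map (measurable_pointα a b) measurable_fill]
  · rfl
  · rw [nuα_eq hm, (measurable_fill.measurableEmbedding hinj).ae_map_iff]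
    filter_upwards [ae_regular_fill hm] with η hη
    obtain ⟨q, -, hq⟩ := exists_orbitα ha hb hη
    exact ⟨hη.mem_setAα, q 0, q, rfl, hq⟩

/-- The second measure is the law of the point that is coded by a reversed Bernoulli sequence. -/
theorem muβ_eq (hm : 2 ≤ m) :
    muβ ha hb = (bernoulli (Fin m ⊕ Unit)).map fun η => pointβ a b (rev (fill η)) := by
  have hmeas : Measurable fun η : ℤ → Fin m ⊕ Unit => rev (fill η) :=
    measurable_rev.comp measurable_fill
  have hinj : Function.Injective fun η : ℤ → Fin m ⊕ Unit => rev (fill η) :=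
    (Function.LeftInverse.injective rev_rev).comp
      (Function.LeftInverse.injective forgetRight_fill)
  rw [muβ, transfer_eq_map (measurable_pointβ a b) (fun p ω h hω => h.eq_pointβ hm hω), nuβ_eq hm,
    Measure.map_map (measurable_pointβ a b) hmeas]
  · rfl
  · rw [nuβ_eq hm, (hmeas.measurableEmbedding hinj).ae_map_iff]
    filter_upwards [ae_regular_fill hm] with η hη
    obtain ⟨q, -, hq⟩ := exists_orbitβ ha hb hη
    exact ⟨rev_mem_setAβ hη.mem_setAα, q 0, q, rfl, hq⟩

end Baker

/-! ### Ergodicity of the two measures, and lower bounds for their entropies -/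

namespace Baker
open Dyck Affine BernoulliShift Shannon
variable {m : ℕ} {a b : ℝ}

lemma measurableSet_Ω (γ : Bracket m) : MeasurableSet (Ω a γ) := by
  have hc : MeasurableSet cube := isCompact_cube.measurableSet
  have hy : Measurable fun p : ℝ × ℝ × ℝ => p.2.1 := measurable_fst.comp measurable_snd
  rcases γ with i | i
  · exact hc.inter ((measurableSet_le measurable_const measurable_fst).inter
      (measurableSet_lt measurable_fst measurable_const))
  · exact hc.inter ((measurableSet_le measurable_const measurable_fst).inter
      ((measurableSet_le measurable_const hy).inter ((measurableSet_lt hy measurable_const).union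
        ((MeasurableSet.const _).inter (measurableSet_eq_fun hy measurable_const)))))

lemma measurable_branch (γ : Bracket m) : Measurable (branch a b γ) := by
  rcases γ with i | i <;> · unfold branch; fun_prop

/-- The piece to which a point of the cube belongs. -/
noncomputable def letter (ha : a ∈ Ioo (0 : ℝ) (1 / m)) (p : cube) : Bracket m :=
  (exists_mem_Ω ha p.2).choose

lemma mem_Ω_letter (ha : a ∈ Ioo (0 : ℝ) (1 / m)) (p : cube) :
    (p : ℝ × ℝ × ℝ) ∈ Ω a (letter ha p) := (exists_mem_Ω ha p.2).choose_spec

lemma letter_eq_iff (ha : a ∈ Ioo (0 : ℝ) (1 / m)) {p : cube} {γ : Bracket m} :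
    letter ha p = γ ↔ (p : ℝ × ℝ × ℝ) ∈ Ω a γ :=
  ⟨fun h => h ▸ mem_Ω_letter ha p, fun h => eq_of_mem_Ω ha (mem_Ω_letter ha p) h⟩

lemma measurable_letter (ha : a ∈ Ioo (0 : ℝ) (1 / m)) : Measurable (letter ha) := by
  refine measurable_to_countable' fun γ => ?_
  have : letter ha ⁻¹' {γ} = Subtype.val ⁻¹' Ω a γ := by
    ext p; exact letter_eq_iff ha
  rw [this]
  exact measurable_subtype_coe (measurableSet_Ω γ)

lemma coe_map (ha : a ∈ Ioo (0 : ℝ) (1 / m)) (hb : b ∈ Ioo (0 : ℝ) (1 / m)) (p : cube) :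
    (map ha hb p : ℝ × ℝ × ℝ) = branch a b (letter ha p) p := rfl

lemma measurable_map (ha : a ∈ Ioo (0 : ℝ) (1 / m)) (hb : b ∈ Ioo (0 : ℝ) (1 / m)) :
    Measurable (map ha hb) := by
  refine Measurable.subtype_mk ?_
  have : Measurable fun x : Bracket m × cube => branch a b x.1 x.2 :=
    measurable_from_prod_countable_right fun γ => (measurable_branch γ).comp measurable_subtype_coe
  exact this.comp ((measurable_letter ha).prodMk measurable_id)

lemma xCoord_shiftBy (d n : ℤ) (ω : ℤ → Bracket m) :
    xCoord a (shiftBy d ω) n = xCoord a ω (n + d) := by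
  unfold xCoord
  congr 1
  funext j
  simp only [future, shiftBy]
  congr 1; ring

lemma zCoord_shiftBy (d n : ℤ) (ω : ℤ → Bracket m) :
    zCoord b (shiftBy d ω) n = zCoord b ω (n + d) := by
  unfold zCoord
  congr 1
  funext j
  simp only [past, shiftBy]
  congr 1; ring

lemma rev_shiftBy (d : ℤ) (ω : ℤ → Bracket m) : rev (shiftBy d ω) = shiftBy (-d) (rev ω) := by
  funext k
  simp only [rev, shiftBy]
  congr 2; ring

lemma pointα_shiftBy (n : ℤ) (ω : ℤ → Bracket m) :
    pointα a b (shiftBy n ω) = point (xCoord a ω n, yCoord ω n, zCoord b ω n) := by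
  rw [pointα, xCoord_shiftBy, yCoord_shiftBy, zCoord_shiftBy, zero_add]

lemma pointβ_rev_shiftBy (n : ℤ) (ω : ℤ → Bracket m) :
    pointβ a b (rev (shiftBy (-n) ω))
      = point (xCoord a (rev ω) n, yCoord ω (-n), zCoord b (rev ω) n) := by
  rw [pointβ, rev_rev, yCoord_shiftBy, rev_shiftBy, neg_neg, xCoord_shiftBy, zCoord_shiftBy,
    zero_add, zero_add]

variable {ha : a ∈ Ioo (0 : ℝ) (1 / m)} {hb : b ∈ Ioo (0 : ℝ) (1 / m)} [NeZero m]

lemma orbit_pointα {η : ℤ → Fin m ⊕ Unit} (h : Regular (fill η)) (n : ℤ) :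
    (pointα a b (fill (shiftBy n η)) : ℝ × ℝ × ℝ) ∈ interior (Ω a (fill η n)) ∧
      letter ha (pointα a b (fill (shiftBy n η))) = fill η n ∧
      map ha hb (pointα a b (fill (shiftBy n η))) = pointα a b (fill (shiftBy (n + 1) η)) := by
  obtain ⟨q, h1, h2⟩ := exists_orbitα ha hb h
  simp only [fill_shiftBy, pointα_shiftBy, ← h1]
  exact ⟨(h2 n).1, (letter_eq_iff ha).2 (interior_subset (h2 n).1), (h2 n).2⟩

lemma orbit_pointβ {η : ℤ → Fin m ⊕ Unit} (h : Regular (fill η)) (n : ℤ) :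
    (pointβ a b (rev (fill (shiftBy (-n) η))) : ℝ × ℝ × ℝ) ∈ interior (Ω a (rev (fill η) n)) ∧
      letter ha (pointβ a b (rev (fill (shiftBy (-n) η)))) = rev (fill η) n ∧
      map ha hb (pointβ a b (rev (fill (shiftBy (-n) η))))
        = pointβ a b (rev (fill (shiftBy (-(n + 1)) η))) := by
  obtain ⟨q, h1, h2⟩ := exists_orbitβ ha hb h
  simp only [fill_shiftBy, pointβ_rev_shiftBy, ← h1]
  exact ⟨(h2 n).1, (letter_eq_iff ha).2 (interior_subset (h2 n).1), (h2 n).2⟩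

omit [NeZero m] in
lemma shiftBy_zero {S : Type*} (η : ℤ → S) : shiftBy 0 η = η := by
  funext k; simp [shiftBy]

lemma iterate_pointα {η : ℤ → Fin m ⊕ Unit} (h : Regular (fill η)) (n : ℕ) :
    (map ha hb)^[n] (pointα a b (fill η)) = pointα a b (fill (shiftBy n η)) := by
  induction n with
  | zero => simp [shiftBy_zero]
  | succ n ih =>
    rw [Function.iterate_succ_apply', ih, (orbit_pointα (ha := ha) (hb := hb) h n).2.2]
    push_cast; rfl

lemma iterate_pointβ {η : ℤ → Fin m ⊕ Unit} (h : Regular (fill η)) (n : ℕ) :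
    (map ha hb)^[n] (pointβ a b (rev (fill η))) = pointβ a b (rev (fill (shiftBy (-n) η))) := by
  induction n with
  | zero => simp [shiftBy_zero]
  | succ n ih =>
    rw [Function.iterate_succ_apply', ih, (orbit_pointβ (ha := ha) (hb := hb) h n).2.2]
    push_cast; rfl

lemma measurable_pointα_fill (a b : ℝ) :
    Measurable fun η : ℤ → Fin m ⊕ Unit => pointα a b (fill η) :=
  (measurable_pointα a b).comp measurable_fill

lemma measurable_pointβ_rev_fill (a b : ℝ) :
    Measurable fun η : ℤ → Fin m ⊕ Unit => pointβ a b (rev (fill η)) :=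
  (measurable_pointβ a b).comp (measurable_rev.comp measurable_fill)

theorem isProbabilityMeasure_muα (hm : 2 ≤ m) : IsProbabilityMeasure (muα ha hb) := by
  rw [muα_eq hm]
  exact Measure.isProbabilityMeasure_map (measurable_pointα_fill a b).aemeasurable

theorem isProbabilityMeasure_muβ (hm : 2 ≤ m) : IsProbabilityMeasure (muβ ha hb) := by
  rw [muβ_eq hm]
  exact Measure.isProbabilityMeasure_map (measurable_pointβ_rev_fill a b).aemeasurable

theorem ergodic_muα (hm : 2 ≤ m) : Ergodic (map ha hb) (muα ha hb) := by
  rw [muα_eq hm]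
  refine Dynamics.ergodic_map_of_ae_semiconj (ergodic_shiftBy _ one_ne_zero) (measurable_map ha hb)
    (measurable_pointα_fill a b) ?_
  filter_upwards [ae_regular_fill hm] with η hη
  exact (iterate_pointα hη 1).symm

theorem ergodic_muβ (hm : 2 ≤ m) : Ergodic (map ha hb) (muβ ha hb) := by
  rw [muβ_eq hm]
  refine Dynamics.ergodic_map_of_ae_semiconj (ergodic_shiftBy _ (neg_ne_zero.2 one_ne_zero))
    (measurable_map ha hb) (measurable_pointβ_rev_fill a b) ?_
  filter_upwards [ae_regular_fill hm] with η hη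
  exact (iterate_pointβ hη 1).symm

omit [NeZero m] in
lemma _root_.Dyck.bernoulli_real_eval_preimage (k : ℤ) (A : Finset (Fin m ⊕ Unit)) :
    (bernoulli (Fin m ⊕ Unit)).real {η | η k ∈ A} = A.card / (m + 1) := by
  have h := measurePreserving_eval_infinitePi
    (fun _ : ℤ => (PMF.uniformOfFintype (Fin m ⊕ Unit)).toMeasure) k
  have h1 : (bernoulli (Fin m ⊕ Unit)).real {η | η k ∈ A}
      = (PMF.uniformOfFintype (Fin m ⊕ Unit)).toMeasure.real A :=
    congrArg ENNReal.toReal (h.measure_preimage A.measurableSet.nullMeasurableSet)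
  rw [h1, Measure.real, PMF.toMeasure_uniformOfFintype_apply _ (by exact A.measurableSet)]
  simp only [ENNReal.toReal_div]
  norm_num
  norm_cast

theorem muα_real (hm : 2 ≤ m) :
    (muα ha hb).real {p | ∃ i : Fin m, (p : ℝ × ℝ × ℝ) ∈ Ω a (Sum.inl i)} = m / (m + 1) := by
  have hms : MeasurableSet {p : cube | ∃ i : Fin m, (p : ℝ × ℝ × ℝ) ∈ Ω a (Sum.inl i)} := by
    rw [ofPred_exists]
    exact MeasurableSet.iUnion fun i => measurable_subtype_coe (measurableSet_Ω (Sum.inl i))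
  have h1 := bernoulli_real_eval_preimage (m := m) 0 (Finset.univ.map Function.Embedding.inl)
  rw [Finset.card_map, Finset.card_univ, Fintype.card_fin] at h1
  rw [muα_eq hm, map_measureReal_apply (measurable_pointα_fill a b) hms, ← h1]
  refine measureReal_congr ?_
  filter_upwards [ae_regular_fill hm] with η hη
  have h2 := (orbit_pointα (ha := ha) (hb := hb) hη 0).2.1
  rw [shiftBy_zero] at h2
  have h3 : (∃ i : Fin m, (pointα a b (fill η) : ℝ × ℝ × ℝ) ∈ Ω a (Sum.inl i))
      ↔ η 0 ∈ Finset.univ.map Function.Embedding.inl := by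
    simp only [← letter_eq_iff ha, h2, fill_eq_inl_iff, Finset.mem_map, Finset.mem_univ, true_and,
      Function.Embedding.inl_apply, eq_comm]
  exact propext h3

theorem muβ_real (hm : 2 ≤ m) :
    (muβ ha hb).real {p | ∃ i : Fin m, (p : ℝ × ℝ × ℝ) ∈ Ω a (Sum.inr i)} = m / (m + 1) := by
  have hms : MeasurableSet {p : cube | ∃ i : Fin m, (p : ℝ × ℝ × ℝ) ∈ Ω a (Sum.inr i)} := by
    rw [ofPred_exists]
    exact MeasurableSet.iUnion fun i => measurable_subtype_coe (measurableSet_Ω (Sum.inr i))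
  have h1 := bernoulli_real_eval_preimage (m := m) (-1) (Finset.univ.map Function.Embedding.inl)
  rw [Finset.card_map, Finset.card_univ, Fintype.card_fin] at h1
  rw [muβ_eq hm, map_measureReal_apply (measurable_pointβ_rev_fill a b) hms, ← h1]
  refine measureReal_congr ?_
  filter_upwards [ae_regular_fill hm] with η hη
  have h2 := (orbit_pointβ (ha := ha) (hb := hb) hη 0).2.1
  rw [neg_zero, shiftBy_zero] at h2
  have h3 : ∀ i : Fin m, rev (fill η) 0 = Sum.inr i ↔ η (-1) = Sum.inl i := fun i => by
    rw [← fill_eq_inl_iff, rev, sub_zero]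
    rcases fill η (-1) with j | j <;> simp
  have h4 : (∃ i : Fin m, (pointβ a b (rev (fill η)) : ℝ × ℝ × ℝ) ∈ Ω a (Sum.inr i))
      ↔ η (-1) ∈ Finset.univ.map Function.Embedding.inl := by
    simp only [← letter_eq_iff ha, h2, h3, Finset.mem_map, Finset.mem_univ, true_and,
      Function.Embedding.inl_apply, eq_comm]
  exact propext h4

/-- The partition of the cube into the pieces. -/
noncomputable def pieces (ha : a ∈ Ioo (0 : ℝ) (1 / m)) (p : cube) :
    Fin (Fintype.card (Bracket m)) := Fintype.equivFin _ (letter ha p)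

omit [NeZero m] in
lemma measurable_pieces : Measurable (pieces ha) :=
  (measurable_of_finite _).comp (measurable_letter ha)

omit [NeZero m] in
lemma _root_.Shannon.shannon_map {X Y A : Type*} [MeasurableSpace X] [MeasurableSpace Y]
    {μ : Measure X} {g : X → Y} (hg : Measurable g) [Fintype A] [MeasurableSpace A]
    [MeasurableSingletonClass A] {Z : Y → A} (hZ : Measurable Z) :
    shannon (μ.map g) Z = shannon μ (Z ∘ g) := by
  unfold shannon
  refine Finset.sum_congr rfl fun a _ => ?_
  rw [map_measureReal_apply hg (hZ (measurableSet_singleton a))]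
  rfl

omit [NeZero m] in
lemma shannon_bernoulli (n : ℕ) {e : Fin n → ℤ} (he : Function.Injective e) :
    shannon (bernoulli (Fin m ⊕ Unit)) (fun η j => η (e j)) = n * Real.log (m + 1) := by
  have hfib : ∀ w : Fin n → Fin m ⊕ Unit, (bernoulli (Fin m ⊕ Unit)).real
      ((fun η j => η (e j)) ⁻¹' {w}) = ((m + 1 : ℝ)⁻¹) ^ n := by
    intro w
    have h1 : ((fun (η : ℤ → Fin m ⊕ Unit) (j : Fin n) => η (e j)) ⁻¹' {w})
        = Set.pi (Finset.univ.image e : Finset ℤ) fun i => {x | ∀ j, e j = i → x = w j} := by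
      ext η
      simp only [mem_preimage, mem_singleton_iff, funext_iff, Finset.coe_image, Finset.coe_univ,
        image_univ, Set.mem_pi, forall_mem_range, mem_ofPred_eq, he.eq_iff, forall_eq]
    have h2 : ∀ j, {x | ∀ i, e i = e j → x = w i} = {w j} := fun j => by
      ext x
      simp only [mem_ofPred_eq, mem_singleton_iff, he.eq_iff]
      exact ⟨fun h => h j rfl, fun h i hi => hi ▸ h⟩
    rw [h1, Dyck.bernoulli, Measure.real, Measure.infinitePi_pi _ fun i _ => MeasurableSet.of_discrete,
      Finset.prod_image fun i _ j _ h => he h]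
    simp only [h2, PMF.toMeasure_apply_singleton _ _ (measurableSet_singleton _),
      PMF.uniformOfFintype_apply, Finset.prod_const, Finset.card_univ, Fintype.card_fin,
      ENNReal.toReal_pow, ENNReal.toReal_inv, Fintype.card_sum, Fintype.card_unit]
    norm_num
    norm_cast
  have hm : (0 : ℝ) < m + 1 := by positivity
  simp only [shannon, hfib, Finset.sum_const, Finset.card_univ, Fintype.card_fun,
    Fintype.card_fin, Fintype.card_sum, Fintype.card_unit, Real.negMulLog, nsmul_eq_mul]
  rw [Real.log_pow, Real.log_inv]
  push_cast
  rw [show ((m : ℝ) + 1) ^ n * (-((m + 1 : ℝ)⁻¹) ^ n * (n * -Real.log (m + 1)))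
    = ((m + 1) * (m + 1 : ℝ)⁻¹) ^ n * (n * Real.log (m + 1)) by rw [mul_pow]; ring,
    mul_inv_cancel₀ hm.ne', one_pow, one_mul]

/-- The itinerary determines a Bernoulli word of the same length. -/
theorem le_joinEntropy_muα (hm : 2 ≤ m) (n : ℕ) :
    n * Real.log (m + 1) ≤ Dynamics.joinEntropy (map ha hb) (muα ha hb) (pieces ha) n := by
  have hmeas := Dynamics.measurable_itinerary (measurable_map ha hb) (measurable_pieces (ha := ha)) n
  rw [Dynamics.joinEntropy_eq_shannon, muα_eq hm, shannon_map (measurable_pointα_fill a b) hmeas,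
    ← shannon_bernoulli n (e := fun j => j) (Nat.cast_injective.comp Fin.val_injective)]
  refine shannon_le_of_determined (hmeas.comp (measurable_pointα_fill a b)) (ae_regular_fill hm) ?_
  intro η hη η' hη' h
  funext j
  have h1 := congrFun h j
  simp only [Function.comp, Dynamics.itinerary, iterate_pointα hη, iterate_pointα hη', pieces,
    EmbeddingLike.apply_eq_iff_eq] at h1
  rw [(orbit_pointα (ha := ha) (hb := hb) hη j).2.1,
    (orbit_pointα (ha := ha) (hb := hb) hη' j).2.1] at h1
  have h2 := congrFun (forgetRight_fill η) j
  have h3 := congrFun (forgetRight_fill η') j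
  rw [← h2, ← h3, forgetRight, forgetRight, h1]

theorem le_joinEntropy_muβ (hm : 2 ≤ m) (n : ℕ) :
    n * Real.log (m + 1) ≤ Dynamics.joinEntropy (map ha hb) (muβ ha hb) (pieces ha) n := by
  have hmeas := Dynamics.measurable_itinerary (measurable_map ha hb) (measurable_pieces (ha := ha)) n
  rw [Dynamics.joinEntropy_eq_shannon, muβ_eq hm, shannon_map (measurable_pointβ_rev_fill a b) hmeas,
    ← shannon_bernoulli n (e := fun j => -1 - j)
      (sub_right_injective.comp (Nat.cast_injective.comp Fin.val_injective))]
  refine shannon_le_of_determined (hmeas.comp (measurable_pointβ_rev_fill a b))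
    (ae_regular_fill hm) ?_
  intro η hη η' hη' h
  funext j
  have h1 := congrFun h j
  simp only [Function.comp, Dynamics.itinerary, iterate_pointβ hη, iterate_pointβ hη', pieces,
    EmbeddingLike.apply_eq_iff_eq] at h1
  rw [(orbit_pointβ (ha := ha) (hb := hb) hη j).2.1,
    (orbit_pointβ (ha := ha) (hb := hb) hη' j).2.1] at h1
  have h2 := congrFun (forgetRight_fill η) (-1 - j)
  have h3 := congrFun (forgetRight_fill η') (-1 - j)
  rw [← h2, ← h3, forgetRight, forgetRight, Sum.swap_leftInverse.injective h1]

end Baker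

/-! ### Words with one kind of subscripts forgotten -/

namespace Dyck
open Shannon
variable {m : ℕ}

/-- Replace every right bracket by one symbol. -/
def forget : Bracket m → Fin m ⊕ Unit := Sum.map id fun _ => ()

/-- `y` runs through stacks, read as expansions to the base `m`, during the first `n` steps of the
automaton that is driven by `u`; compare `Baker.IsStackPath`. -/
def StackSteps (u : ℕ → Bracket m) (y : ℕ → ℝ) (n : ℕ) : Prop :=
  ∀ k < n, (∀ i : Fin m, u k = Sum.inl i → y (k + 1) = (y k + (i : ℕ)) / m) ∧
    ∀ i : Fin m, u k = Sum.inr i → y k = (y (k + 1) + (i : ℕ)) / m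

lemma floor_pow_mul_lt {y : ℝ} (hy : y ∈ Ico (0 : ℝ) 1) (hm : 0 < m) (e : ℕ) :
    ⌊(m : ℝ) ^ e * y⌋₊ < m ^ e := by
  have hm' : (0 : ℝ) < m := by exact_mod_cast hm
  rw [Nat.floor_lt (mul_nonneg (by positivity) hy.1)]
  push_cast
  exact mul_lt_of_lt_one_right (by positivity) hy.2

lemma floor_pow_mul_push {y : ℝ} (hy : y ∈ Ico (0 : ℝ) 1) (hm : 0 < m) (i e : ℕ) :
    ⌊(m : ℝ) ^ (e + 1) * ((y + i) / m)⌋₊ = ⌊(m : ℝ) ^ e * y⌋₊ + i * m ^ e := by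
  have hm' : (0 : ℝ) < m := by exact_mod_cast hm
  rw [← Nat.floor_add_natCast (mul_nonneg (by positivity) hy.1)]
  congr 1
  push_cast
  field_simp
  ring

/-- The subscripts of the right brackets can be recovered from the other letters and from finitely
many digits of the initial stack. -/
lemma eq_of_stackSteps {n : ℕ} {u u' : ℕ → Bracket m} {y y' : ℕ → ℝ} (hs : StackSteps u y n)
    (hs' : StackSteps u' y' n) (hy : ∀ k ≤ n, y k ∈ Ico (0 : ℝ) 1)
    (hy' : ∀ k ≤ n, y' k ∈ Ico (0 : ℝ) 1) {e : ℕ → ℕ}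
    (he : ∀ k < n, (e (k + 1) : ℤ) = e k + sign (u k))
    (hq : ∀ k < n, forget (u k) = forget (u' k))
    (h0 : ⌊(m : ℝ) ^ e 0 * y 0⌋₊ = ⌊(m : ℝ) ^ e 0 * y' 0⌋₊) :
    ∀ k ≤ n, ⌊(m : ℝ) ^ e k * y k⌋₊ = ⌊(m : ℝ) ^ e k * y' k⌋₊ ∧ ∀ j < k, u j = u' j := by
  intro k
  induction k with
  | zero => exact fun _ => ⟨h0, fun j hj => absurd hj (Nat.not_lt_zero _)⟩
  | succ k ih =>
    intro hk
    obtain ⟨hf, hj⟩ := ih (by omega)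
    have hek := he k (by omega)
    have hqk := hq k (by omega)
    have key : ⌊(m : ℝ) ^ e (k + 1) * y (k + 1)⌋₊ = ⌊(m : ℝ) ^ e (k + 1) * y' (k + 1)⌋₊ ∧
        u k = u' k := by
      rcases hu : u k with i | i <;> rcases hu' : u' k with i' | i' <;> rw [hu, hu'] at hqk <;>
        simp only [forget, Sum.map_inl, Sum.map_inr, id, Sum.inl.injEq, reduceCtorEq] at hqk
      · subst hqk
        rw [hu] at hek
        have hek' : e (k + 1) = e k + 1 := by simp only [sign] at hek; omega
        have hm : 0 < m := i.pos
        rw [hek', (hs k (by omega)).1 i hu, (hs' k (by omega)).1 i hu',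
          floor_pow_mul_push (hy k (by omega)) hm, floor_pow_mul_push (hy' k (by omega)) hm, hf]
        exact ⟨rfl, rfl⟩
      · rw [hu] at hek
        have hek' : e k = e (k + 1) + 1 := by simp only [sign] at hek; omega
        have hm : 0 < m := i.pos
        rw [hek', (hs k (by omega)).2 i hu, (hs' k (by omega)).2 i' hu',
          floor_pow_mul_push (hy (k + 1) hk) hm, floor_pow_mul_push (hy' (k + 1) hk) hm] at hf
        have h1 := floor_pow_mul_lt (hy (k + 1) hk) hm (e (k + 1))
        have h2 := floor_pow_mul_lt (hy' (k + 1) hk) hm (e (k + 1))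
        have h3 := congrArg (· / m ^ e (k + 1)) hf
        beta_reduce at h3
        rw [Nat.add_mul_div_right _ _ (by positivity), Nat.add_mul_div_right _ _ (by positivity),
          Nat.div_eq_of_lt h1, Nat.div_eq_of_lt h2, zero_add, zero_add] at h3
        rw [h3] at hf
        exact ⟨Nat.add_right_cancel hf, congrArg Sum.inr (Fin.ext h3)⟩
    refine ⟨key.1, fun j hjk => ?_⟩
    rcases Nat.lt_succ_iff_lt_or_eq.1 hjk with h | rfl
    · exact hj j h
    · exact key.2

/-- The depth of the deepest point of the first `n` steps of a walk below its starting point. -/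
def dip (s : ℕ → ℤ) (n : ℕ) : ℕ :=
  (Finset.range (n + 1)).sup fun k => (-∑ j ∈ Finset.range k, s j).toNat

lemma dip_congr {s s' : ℕ → ℤ} {n : ℕ} (h : ∀ j < n, s j = s' j) : dip s n = dip s' n := by
  refine Finset.sup_congr rfl fun k hk => ?_
  rw [Finset.sum_congr rfl fun j hj => h j ?_]
  have := Finset.mem_range.1 hk
  have := Finset.mem_range.1 hj
  omega

lemma neg_sum_le_dip {s : ℕ → ℤ} {n k : ℕ} (hk : k ≤ n) :
    -∑ j ∈ Finset.range k, s j ≤ dip s n := by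
  have := Finset.le_sup (f := fun k => (-∑ j ∈ Finset.range k, s j).toNat)
    (Finset.mem_range.2 (Nat.lt_succ_of_le hk))
  exact (Int.self_le_toNat _).trans (by exact_mod_cast this)

lemma dip_le {s : ℕ → ℤ} {n : ℕ} (hs : ∀ j, -1 ≤ s j) : dip s n ≤ n := by
  refine Finset.sup_le fun k hk => ?_
  have h1 : ∑ j ∈ Finset.range k, (-1 : ℤ) ≤ ∑ j ∈ Finset.range k, s j :=
    Finset.sum_le_sum fun j _ => hs j
  have := Finset.mem_range.1 hk
  simp at h1
  omega

lemma dip_le_of_forall {s : ℕ → ℤ} {n : ℕ} {M : ℝ} (hM : 0 ≤ M)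
    (h : ∀ k ≤ n, -(∑ j ∈ Finset.range k, (s j : ℝ)) ≤ M) : (dip s n : ℝ) ≤ M := by
  obtain ⟨k, hk, he⟩ := Finset.exists_mem_eq_sup (Finset.range (n + 1)) ⟨0, by simp⟩
    fun k => (-∑ j ∈ Finset.range k, s j).toNat
  rw [dip, he]
  have h1 := h k (Nat.lt_succ_iff.1 (Finset.mem_range.1 hk))
  have h2 : (((-∑ j ∈ Finset.range k, s j).toNat : ℕ) : ℝ)
      = max (-(∑ j ∈ Finset.range k, (s j : ℝ))) 0 := by
    rw [← Int.cast_natCast, Int.toNat_eq_max]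
    push_cast; rfl
  rw [h2]
  exact max_le h1 hM

/-- The sign of a symbol. -/
def forgetSign : Fin m ⊕ Unit → ℤ := Sum.elim (fun _ => 1) fun _ => -1

lemma forgetSign_forget (γ : Bracket m) : forgetSign (forget γ) = sign γ := by
  rcases γ with i | i <;> rfl

lemma neg_one_le_sign (γ : Bracket m) : -1 ≤ sign γ := by
  rcases γ with i | i <;> simp [sign]

/-- The depth of the walk that is described by a word. -/
def wordDip {n : ℕ} (w : Fin n → Fin m ⊕ Unit) : ℕ :=
  dip (fun j => if h : j < n then forgetSign (w ⟨j, h⟩) else 0) n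

lemma wordDip_forget {n : ℕ} (u : ℕ → Bracket m) :
    wordDip (fun j : Fin n => forget (u j)) = dip (fun j => sign (u j)) n :=
  dip_congr fun j hj => by simp only [dif_pos hj, forgetSign_forget]

variable {Ω : Type*} [MeasurableSpace Ω] {μ : Measure Ω} [IsProbabilityMeasure μ]

/-- Forgetting the subscripts of the right brackets reduces the entropy of a word at most by the
logarithm of the number of initial stacks, truncated to the digits that are ever exposed. -/
theorem shannon_word_le (hm : 0 < m) {n : ℕ} {u : Ω → ℕ → Bracket m}
    (hu : ∀ j, Measurable fun ω => u ω j) {y : Ω → ℕ → ℝ} (hy0 : Measurable fun ω => y ω 0)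
    (h : ∀ᵐ ω ∂μ, StackSteps (u ω) (y ω) n ∧ ∀ k ≤ n, y ω k ∈ Ico (0 : ℝ) 1) :
    shannon μ (fun ω (j : Fin n) => u ω j) ≤ shannon μ (fun ω (j : Fin n) => forget (u ω j))
      + (∫ ω, (dip (fun j => sign (u ω j)) n : ℝ) ∂μ) * Real.log m := by
  set Y : Ω → Fin n → Fin m ⊕ Unit := fun ω j => forget (u ω j) with hY
  have hYm : Measurable Y := measurable_pi_lambda _ fun j => (measurable_of_finite forget).comp (hu j)
  have hdip : ∀ ω, wordDip (Y ω) = dip (fun j => sign (u ω j)) n := fun ω => wordDip_forget (u ω)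
  have hfl : Measurable fun ω => ⌊(m : ℝ) ^ wordDip (Y ω) * y ω 0⌋₊ :=
    Nat.measurable_floor.comp
      (((measurable_of_finite fun w => (m : ℝ) ^ wordDip w).comp hYm).mul hy0)
  set U : Ω → Fin (m ^ n + 1) := fun ω =>
    ⟨min ⌊(m : ℝ) ^ wordDip (Y ω) * y ω 0⌋₊ (m ^ n), by omega⟩ with hU
  have hUm : Measurable U :=
    (measurable_of_countable fun k : ℕ => (⟨min k (m ^ n), by omega⟩ : Fin (m ^ n + 1))).comp hfl
  have hle : ∀ ω, wordDip (Y ω) ≤ n := fun ω => by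
    rw [hdip]; exact dip_le fun j => neg_one_le_sign _
  have hUlt : ∀ ω, y ω 0 ∈ Ico (0 : ℝ) 1 →
      (U ω : ℕ) = ⌊(m : ℝ) ^ wordDip (Y ω) * y ω 0⌋₊ ∧ (U ω : ℕ) < m ^ wordDip (Y ω) := by
    intro ω hω
    have h1 := floor_pow_mul_lt hω hm (wordDip (Y ω))
    have h2 : m ^ wordDip (Y ω) ≤ m ^ n := Nat.pow_le_pow_right hm (hle ω)
    have h3 : (U ω : ℕ) = ⌊(m : ℝ) ^ wordDip (Y ω) * y ω 0⌋₊ := by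
      simp only [hU]
      omega
    exact ⟨h3, h3 ▸ h1⟩
  have h1 : shannon μ (fun ω (j : Fin n) => u ω j) ≤ shannon μ fun ω => (Y ω, U ω) := by
    refine shannon_le_of_determined (hYm.prodMk hUm) h ?_
    rintro ω ⟨hs, hyω⟩ ω' ⟨hs', hyω'⟩ heq
    have hYeq : Y ω = Y ω' := congrArg Prod.fst heq
    have hUeq : (U ω : ℕ) = U ω' := congrArg (fun z => (z.2 : ℕ)) heq
    rw [(hUlt ω (hyω 0 (Nat.zero_le _))).1, (hUlt ω' (hyω' 0 (Nat.zero_le _))).1, ← hYeq, hdip]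
      at hUeq
    have hpos : ∀ k ≤ n, 0 ≤ ∑ j ∈ Finset.range k, sign (u ω j)
        + (dip (fun j => sign (u ω j)) n : ℕ) := fun k hk => by
      have := neg_sum_le_dip (s := fun j => sign (u ω j)) hk
      omega
    have := (eq_of_stackSteps hs hs' hyω hyω'
      (e := fun k => (∑ j ∈ Finset.range k, sign (u ω j)
        + (dip (fun j => sign (u ω j)) n : ℕ)).toNat) (fun k hk => ?_)
      (fun k hk => congrFun hYeq ⟨k, hk⟩) (by simpa using hUeq) n le_rfl).2
    · funext j
      exact this j j.2
    · rw [Int.toNat_of_nonneg (hpos _ hk), Int.toNat_of_nonneg (hpos _ hk.le),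
        Finset.sum_range_succ]
      ring
  have h2 := shannon_pair_le_of_lt (μ := μ) hYm hUm (N := fun w => m ^ wordDip w)
    (fun w => by positivity) (h.mono fun ω hω => (hUlt ω (hω.2 0 (Nat.zero_le _))).2)
  have h3 : ∑ w, μ.real (Y ⁻¹' {w}) * Real.log ((m ^ wordDip w : ℕ) : ℝ)
      = (∫ ω, (dip (fun j => sign (u ω j)) n : ℝ) ∂μ) * Real.log m := by
    simp only [← hdip]
    have h4 : ∫ ω, (wordDip (Y ω) : ℝ) ∂μ = ∫ w, (wordDip w : ℝ) ∂(μ.map Y) :=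
      (integral_map (f := fun w => (wordDip w : ℝ)) hYm.aemeasurable
        (measurable_of_finite _).aestronglyMeasurable).symm
    have : IsProbabilityMeasure (μ.map Y) := Measure.isProbabilityMeasure_map hYm.aemeasurable
    rw [h4, integral_fintype (Integrable.of_finite), Finset.sum_mul]
    refine Finset.sum_congr rfl fun w _ => ?_
    rw [map_measureReal_apply hYm (measurableSet_singleton w), smul_eq_mul, Nat.cast_pow,
      Real.log_pow, mul_assoc]
  linarith [h1.trans h2]

/-- Words in which only one right bracket occurs. -/
lemma shannon_word_le_of_const {n : ℕ} {u : Ω → ℕ → Bracket m}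
    (hu : ∀ j, Measurable fun ω => u ω j)
    (h : ∀ᵐ ω ∂μ, ∀ j < n, ∀ i : Fin m, u ω j = Sum.inr i → (i : ℕ) + 1 = m) :
    shannon μ (fun ω (j : Fin n) => u ω j) ≤ shannon μ (fun ω (j : Fin n) => forget (u ω j)) := by
  refine shannon_le_of_determined
    (measurable_pi_lambda _ fun j => (measurable_of_finite forget).comp (hu j)) h ?_
  intro ω hω ω' hω' heq
  funext j
  have hj := congrFun heq j
  have h1 := hω j j.2
  have h2 := hω' j j.2
  beta_reduce at hj
  rcases hu : u ω j with i | i <;> rcases hu' : u ω' j with i' | i' <;> rw [hu, hu'] at hj <;>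
    simp only [forget, Sum.map_inl, Sum.map_inr, id, Sum.inl.injEq, reduceCtorEq] at hj
  · rw [hj]
  · have := h1 i hu
    have := h2 i' hu'
    exact congrArg Sum.inr (Fin.ext (by omega))

/-- A bracket is determined by its kind and, unless it is a right bracket, by its subscript. -/
lemma shannon_forget_le (hm : 0 < m) {q : Ω → Bracket m} (hq : Measurable q) :
    shannon μ (fun ω => forget (q ω))
      ≤ Real.log 2 + μ.real {ω | ∃ i, q ω = Sum.inl i} * Real.log m := by
  let kind : Bracket m → Bool := Sum.elim (fun _ => true) fun _ => false
  let label : Bracket m → Fin m := Sum.elim id fun _ => ⟨0, hm⟩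
  have hk : Measurable fun ω => kind (q ω) := (measurable_of_finite kind).comp hq
  have hl : Measurable fun ω => label (q ω) := (measurable_of_finite label).comp hq
  have h1 : shannon μ (fun ω => forget (q ω)) ≤ shannon μ fun ω => (kind (q ω), label (q ω)) := by
    refine shannon_le_of_determined (hk.prodMk hl) (G := univ) (by simp) fun ω _ ω' _ h => ?_
    simp only [Prod.mk.injEq] at h
    rcases hu : q ω with i | i <;> rcases hu' : q ω' with i' | i' <;> rw [hu, hu'] at h <;>
      simp_all [kind, label, forget]
  have h2 := shannon_pair_le_of_lt (μ := μ) hk hl (N := fun b => if b then m else 1)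
    (fun b => by split_ifs <;> omega) (Eventually.of_forall fun ω => by
      rcases q ω with i | i <;> simp [kind, label])
  have h3 : shannon μ (fun ω => kind (q ω)) ≤ Real.log 2 := by
    simpa using shannon_le_log_card (μ := μ) hk
  have h4 : (fun ω => kind (q ω)) ⁻¹' {true} = {ω | ∃ i, q ω = Sum.inl i} := by
    ext ω
    simp only [mem_preimage, mem_singleton_iff, mem_ofPred_eq]
    rcases q ω with i | i <;> simp [kind]
  simp only [Fintype.sum_bool, h4] at h2
  simp only [if_true, Bool.false_eq_true, if_false, Nat.cast_one, Real.log_one, mul_zero,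
    add_zero] at h2
  linarith

end Dyck

/-! ### Upper bounds for the entropy of ergodic measures of the baker map -/

namespace Dynamics

section
variable {Ω : Type*} [MeasurableSpace Ω] {μ : Measure Ω} {T : Ω → Ω}

omit [MeasurableSpace Ω] in
lemma abs_birkhoffSum_le_maxDeviation (g : Ω → ℝ) (c : ℝ) {k n : ℕ} (hk : k ≤ n) (x : Ω) :
    |birkhoffSum T g k x - k * c| ≤ maxDeviation T g c n x :=
  Finset.le_sup' (fun k => |birkhoffSum T g k x - k * c|)
    (Finset.mem_range.2 (Nat.lt_succ_of_le hk))

omit [MeasurableSpace Ω] in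
lemma maxDeviation_nonneg (g : Ω → ℝ) (c : ℝ) (n : ℕ) (x : Ω) : 0 ≤ maxDeviation T g c n x :=
  (abs_nonneg _).trans (abs_birkhoffSum_le_maxDeviation g c (Nat.zero_le n) x)

lemma integrable_maxDeviation [IsFiniteMeasure μ] (hT : Measurable T) {g : Ω → ℝ}
    (hg : Measurable g) {C c : ℝ} (hC : ∀ x, |g x - c| ≤ C) (n : ℕ) :
    Integrable (maxDeviation T g c n) μ := by
  refine Integrable.of_bound (measurable_maxDeviation hT hg c n).aestronglyMeasurable (n * C)
    (Eventually.of_forall fun x => ?_)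
  rw [Real.norm_of_nonneg (maxDeviation_nonneg g c n x)]
  refine Finset.sup'_le _ _ fun k hk => (abs_birkhoffSum_sub_le hC k x).trans ?_
  have hk' : (k : ℝ) ≤ n := by exact_mod_cast Nat.lt_succ_iff.1 (Finset.mem_range.1 hk)
  exact mul_le_mul_of_nonneg_right hk' ((abs_nonneg _).trans (hC x))

end

/-- If a map preserves the order of a coordinate between points with the same itinerary, then
the itinerary and the sum of the rounded coordinates along an orbit segment determine all the
rounded coordinates. -/
lemma rounded_eq_of_sum_eq {Ω Λ : Type*} {T : Ω → Ω} {D : Ω → Λ} {X : Ω → ℝ}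
    (hX : ∀ p q, D p = D q → X p ≤ X q → X (T p) ≤ X (T q)) {g : ℝ → ℕ} (hg : Monotone g) {n : ℕ}
    {p q : Ω} (hD : ∀ j < n, D (T^[j] p) = D (T^[j] q))
    (hsum : ∑ j ∈ Finset.range n, g (X (T^[j] p)) = ∑ j ∈ Finset.range n, g (X (T^[j] q))) :
    ∀ j < n, g (X (T^[j] p)) = g (X (T^[j] q)) := by
  wlog h : X p ≤ X q generalizing p q
  · exact fun j hj => (this (fun j hj => (hD j hj).symm) hsum.symm (le_of_not_ge h) j hj).symm
  have hle : ∀ j < n, X (T^[j] p) ≤ X (T^[j] q) := by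
    intro j
    induction j with
    | zero => exact fun _ => h
    | succ j ih =>
      intro hj
      rw [Function.iterate_succ_apply', Function.iterate_succ_apply']
      exact hX _ _ (hD j (by omega)) (ih (by omega))
  exact fun j hj => (Finset.sum_eq_sum_iff_of_le fun i hi =>
    hg (hle i (Finset.mem_range.1 hi))).1 hsum j (Finset.mem_range.2 hj)

end Dynamics

namespace Baker
open Dyck Affine BernoulliShift Shannon Dynamics
variable {m : ℕ} {a b : ℝ}

/-- Round to a multiple of `1 / (N + 1)`. -/
noncomputable def grid (N : ℕ) (x : ℝ) : ℕ := min ⌊((N : ℝ) + 1) * x⌋₊ (N + 1)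

lemma monotone_grid (N : ℕ) : Monotone (grid N) := fun x y h =>
  min_le_min_right _ (Nat.floor_mono (by gcongr))

lemma grid_le (N : ℕ) (x : ℝ) : grid N x ≤ N + 1 := min_le_right _ _

lemma measurable_grid (N : ℕ) : Measurable (grid N) := (monotone_grid N).measurable

lemma abs_sub_lt_of_grid_eq {N : ℕ} {x y : ℝ} (hx : x ∈ Icc (0 : ℝ) 1) (hy : y ∈ Icc (0 : ℝ) 1)
    (h : grid N x = grid N y) : |x - y| < 1 / (N + 1) := by
  have hN : (0 : ℝ) < N + 1 := by positivity
  have key : ∀ t ∈ Icc (0 : ℝ) 1, grid N t = ⌊((N : ℝ) + 1) * t⌋₊ := fun t ht => by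
    refine min_eq_left (Nat.floor_le_of_le ?_)
    push_cast
    exact mul_le_of_le_one_right hN.le ht.2
  rw [key x hx, key y hy] at h
  have h1 := Nat.floor_le (mul_nonneg hN.le hx.1)
  have h2 := Nat.lt_floor_add_one (((N : ℝ) + 1) * x)
  have h3 := Nat.floor_le (mul_nonneg hN.le hy.1)
  have h4 := Nat.lt_floor_add_one (((N : ℝ) + 1) * y)
  rw [h] at h1 h2
  have e : |x - y| * (N + 1) = |(x - y) * (N + 1)| := by rw [abs_mul, abs_of_pos hN]
  rw [lt_div_iff₀ hN, e, abs_lt]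
  constructor <;> linarith

/-- The cells of a grid of mesh `1 / (N + 1)`. -/
noncomputable def cell (N : ℕ) (p : cube) : Fin (N + 2) × Fin (N + 2) × Fin (N + 2) :=
  (⟨grid N p.1.1, Nat.lt_succ_of_le (grid_le _ _)⟩, ⟨grid N p.1.2.1, Nat.lt_succ_of_le (grid_le _ _)⟩,
    ⟨grid N p.1.2.2, Nat.lt_succ_of_le (grid_le _ _)⟩)

lemma measurable_cell (N : ℕ) : Measurable (cell N) := by
  have h : ∀ X : cube → ℝ, Measurable X → Measurable fun p =>
      (⟨grid N (X p), Nat.lt_succ_of_le (grid_le _ _)⟩ : Fin (N + 2)) := fun X hX => by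
    have h1 := (measurable_of_countable fun k : ℕ => (⟨min k (N + 1), by omega⟩ : Fin (N + 2))).comp
      ((measurable_grid N).comp hX)
    convert h1 using 2 with p
    exact Fin.ext (min_eq_left (grid_le _ _)).symm
  have hc : Measurable (Subtype.val : cube → ℝ × ℝ × ℝ) := measurable_subtype_coe
  exact (h _ hc.fst).prodMk ((h _ hc.snd.fst).prodMk (h _ hc.snd.snd))

lemma exists_cell_mesh {δ : ℝ} (hδ : 0 < δ) : ∃ N, ∀ p q, cell N p = cell N q → dist p q < δ := by
  obtain ⟨N, hN⟩ := exists_nat_one_div_lt hδ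
  refine ⟨N, fun p q h => ?_⟩
  simp only [cell, Prod.mk.injEq, Fin.mk.injEq] at h
  rw [Subtype.dist_eq, Prod.dist_eq, Prod.dist_eq]
  refine lt_trans ?_ hN
  obtain ⟨hp1, hp2, hp3⟩ := p.2
  obtain ⟨hq1, hq2, hq3⟩ := q.2
  simp only [max_lt_iff, Real.dist_eq]
  exact ⟨abs_sub_lt_of_grid_eq hp1 hq1 h.1, abs_sub_lt_of_grid_eq hp2 hq2 h.2.1,
    abs_sub_lt_of_grid_eq hp3 hq3 h.2.2⟩

variable (ha : a ∈ Ioo (0 : ℝ) (1 / m)) (hb : b ∈ Ioo (0 : ℝ) (1 / m))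

lemma monotone_coordinates (p q : cube) (h : letter ha p = letter ha q) :
    (p.1.1 ≤ q.1.1 → (map ha hb p).1.1 ≤ (map ha hb q).1.1) ∧
      (p.1.2.1 ≤ q.1.2.1 → (map ha hb p).1.2.1 ≤ (map ha hb q).1.2.1) ∧
      (p.1.2.2 ≤ q.1.2.2 → (map ha hb p).1.2.2 ≤ (map ha hb q).1.2.2) := by
  obtain ⟨hm, hma⟩ := pos_of_mem ha
  obtain ⟨-, hmb⟩ := pos_of_mem hb
  have ha0 := ha.1
  have hb0 := hb.1
  have h1 : 0 < 1 - m * a := by linarith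
  have h2 : 0 ≤ 1 - m * b := by linarith
  simp only [coe_map, ← h]
  rcases letter ha p with i | i <;> refine ⟨fun h => ?_, fun h => ?_, fun h => ?_⟩ <;>
    simp only [branch] <;> gcongr

variable {ν : Measure cube} [IsProbabilityMeasure ν]

/-- The word of length `n` that is the itinerary of a point. -/
noncomputable def word (n : ℕ) (p : cube) : Fin n → Bracket m :=
  fun j => letter ha ((map ha hb)^[j] p)

lemma measurable_letter_iterate (j : ℕ) :
    Measurable fun p => letter ha ((map ha hb)^[j] p) :=
  (measurable_letter ha).comp ((measurable_map ha hb).iterate j)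

/-- Apart from the itinerary, the positions in a grid along an orbit segment carry only
logarithmic information. -/
lemma shannon_cell_le (N n : ℕ) :
    shannon ν (fun p (j : Fin n) => cell N ((map ha hb)^[j] p))
      ≤ shannon ν (word ha hb n) + 3 * Real.log (n * (N + 1) + 1) := by
  have hD : Measurable (word ha hb n) :=
    measurable_pi_lambda _ fun j => measurable_letter_iterate ha hb j
  let S : (cube → ℝ) → cube → Fin (n * (N + 1) + 1) := fun X p =>
    ⟨∑ j ∈ Finset.range n, grid N (X ((map ha hb)^[j] p)), Nat.lt_succ_of_le
      ((Finset.sum_le_card_nsmul _ _ _ fun j _ => grid_le N _).trans (by simp))⟩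
  have hS : ∀ X : cube → ℝ, Measurable X → Measurable (S X) := fun X hX => by
    have h0 : Measurable fun p => ∑ j ∈ Finset.range n, grid N (X ((map ha hb)^[j] p)) :=
      Finset.measurable_sum _ fun j _ =>
        (measurable_grid N).comp (hX.comp ((measurable_map ha hb).iterate j))
    have h1 := (measurable_of_countable fun k : ℕ =>
      (⟨min k (n * (N + 1)), by omega⟩ : Fin (n * (N + 1) + 1))).comp h0
    exact (congrArg Measurable (funext fun p => Fin.ext
      (min_eq_left (Nat.lt_succ_iff.1 (S X p).2)))).mp h1
  have hc : Measurable (Subtype.val : cube → ℝ × ℝ × ℝ) := measurable_subtype_coe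
  have hx := hS _ hc.fst
  have hy := hS _ hc.snd.fst
  have hz := hS _ hc.snd.snd
  have h1 : shannon ν (fun p (j : Fin n) => cell N ((map ha hb)^[j] p))
      ≤ shannon ν fun p => (word ha hb n p, S (fun p => p.1.1) p, S (fun p => p.1.2.1) p,
        S (fun p => p.1.2.2) p) := by
    refine shannon_le_of_determined (hD.prodMk (hx.prodMk (hy.prodMk hz))) (G := univ) (by simp) ?_
    intro p _ q _ h
    simp only [Prod.mk.injEq, S, Fin.mk.injEq] at h
    obtain ⟨hw, h1, h2, h3⟩ := h
    have hw' : ∀ j < n, letter ha ((map ha hb)^[j] p) = letter ha ((map ha hb)^[j] q) :=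
      fun j hj => congrFun hw ⟨j, hj⟩
    have e1 := rounded_eq_of_sum_eq (X := fun p : cube => p.1.1)
      (fun p q hpq => (monotone_coordinates ha hb p q hpq).1) (monotone_grid N) hw' h1
    have e2 := rounded_eq_of_sum_eq (X := fun p : cube => p.1.2.1)
      (fun p q hpq => (monotone_coordinates ha hb p q hpq).2.1) (monotone_grid N) hw' h2
    have e3 := rounded_eq_of_sum_eq (X := fun p : cube => p.1.2.2)
      (fun p q hpq => (monotone_coordinates ha hb p q hpq).2.2) (monotone_grid N) hw' h3
    funext j
    exact Prod.ext (Fin.ext (e1 j j.2)) (Prod.ext (Fin.ext (e2 j j.2)) (Fin.ext (e3 j j.2)))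
  have hlog : ∀ X : cube → ℝ, Measurable X → shannon ν (S X) ≤ Real.log (n * (N + 1) + 1) :=
    fun X hX => by
      have := shannon_le_log_card (μ := ν) (hS X hX)
      simpa using this
  have h2 := shannon_pair_le (μ := ν) hD (hx.prodMk (hy.prodMk hz))
  have h3 := shannon_pair_le (μ := ν) hx (hy.prodMk hz)
  have h4 := shannon_pair_le (μ := ν) hy hz
  have h5 := hlog _ hc.fst
  have h6 := hlog _ hc.snd.fst
  have h7 := hlog _ hc.snd.snd
  linarith

lemma eventually_log_le (N : ℕ) {ε : ℝ} (hε : 0 < ε) :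
    ∀ᶠ n : ℕ in atTop, 3 * Real.log (n * (N + 1) + 1) ≤ n * ε := by
  have h1 : Tendsto (fun n : ℕ => (n : ℝ) * (N + 1) + 1) atTop atTop :=
    tendsto_atTop_add_const_right _ _
      (tendsto_natCast_atTop_atTop.atTop_mul_const (by positivity))
  have h2 := (Real.isLittleO_log_id_atTop.comp_tendsto h1).def
    (show 0 < ε / (3 * (N + 2)) by positivity)
  filter_upwards [h2, eventually_ge_atTop 1] with n hn hn1
  have hn1' : (1 : ℝ) ≤ n := by exact_mod_cast hn1
  simp only [Function.comp, id, Real.norm_eq_abs] at hn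
  rw [abs_of_nonneg (by positivity : (0 : ℝ) ≤ n * (N + 1) + 1)] at hn
  have h3 := (le_abs_self _).trans hn
  have h4 : ε / (3 * (N + 2)) * (n * (N + 1) + 1) ≤ ε / (3 * (N + 2)) * (n * (N + 2)) :=
    mul_le_mul_of_nonneg_left (by linarith) (by positivity)
  have h5 : ε / (3 * (N + 2)) * (n * ((N : ℝ) + 2)) = n * ε / 3 := by field_simp
  linarith

lemma entropy_le_of_word (hν : MeasurePreserving (map ha hb) ν ν) {L : ℝ} {e : ℕ → ℝ}
    (he : Tendsto (fun n : ℕ => e n / n) atTop (𝓝 0))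
    (h : ∀ n, shannon ν (word ha hb n) ≤ n * L + e n) :
    entropy (map ha hb) ν ≤ ENNReal.ofReal L := by
  refine entropy_le_of_cells hν measurable_cell (fun δ hδ => exists_cell_mesh hδ) fun N ε hε => ?_
  filter_upwards [eventually_log_le N (half_pos hε), he.eventually_le_const (half_pos hε),
    eventually_ge_atTop 1] with n h1 h2 h3
  have hn : (0 : ℝ) < n := by exact_mod_cast h3
  rw [div_le_iff₀ hn] at h2
  linarith [shannon_cell_le (ν := ν) ha hb N n, h n]

lemma map_y_of_inl {p : cube} {i : Fin m} (h : letter ha p = Sum.inl i) :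
    (map ha hb p).1.2.1 = (p.1.2.1 + (i : ℕ)) / m := by
  rw [coe_map, h]
  simp only [branch]
  ring

lemma y_of_inr {p : cube} {i : Fin m} (h : letter ha p = Sum.inr i) :
    p.1.2.1 = ((map ha hb p).1.2.1 + (i : ℕ)) / m := by
  obtain ⟨hm, -⟩ := pos_of_mem ha
  rw [coe_map, h]
  simp only [branch]
  field_simp
  ring

/-- The top face of the cube is backward invariant, and on it only the last subscript occurs. -/
lemma top_of_map_top {p : cube} (h : (map ha hb p).1.2.1 = 1) :
    p.1.2.1 = 1 ∧ ∀ i : Fin m, letter ha p = Sum.inl i ∨ letter ha p = Sum.inr i → (i : ℕ) + 1 = m := by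
  obtain ⟨hm, -⟩ := pos_of_mem ha
  have hp1 := p.2.2.1.2
  rcases hl : letter ha p with i | i
  · have h1 := map_y_of_inl ha hb hl
    rw [h, eq_div_iff hm.ne', one_mul] at h1
    have hi : ((i : ℕ) : ℝ) + 1 ≤ m := by exact_mod_cast i.2
    have h2 : ((i : ℕ) : ℝ) + 1 = m := by linarith
    refine ⟨by linarith, fun j hj => ?_⟩
    rcases hj with hj | hj
    · rw [← Sum.inl.inj hj]; exact_mod_cast h2
    · cases hj
  · have h1 := y_of_inr ha hb hl
    rw [h, eq_div_iff hm.ne'] at h1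
    have hi : ((i : ℕ) : ℝ) + 1 ≤ m := by exact_mod_cast i.2
    have hmem := mem_Ω_letter ha p
    rw [hl] at hmem
    obtain ⟨-, -, -, h3⟩ := hmem
    have h4 : p.1.2.1 = 1 ∧ (i : ℕ) + 1 = m := by
      rcases h3 with h3 | h3
      · rw [lt_div_iff₀ hm] at h3; linarith
      · exact ⟨h3.2, h3.1⟩
    refine ⟨h4.1, fun j hj => ?_⟩
    rcases hj with hj | hj
    · cases hj
    · rw [← Sum.inr.inj hj]; exact h4.2

/-- The direction of the stack automaton: `1` on the pieces `Ω a (Sum.inl i)`, `-1` on the others. -/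
noncomputable def direction (p : cube) : ℝ := sign (letter ha p)

lemma measurable_direction : Measurable (direction ha) :=
  (measurable_of_finite fun γ : Bracket m => (sign γ : ℝ)).comp (measurable_letter ha)

lemma abs_direction (p : cube) : |direction ha p| ≤ 1 := by
  unfold direction
  rcases letter ha p with i | i <;> simp [sign]

variable {ha hb}

/-- Either almost no orbit or almost every orbit is in the top face. -/
lemma top_or (hν : Ergodic (map ha hb) ν) :
    (∀ᵐ p ∂ν, ∀ j : ℕ, ((map ha hb)^[j] p).1.2.1 ∈ Ico (0 : ℝ) 1) ∨
      ∀ᵐ p ∂ν, ∀ j : ℕ, ((map ha hb)^[j] p).1.2.1 = 1 := by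
  have hms : MeasurableSet {p : cube | p.1.2.1 = 1} :=
    (measurable_subtype_coe.snd.fst : Measurable fun p : cube => p.1.2.1)
      (measurableSet_singleton (1 : ℝ))
  have hiter : ∀ {P : cube → Prop}, (∀ᵐ p ∂ν, P p) → ∀ᵐ p ∂ν, ∀ j : ℕ, P ((map ha hb)^[j] p) :=
    fun hP => ae_all_iff.2 fun j =>
      (hν.toMeasurePreserving.iterate j).quasiMeasurePreserving.ae hP
  rcases hν.ae_empty_or_univ_of_preimage_ae_le hms.nullMeasurableSet
    (Eventually.of_forall fun p hp => (top_of_map_top ha hb hp).1) with h | h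
  · refine Or.inl (hiter (P := fun p => p.1.2.1 ∈ Ico (0 : ℝ) 1) ?_)
    filter_upwards [eventuallyEq_empty.1 h] with p hp
    exact ⟨p.2.2.1.1, p.2.2.1.2.lt_of_ne hp⟩
  · exact Or.inr (hiter (P := fun p => p.1.2.1 = 1) (eventuallyEq_univ.1 h))

lemma direction_sum (p : cube) (k : ℕ) :
    birkhoffSum (map ha hb) (direction ha) k p
      = ∑ j ∈ Finset.range k, (sign (letter ha ((map ha hb)^[j] p)) : ℝ) := rfl

lemma shannon_tuple_le_mul (hν : MeasurePreserving (map ha hb) ν ν) {A : Type*} [Fintype A]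
    [MeasurableSpace A] [MeasurableSingletonClass A] {q : cube → A} (hq : Measurable q) {n : ℕ}
    (e : Fin n → ℕ) :
    shannon ν (fun p (j : Fin n) => q ((map ha hb)^[e j] p)) ≤ n * shannon ν q := by
  refine (shannon_tuple_le fun j => hq.comp (hν.iterate (e j)).measurable).trans_eq ?_
  have : ∀ j, shannon ν (q ∘ (map ha hb)^[e j]) = shannon ν q := fun j =>
    shannon_comp_measurePreserving (hν.iterate (e j)) hq
  have h2 : ∀ j, shannon ν (fun p => q ((map ha hb)^[e j] p)) = shannon ν q := this
  simp only [Function.comp_def, h2, Finset.sum_const, Finset.card_univ, Fintype.card_fin,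
    nsmul_eq_mul]

/-- If there are on average at least as many left as right brackets, then only the subscripts of
the left brackets contribute to the entropy. -/
theorem entropy_le_of_nonneg (hν : Ergodic (map ha hb) ν) (hc : 0 ≤ ∫ p, direction ha p ∂ν) :
    entropy (map ha hb) ν ≤ ENNReal.ofReal (shannon ν fun p => forget (letter ha p)) := by
  have hm : 0 < m := by exact_mod_cast (pos_of_mem ha).1
  have hm1 : (1 : ℝ) ≤ m := by exact_mod_cast hm
  set c := ∫ p, direction ha p ∂ν with hcdef
  have hq : Measurable fun p => forget (letter ha p) :=
    (measurable_of_finite forget).comp (measurable_letter ha)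
  have hlim := (tendsto_integral_maxDeviation hν (measurable_direction ha)
    (abs_direction ha)).mul_const (Real.log m)
  rw [zero_mul] at hlim
  refine entropy_le_of_word ha hb hν.toMeasurePreserving
    (e := fun n => (∫ p, maxDeviation (map ha hb) (direction ha) c n p ∂ν) * Real.log m)
    (hlim.congr fun n => by ring) fun n => ?_
  have hI0 : 0 ≤ ∫ p, maxDeviation (map ha hb) (direction ha) c n p ∂ν :=
    integral_nonneg fun p => maxDeviation_nonneg _ _ _ _
  have hforget := shannon_tuple_le_mul hν.toMeasurePreserving hq (n := n) fun j => j
  have hu := measurable_letter_iterate ha hb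
  rcases top_or hν with h | h
  · have h1 := shannon_word_le (μ := ν) hm (n := n)
      (u := fun p j => letter ha ((map ha hb)^[j] p)) hu
      (y := fun p j => ((map ha hb)^[j] p).1.2.1) (measurable_subtype_coe.snd.fst)
      (h.mono fun p hp => ⟨fun k _ => ⟨fun i hi => ?_, fun i hi => ?_⟩, fun k _ => hp k⟩)
    · have h2 : ∫ p, (dip (fun j => sign (letter ha ((map ha hb)^[j] p))) n : ℝ) ∂ν
          ≤ ∫ p, maxDeviation (map ha hb) (direction ha) c n p ∂ν := by
        refine integral_mono_of_nonneg (Eventually.of_forall fun p => Nat.cast_nonneg _)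
          (integrable_maxDeviation (measurable_map ha hb) (measurable_direction ha) (C := 1 + |c|)
            (fun p => (abs_sub _ _).trans (add_le_add_left (abs_direction ha p) _)) n)
          (Eventually.of_forall fun p =>
            dip_le_of_forall (maxDeviation_nonneg _ _ _ _) fun k hk => ?_)
        have h3 := abs_birkhoffSum_le_maxDeviation (T := map ha hb) (direction ha) c hk p
        rw [direction_sum] at h3
        have h4 := neg_le_of_abs_le h3
        have h5 : 0 ≤ (k : ℝ) * c := by positivity
        linarith
      have h3 := mul_le_mul_of_nonneg_right h2 (Real.log_nonneg hm1)
      have h4 : shannon ν (word ha hb n) ≤ _ := h1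
      linarith
    · beta_reduce
      rw [Function.iterate_succ_apply', map_y_of_inl ha hb hi]
    · beta_reduce
      rw [Function.iterate_succ_apply', ← y_of_inr ha hb hi]
  · have h1 := shannon_word_le_of_const (μ := ν) (n := n)
      (u := fun p j => letter ha ((map ha hb)^[j] p)) hu (h.mono fun p hp j _ i hi =>
        (top_of_map_top ha hb (p := (map ha hb)^[j] p) (by
          rw [← Function.iterate_succ_apply' (map ha hb), hp])).2 i (Or.inr hi))
    have h4 : shannon ν (word ha hb n) ≤ _ := h1
    have := mul_nonneg hI0 (Real.log_nonneg hm1)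
    linarith

/-- If there are on average at most as many left as right brackets, then only the subscripts of
the right brackets contribute to the entropy. The orbit segments are read backwards. -/
theorem entropy_le_of_nonpos (hν : Ergodic (map ha hb) ν) (hc : ∫ p, direction ha p ∂ν ≤ 0) :
    entropy (map ha hb) ν ≤ ENNReal.ofReal (shannon ν fun p => forget (letter ha p).swap) := by
  have hm : 0 < m := by exact_mod_cast (pos_of_mem ha).1
  have hm1 : (1 : ℝ) ≤ m := by exact_mod_cast hm
  set c := ∫ p, direction ha p ∂ν with hcdef
  have hq : Measurable fun p => forget (letter ha p).swap :=
    (measurable_of_finite fun γ : Bracket m => forget γ.swap).comp (measurable_letter ha)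
  have hlim := (tendsto_integral_maxDeviation hν (measurable_direction ha)
    (abs_direction ha)).mul_const (2 * Real.log m)
  rw [zero_mul] at hlim
  refine entropy_le_of_word ha hb hν.toMeasurePreserving
    (e := fun n => (∫ p, maxDeviation (map ha hb) (direction ha) c n p ∂ν) * (2 * Real.log m))
    (hlim.congr fun n => by ring) fun n => ?_
  have hI0 : 0 ≤ ∫ p, maxDeviation (map ha hb) (direction ha) c n p ∂ν :=
    integral_nonneg fun p => maxDeviation_nonneg _ _ _ _
  have hforget := shannon_tuple_le_mul hν.toMeasurePreserving hq (n := n) fun j => n - 1 - j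
  have hu : ∀ j, Measurable fun p => (letter ha ((map ha hb)^[n - 1 - j] p)).swap := fun j =>
    (measurable_of_finite Sum.swap).comp (measurable_letter_iterate ha hb (n - 1 - j))
  -- reading a word backwards does not change its entropy
  have hrev : shannon ν (word ha hb n)
      ≤ shannon ν fun p (j : Fin n) => (letter ha ((map ha hb)^[n - 1 - j] p)).swap := by
    refine shannon_le_of_determined (measurable_pi_lambda _ fun j => hu j) (G := univ) (by simp)
      fun p _ q _ h => ?_
    funext j
    have := congrFun h ⟨n - 1 - j, by omega⟩
    simp only [show n - 1 - (n - 1 - (j : ℕ)) = j by omega] at this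
    exact Sum.swap_leftInverse.injective this
  have hidx : ∀ k < n, n - k = n - 1 - k + 1 := fun k hk => by omega
  rcases top_or hν with h | h
  · have h1 := shannon_word_le (μ := ν) hm (n := n)
      (u := fun p j => (letter ha ((map ha hb)^[n - 1 - j] p)).swap) hu
      (y := fun p j => ((map ha hb)^[n - j] p).1.2.1)
      (measurable_subtype_coe.comp ((measurable_map ha hb).iterate n)).snd.fst
      (h.mono fun p hp => ⟨fun k hk => ⟨fun i hi => ?_, fun i hi => ?_⟩, fun k _ => hp _⟩)
    · have h2 : ∫ p, (dip (fun j => sign (letter ha ((map ha hb)^[n - 1 - j] p)).swap) n : ℝ) ∂ν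
          ≤ ∫ p, 2 * maxDeviation (map ha hb) (direction ha) c n p ∂ν := by
        refine integral_mono_of_nonneg (Eventually.of_forall fun p => Nat.cast_nonneg _)
          ((integrable_maxDeviation (measurable_map ha hb) (measurable_direction ha) (C := 1 + |c|)
            (fun p => (abs_sub _ _).trans (add_le_add_left (abs_direction ha p) _)) n).const_mul 2)
          (Eventually.of_forall fun p => dip_le_of_forall
            (mul_nonneg zero_le_two (maxDeviation_nonneg _ _ _ _)) fun k hk => ?_)
        have h3 := abs_birkhoffSum_le_maxDeviation (T := map ha hb) (direction ha) c le_rfl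
          (n := n) p
        have h3' := abs_birkhoffSum_le_maxDeviation (T := map ha hb) (direction ha) c
          (Nat.sub_le n k) p
        rw [direction_sum] at h3 h3'
        have h4 := le_of_abs_le h3
        have h4' := neg_le_of_abs_le h3'
        have h5 : (k : ℝ) * c ≤ 0 := mul_nonpos_of_nonneg_of_nonpos (Nat.cast_nonneg k) hc
        have h6 : ∑ j ∈ Finset.range k, (sign (letter ha ((map ha hb)^[n - 1 - j] p)) : ℝ)
            + ∑ j ∈ Finset.range (n - k), (sign (letter ha ((map ha hb)^[j] p)) : ℝ)
            = ∑ j ∈ Finset.range n, (sign (letter ha ((map ha hb)^[j] p)) : ℝ) := by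
          set F : ℕ → ℝ := fun j => (sign (letter ha ((map ha hb)^[j] p)) : ℝ)
          have e1 := Finset.sum_range_add F (n - k) k
          have e2 := Finset.sum_range_reflect (fun j => F (n - k + j)) k
          have e3 : ∑ j ∈ Finset.range k, F (n - 1 - j)
              = ∑ j ∈ Finset.range k, F (n - k + (k - 1 - j)) :=
            Finset.sum_congr rfl fun j hj => by
              have := Finset.mem_range.1 hj
              congr 1
              omega
          rw [Nat.sub_add_cancel hk] at e1
          rw [e1, add_comm, e3, e2]
        simp only [sign_swap, Int.cast_neg, Finset.sum_neg_distrib, neg_neg]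
        rw [Nat.cast_sub hk] at h4'
        linarith
      rw [integral_const_mul] at h2
      have h3 := mul_le_mul_of_nonneg_right h2 (Real.log_nonneg hm1)
      linarith
    · have hi' : letter ha ((map ha hb)^[n - 1 - k] p) = Sum.inr i := by
        rw [← Sum.swap_swap (letter ha _)]; exact congrArg Sum.swap hi
      beta_reduce
      rw [show n - (k + 1) = n - 1 - k by omega, hidx k hk, Function.iterate_succ_apply',
        ← y_of_inr ha hb hi']
    · have hi' : letter ha ((map ha hb)^[n - 1 - k] p) = Sum.inl i := by
        rw [← Sum.swap_swap (letter ha _)]; exact congrArg Sum.swap hi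
      beta_reduce
      rw [show n - (k + 1) = n - 1 - k by omega, hidx k hk, Function.iterate_succ_apply',
        map_y_of_inl ha hb hi']
  · have h1 := shannon_word_le_of_const (μ := ν) (n := n)
      (u := fun p j => (letter ha ((map ha hb)^[n - 1 - j] p)).swap) hu (h.mono fun p hp j _ i hi =>
        (top_of_map_top ha hb (p := (map ha hb)^[n - 1 - j] p) (by
          rw [← Function.iterate_succ_apply' (map ha hb), hp])).2 i (Or.inl (by
            rw [← Sum.swap_swap (letter ha _)]; exact congrArg Sum.swap hi)))
    have := mul_nonneg hI0 (Real.log_nonneg hm1)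
    linarith

end Baker

/-! ### The entropies of the two measures and of their mean -/

namespace Baker
open Dyck Affine BernoulliShift Shannon Dynamics
variable {m : ℕ} {a b : ℝ} {ha : a ∈ Ioo (0 : ℝ) (1 / m)} {hb : b ∈ Ioo (0 : ℝ) (1 / m)}

/-- The part of the cube that consists of the pieces `Ω a (Sum.inl i)`. -/
def leftPart (m : ℕ) (a : ℝ) : Set cube := {p | p.1.1 < m * a}

lemma measurableSet_leftPart : MeasurableSet (leftPart m a) :=
  measurableSet_lt measurable_subtype_coe.fst measurable_const

lemma letter_eq_inl_iff {p : cube} : (∃ i, letter ha p = Sum.inl i) ↔ p ∈ leftPart m a := by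
  have h := mem_Ω_letter ha p
  rcases hl : letter ha p with i | i <;> rw [hl] at h
  · have hi : ((i : ℕ) : ℝ) + 1 ≤ m := by exact_mod_cast i.2
    simp only [Sum.inl.injEq, exists_eq', true_iff]
    exact h.2.2.trans_le (mul_le_mul_of_nonneg_right hi ha.1.le)
  · simp only [reduceCtorEq, exists_false, false_iff]
    exact not_lt.2 h.2.1

lemma letter_eq_inr_iff {p : cube} : (∃ i, letter ha p = Sum.inr i) ↔ p ∉ leftPart m a := by
  rw [← letter_eq_inl_iff (ha := ha)]
  rcases letter ha p with i | i <;> simp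

lemma setOf_mem_inl (ha : a ∈ Ioo (0 : ℝ) (1 / m)) :
    {p : cube | ∃ i : Fin m, (p : ℝ × ℝ × ℝ) ∈ Ω a (Sum.inl i)} = leftPart m a := by
  ext p
  rw [← letter_eq_inl_iff (ha := ha)]
  simp only [letter_eq_iff, mem_ofPred_eq]

lemma setOf_mem_inr (ha : a ∈ Ioo (0 : ℝ) (1 / m)) :
    {p : cube | ∃ i : Fin m, (p : ℝ × ℝ × ℝ) ∈ Ω a (Sum.inr i)} = (leftPart m a)ᶜ := by
  ext p
  rw [mem_compl_iff, ← letter_eq_inr_iff (ha := ha)]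
  simp only [letter_eq_iff, mem_ofPred_eq]

section Upper

variable {ν : Measure cube} [IsProbabilityMeasure ν]

theorem entropy_le_log (hν : Ergodic (map ha hb) ν) :
    entropy (map ha hb) ν ≤ ENNReal.ofReal (Real.log (m + 1)) := by
  rcases le_total 0 (∫ p, direction ha p ∂ν) with h | h
  · refine (entropy_le_of_nonneg hν h).trans (ENNReal.ofReal_le_ofReal ?_)
    refine (shannon_le_log_card
      ((measurable_of_finite forget).comp (measurable_letter ha))).trans_eq ?_
    simp
  · refine (entropy_le_of_nonpos hν h).trans (ENNReal.ofReal_le_ofReal ?_)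
    refine (shannon_le_log_card ((measurable_of_finite fun γ : Bracket m => forget γ.swap).comp
      (measurable_letter ha))).trans_eq ?_
    simp

theorem entropy_le_of_leftPart (hν : Ergodic (map ha hb) ν) :
    entropy (map ha hb) ν ≤ ENNReal.ofReal (Real.log 2
      + max (ν.real (leftPart m a)) (1 - ν.real (leftPart m a)) * Real.log m) := by
  have hm : 0 < m := by exact_mod_cast (pos_of_mem ha).1
  have hlog : 0 ≤ Real.log m := Real.log_natCast_nonneg m
  rcases le_total 0 (∫ p, direction ha p ∂ν) with h | h
  · refine (entropy_le_of_nonneg hν h).trans (ENNReal.ofReal_le_ofReal ?_)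
    refine (shannon_forget_le hm (measurable_letter ha)).trans ?_
    simp only [letter_eq_inl_iff]
    gcongr
    exact le_max_left _ _
  · refine (entropy_le_of_nonpos hν h).trans (ENNReal.ofReal_le_ofReal ?_)
    refine (shannon_forget_le hm ((measurable_of_finite Sum.swap).comp
      (measurable_letter ha))).trans ?_
    have h1 : {p | ∃ i, (Sum.swap ∘ letter ha) p = Sum.inl i} = (leftPart m a)ᶜ := by
      ext p
      rw [mem_compl_iff, ← letter_eq_inr_iff (ha := ha)]
      simp only [Function.comp, mem_ofPred_eq]
      rcases letter ha p with i | i <;> simp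
    rw [h1, probReal_compl_eq_one_sub measurableSet_leftPart]
    gcongr
    exact le_max_right _ _

end Upper

variable [NeZero m]

theorem entropy_muα (hm : 2 ≤ m) :
    entropy (map ha hb) (muα ha hb) = ENNReal.ofReal (Real.log (m + 1)) := by
  have := isProbabilityMeasure_muα (ha := ha) (hb := hb) hm
  exact le_antisymm (entropy_le_log (ergodic_muα hm))
    ((le_partitionEntropy (le_joinEntropy_muα hm)).trans (le_entropy measurable_pieces))

theorem entropy_muβ (hm : 2 ≤ m) :
    entropy (map ha hb) (muβ ha hb) = ENNReal.ofReal (Real.log (m + 1)) := by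
  have := isProbabilityMeasure_muβ (ha := ha) (hb := hb) hm
  exact le_antisymm (entropy_le_log (ergodic_muβ hm))
    ((le_partitionEntropy (le_joinEntropy_muβ hm)).trans (le_entropy measurable_pieces))

variable (ha hb) in
/-- The mean of the two ergodic measures of maximal entropy. -/
noncomputable def muMean : Measure cube := (2 : ENNReal)⁻¹ • (muα ha hb + muβ ha hb)

theorem isProbabilityMeasure_muMean (hm : 2 ≤ m) : IsProbabilityMeasure (muMean ha hb) := by
  have := isProbabilityMeasure_muα (ha := ha) (hb := hb) hm
  have := isProbabilityMeasure_muβ (ha := ha) (hb := hb) hm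
  refine ⟨?_⟩
  simp only [muMean, Measure.smul_apply, Measure.add_apply, measure_univ, smul_eq_mul]
  rw [one_add_one_eq_two, ENNReal.inv_mul_cancel two_ne_zero ENNReal.ofNat_ne_top]

theorem entropy_muMean (hm : 2 ≤ m) :
    entropy (map ha hb) (muMean ha hb) = ENNReal.ofReal (Real.log (m + 1)) := by
  have := isProbabilityMeasure_muα (ha := ha) (hb := hb) hm
  have := isProbabilityMeasure_muβ (ha := ha) (hb := hb) hm
  refine le_antisymm (entropy_half_add_le (measurable_map ha hb)
    (Real.log_nonneg (by linarith [(Nat.cast_nonneg m : (0 : ℝ) ≤ m)])) (entropy_muα hm).le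
    (entropy_muβ hm).le) ((le_partitionEntropy fun n => ?_).trans (le_entropy (measurable_pieces (ha := ha))))
  have h1 := le_joinEntropy_muα (ha := ha) (hb := hb) hm n
  have h2 := le_joinEntropy_muβ (ha := ha) (hb := hb) hm n
  have h3 := le_shannon_half_add (μ := muα ha hb) (ν := muβ ha hb)
    (itinerary (map ha hb) (pieces ha) n)
  rw [joinEntropy_eq_shannon] at h1 h2 ⊢
  exact le_trans (by linarith) h3

theorem measurePreserving_muMean (hm : 2 ≤ m) :
    MeasurePreserving (map ha hb) (muMean ha hb) (muMean ha hb) := by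
  refine ⟨measurable_map ha hb, ?_⟩
  rw [muMean, Measure.map_smul, Measure.map_add _ _ (measurable_map ha hb),
    (ergodic_muα hm).map_eq, (ergodic_muβ hm).map_eq]

lemma muα_leftPart (hm : 2 ≤ m) : (muα ha hb).real (leftPart m a) = m / (m + 1) := by
  rw [← setOf_mem_inl ha, muα_real hm]

lemma muβ_leftPart (hm : 2 ≤ m) : (muβ ha hb).real (leftPart m a) = 1 / (m + 1) := by
  have := isProbabilityMeasure_muβ (ha := ha) (hb := hb) hm
  have h := muβ_real (ha := ha) (hb := hb) hm
  rw [setOf_mem_inr ha, probReal_compl_eq_one_sub measurableSet_leftPart] at h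
  have h2 : (m : ℝ) + 1 ≠ 0 := by positivity
  have h3 : (m : ℝ) / (m + 1) = 1 - 1 / (m + 1) := by field_simp; ring
  linarith

lemma muMean_leftPart (hm : 2 ≤ m) : (muMean ha hb).real (leftPart m a) = 1 / 2 := by
  have := isProbabilityMeasure_muα (ha := ha) (hb := hb) hm
  have := isProbabilityMeasure_muβ (ha := ha) (hb := hb) hm
  rw [muMean, measureReal_half_add, muα_leftPart hm, muβ_leftPart hm, ← add_div,
    div_self (by positivity)]
  norm_num

theorem not_ergodic_muMean (hm : 2 ≤ m) : ¬ Ergodic (map ha hb) (muMean ha hb) := by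
  intro h
  have := isProbabilityMeasure_muα (ha := ha) (hb := hb) hm
  have := isProbabilityMeasure_muMean (ha := ha) (hb := hb) hm
  have hac : muα ha hb ≪ muMean ha hb := fun s hs => by
    simp only [muMean, Measure.smul_apply, Measure.add_apply, smul_eq_mul, mul_eq_zero,
      ENNReal.inv_eq_zero, ENNReal.ofNat_ne_top, false_or, add_eq_zero] at hs
    exact hs.1
  have heq := h.eq_of_absolutelyContinuous (ergodic_muα hm).toMeasurePreserving hac
  have h1 := muMean_leftPart (ha := ha) (hb := hb) hm
  rw [← heq, muα_leftPart hm, div_eq_div_iff (by positivity) two_ne_zero] at h1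
  have hm' : (2 : ℝ) ≤ m := by exact_mod_cast hm
  linarith

omit [NeZero m] in
lemma ne_of_mem_interior {p : cube} {γ : Bracket m} (h : (p : ℝ × ℝ × ℝ) ∈ interior (Ω a γ))
    (ha : a ∈ Ioo (0 : ℝ) (1 / m)) : p.1.1 ≠ m * a := by
  rw [interior_Ω ha] at h
  rcases γ with i | i
  · have hi : ((i : ℕ) : ℝ) + 1 ≤ m := by exact_mod_cast i.2
    exact (h.1.2.trans_le (mul_le_mul_of_nonneg_right hi ha.1.le)).ne
  · exact h.1.1.ne'

lemma muMean_frontier (hm : 2 ≤ m) : muMean ha hb (frontier (leftPart m a)) = 0 := by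
  have hms : MeasurableSet {p : cube | p.1.1 = m * a} :=
    (measurable_subtype_coe.fst : Measurable fun p : cube => p.1.1) (measurableSet_singleton _)
  refine measure_mono_null (frontier_lt_subset_eq
    (continuous_fst.comp continuous_subtype_val) continuous_const) ?_
  have h1 : muα ha hb {p | p.1.1 = m * a} = 0 := by
    rw [muα_eq hm, Measure.map_apply (measurable_pointα_fill a b) hms, measure_eq_zero_iff_ae_notMem]
    filter_upwards [ae_regular_fill hm] with η hη
    have h := (orbit_pointα (ha := ha) (hb := hb) hη 0).1
    rw [shiftBy_zero] at h
    exact ne_of_mem_interior h ha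
  have h2 : muβ ha hb {p | p.1.1 = m * a} = 0 := by
    rw [muβ_eq hm, Measure.map_apply (measurable_pointβ_rev_fill a b) hms,
      measure_eq_zero_iff_ae_notMem]
    filter_upwards [ae_regular_fill hm] with η hη
    have h := (orbit_pointβ (ha := ha) (hb := hb) hη 0).1
    rw [neg_zero, shiftBy_zero] at h
    exact ne_of_mem_interior h ha
  simp only [muMean, Measure.smul_apply, Measure.add_apply] at h1 h2 ⊢
  rw [h1, h2, add_zero, smul_zero]

/-- Ergodic measures close to the mean give the left part a mass close to `1 / 2`, so that their
entropy is hardly more than `log 2 + (log m) / 2`. -/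
theorem not_entropyApproachable (hm : 2 ≤ m) {μ : ProbabilityMeasure cube}
    (hμ : (μ : Measure cube) = muMean ha hb) : ¬ EntropyApproachable (map ha hb) μ := by
  rintro ⟨ν, hν, hlim, hent⟩
  have hm' : (2 : ℝ) ≤ m := by exact_mod_cast hm
  have h1 : Tendsto (fun n => (ν n : Measure cube).real (leftPart m a)) atTop (𝓝 (1 / 2)) := by
    have h2 := ProbabilityMeasure.tendsto_measure_of_null_frontier_of_tendsto' hlim
      (E := leftPart m a) (by rw [hμ]; exact muMean_frontier hm)
    have h3 := (ENNReal.tendsto_toReal (measure_ne_top _ _)).comp h2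
    rw [hμ] at h3
    rw [← muMean_leftPart (ha := ha) (hb := hb) hm]
    exact h3
  have h2 : Tendsto (fun n => ENNReal.ofReal (Real.log 2
      + max ((ν n : Measure cube).real (leftPart m a))
        (1 - (ν n : Measure cube).real (leftPart m a)) * Real.log m)) atTop
      (𝓝 (ENNReal.ofReal (Real.log 2 + max (1 / 2) (1 - 1 / 2) * Real.log m))) :=
    ENNReal.tendsto_ofReal ((((h1.max (h1.const_sub 1)).mul_const _)).const_add _)
  have h3 := liminf_le_liminf (f := atTop) (Eventually.of_forall fun n => entropy_le_of_leftPart (hν n))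
  rw [h2.liminf_eq] at h3
  have h4 := hent.trans h3
  rw [hμ, entropy_muMean hm, ENNReal.ofReal_le_ofReal_iff] at h4
  · have h5 : Real.log 2 + max (1 / 2) (1 - 1 / 2) * Real.log m = Real.log (4 * m) / 2 := by
      rw [show (4 : ℝ) * m = 2 ^ 2 * m by norm_num, Real.log_mul (by norm_num) (by positivity),
        Real.log_pow]
      norm_num
      ring
    have h6 : Real.log (4 * m) < Real.log ((m + 1) ^ 2) :=
      Real.log_lt_log (by positivity) (by nlinarith)
    rw [Real.log_pow] at h6
    push_cast at h6
    linarith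
  · have := Real.log_nonneg (show (1 : ℝ) ≤ 2 by norm_num)
    have := Real.log_nonneg (show (1 : ℝ) ≤ m by linarith)
    positivity

end Baker

/-! ### Periodic orbits that shadow both measures -/

namespace Baker
open Dyck Affine BernoulliShift Shannon Dynamics
variable {m : ℕ} {a b : ℝ}

/-- The sequence of period `2 n` that consists of the word `ω 0, …, ω (n - 1)` and its reversal. -/
def palindrome (ω : ℤ → Bracket m) (n : ℕ) (k : ℤ) : Bracket m :=
  if k % (2 * n) < n then ω (k % (2 * n)) else (ω (2 * n - 1 - k % (2 * n))).swap

/-- The stacks that belong to `palindrome ω n`. -/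
def palindromeStack (y : ℤ → ℝ) (n : ℕ) (k : ℤ) : ℝ :=
  y (min (k % (2 * n)) (2 * n - k % (2 * n)))

lemma palindrome_add_period (ω : ℤ → Bracket m) (n : ℕ) (k : ℤ) :
    palindrome ω n (k + 2 * n) = palindrome ω n k := by
  simp only [palindrome, Int.add_emod_right]

lemma palindrome_of_lt (ω : ℤ → Bracket m) {n : ℕ} {k : ℤ} (h0 : 0 ≤ k) (hk : k < n) :
    palindrome ω n k = ω k := by
  have : k % (2 * n) = k := Int.emod_eq_of_lt h0 (by omega)
  rw [palindrome, this, if_pos hk]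

lemma palindrome_of_le (ω : ℤ → Bracket m) {n : ℕ} {k : ℤ} (h0 : n ≤ k) (hk : k < 2 * n) :
    palindrome ω n k = (ω (2 * n - 1 - k)).swap := by
  have : k % (2 * n) = k := Int.emod_eq_of_lt (by omega) (by omega)
  rw [palindrome, this, if_neg (by omega)]

lemma isStackPath_palindrome {ω : ℤ → Bracket m} {y : ℤ → ℝ} (h : IsStackPath ω y) {n : ℕ}
    (hn : 0 < n) : IsStackPath (palindrome ω n) (palindromeStack y n) := by
  intro k
  have h2n : (0 : ℤ) < 2 * n := by omega
  have h0 := Int.emod_nonneg k h2n.ne'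
  have h1 := Int.emod_lt_of_pos k h2n
  have hsucc : (k + 1) % (2 * n) = if k % (2 * n) + 1 = 2 * n then 0 else k % (2 * n) + 1 := by
    split_ifs with hr
    · have : k + 1 = 2 * n * (k / (2 * n) + 1) := by
        have := Int.emod_add_mul_ediv k (2 * n); linarith
      rw [this, Int.mul_emod_right]
    · have : k + 1 = k % (2 * n) + 1 + 2 * n * (k / (2 * n)) := by
        have := Int.emod_add_mul_ediv k (2 * n); linarith
      rw [this, Int.add_mul_emod_self_left, Int.emod_eq_of_lt (by omega) (by omega)]
  unfold palindromeStack palindrome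
  rw [hsucc]
  generalize hr : k % (2 * (n : ℤ)) = r at *
  by_cases hrn : r < n
  · rw [if_pos hrn, if_neg (by omega), min_eq_left (by omega), min_eq_left (by omega)]
    exact h r
  · have e1 : min r (2 * n - r) = (2 * n - 1 - r) + 1 := by omega
    have e2 : min (if r + 1 = 2 * n then 0 else r + 1)
        (2 * n - if r + 1 = 2 * n then 0 else r + 1) = 2 * n - 1 - r := by
      split_ifs <;> omega
    rw [if_neg hrn, e1, e2]
    have hs := h (2 * n - 1 - r)
    refine ⟨fun i hi => hs.2 i ?_, fun i hi => hs.1 i ?_⟩ <;>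
    · rw [← Sum.swap_swap (ω _), hi]; rfl

lemma recurrent_palindrome (ω : ℤ → Bracket m) {n : ℕ} (hn : 0 < n) :
    Recurrent (palindrome ω n) := by
  have hper : ∀ (t k : ℤ), palindrome ω n (k + 2 * n * t) = palindrome ω n k := fun t k => by
    simp only [palindrome, Int.add_mul_emod_self_left]
  have h0 : palindrome ω n 0 = ω 0 := palindrome_of_lt ω le_rfl (by omega)
  have h1 : palindrome ω n (2 * n - 1) = (ω 0).swap := by
    rw [palindrome_of_le ω (by omega) (by omega), sub_self]
  have hl : ∃ k l, palindrome ω n k = Sum.inl l := by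
    rcases hω : ω 0 with i | i
    · exact ⟨0, i, by rw [h0, hω]⟩
    · exact ⟨2 * n - 1, i, by rw [h1, hω]; rfl⟩
  have hr : ∃ k l, palindrome ω n k = Sum.inr l := by
    rcases hω : ω 0 with i | i
    · exact ⟨2 * n - 1, i, by rw [h1, hω]; rfl⟩
    · exact ⟨0, i, by rw [h0, hω]⟩
  have hlate : ∀ k N : ℤ, ∃ t : ℤ, N ≤ k + 2 * n * t := fun k N =>
    ⟨|N - k|, by nlinarith [le_abs_self (N - k), abs_nonneg (N - k), (by omega : (1 : ℤ) ≤ 2 * n)]⟩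
  have hearly : ∀ k N : ℤ, ∃ t : ℤ, k + 2 * n * t ≤ N := fun k N =>
    ⟨-|N - k|, by
      nlinarith [neg_abs_le (N - k), abs_nonneg (N - k), (by omega : (1 : ℤ) ≤ 2 * n)]⟩
  obtain ⟨k, l, hk⟩ := hl
  obtain ⟨k', l', hk'⟩ := hr
  refine ⟨fun N => ?_, fun N => ?_, fun N => ?_, fun N => ?_⟩
  · obtain ⟨t, ht⟩ := hlate k N
    exact ⟨_, ht, l, by rw [hper, hk]⟩
  · obtain ⟨t, ht⟩ := hlate k' N
    exact ⟨_, ht, l', by rw [hper, hk']⟩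
  · obtain ⟨t, ht⟩ := hearly k N
    exact ⟨_, ht, l, by rw [hper, hk]⟩
  · obtain ⟨t, ht⟩ := hearly k' N
    exact ⟨_, ht, l', by rw [hper, hk']⟩

lemma coe_point_of_mem {v : ℝ × ℝ × ℝ} (hv : v ∈ cube) : (point v : ℝ × ℝ × ℝ) = v :=
  congrArg Subtype.val (point_coe ⟨v, hv⟩)

variable {ha : a ∈ Ioo (0 : ℝ) (1 / m)} {hb : b ∈ Ioo (0 : ℝ) (1 / m)}

lemma rate_nonneg (ha : a ∈ Ioo (0 : ℝ) (1 / m)) : 0 ≤ rate m a b :=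
  ha.1.le.trans ((le_max_left _ _).trans (le_max_left _ _))

/-- Points with itineraries that agree for `k` steps in the past and `l` steps in the future, and
with the same stack, are exponentially close. -/
lemma dist_point_le (ha : a ∈ Ioo (0 : ℝ) (1 / m)) (hb : b ∈ Ioo (0 : ℝ) (1 / m))
    {ω ω' : ℤ → Bracket m} {n n' : ℤ} {k l : ℕ}
    (hpast : ∀ j < k, past ω n j = past ω' n' j) (hfuture : ∀ j < l, future ω n j = future ω' n' j)
    {y : ℝ} (hy : y ∈ Ioo (0 : ℝ) 1) {q : cube}
    (hq : (q : ℝ × ℝ × ℝ) = (xCoord a ω n, y, zCoord b ω n)) :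
    dist q (point (xCoord a ω' n', y, zCoord b ω' n')) ≤ rate m a b ^ k + rate m a b ^ l := by
  have hmem : (xCoord a ω' n', y, zCoord b ω' n') ∈ cube :=
    ⟨(contracting_x ha hb).value_mem _, Ioo_subset_Icc_self hy, (contracting_z ha hb).value_mem _⟩
  have hθ := rate_nonneg (b := b) ha
  have h1 := (contracting_x ha hb).abs_value_sub_le hfuture
  have h2 := (contracting_z ha hb).abs_value_sub_le hpast
  have hk := pow_nonneg hθ k
  have hl := pow_nonneg hθ l
  rw [Subtype.dist_eq, coe_point_of_mem hmem, hq, Prod.dist_eq, Prod.dist_eq]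
  simp only [Real.dist_eq, sub_self, abs_zero, max_le_iff]
  refine ⟨?_, by positivity, ?_⟩
  · exact h1.trans (by linarith)
  · exact h2.trans (by linarith)

/-- The periodic orbit follows a typical orbit of the first measure, and then follows a typical
orbit of the second measure. -/
theorem exists_periodic_shadow (ha : a ∈ Ioo (0 : ℝ) (1 / m)) (hb : b ∈ Ioo (0 : ℝ) (1 / m))
    {ω : ℤ → Bracket m} (hω : Regular ω) {n : ℕ} (hn : 0 < n) :
    ∃ p : cube, Function.IsPeriodicPt (map ha hb) (2 * n) p ∧
      (∀ k < n, dist ((map ha hb)^[k] p) (pointα a b (shiftBy k ω))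
        ≤ rate m a b ^ k + rate m a b ^ (n - 1 - k)) ∧
      ∀ k < n, dist ((map ha hb)^[2 * n - 1 - k] p) (pointβ a b (rev (shiftBy (k + 1) ω)))
        ≤ rate m a b ^ k + rate m a b ^ (n - 1 - k) := by
  have hpath := isStackPath_palindrome hω.isStackPath hn
  have hstack : ∀ k, palindromeStack (yCoord ω) n k ∈ Ioo (0 : ℝ) 1 := fun k => hω.yCoord_mem _
  obtain ⟨q, hq, hstep⟩ := exists_orbit ha hb (recurrent_palindrome ω hn) hstack hpath
  have hθ := rate_nonneg (b := b) ha
  have hθ1 := (rate_lt_one ha hb).le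
  have hiter : ∀ k : ℕ, (map ha hb)^[k] (q 0) = q k := by
    intro k
    induction k with
    | zero => rfl
    | succ k ih => rw [Function.iterate_succ_apply', ih, (hstep k).2]; push_cast; rfl
  refine ⟨q 0, ?_, fun k hk => ?_, fun k hk => ?_⟩
  · refine (hiter _).trans (Subtype.ext ?_)
    rw [hq, hq]
    have e1 : future (palindrome ω n) ((2 * n : ℕ) : ℤ) = future (palindrome ω n) 0 := by
      funext j
      simp only [future]
      rw [← palindrome_add_period ω n (0 + j)]
      congr 1; push_cast; ring
    have e2 : past (palindrome ω n) ((2 * n : ℕ) : ℤ) = past (palindrome ω n) 0 := by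
      funext j
      simp only [past]
      rw [← palindrome_add_period ω n (0 - 1 - j)]
      congr 1; push_cast; ring
    have e3 : palindromeStack (yCoord ω) n ((2 * n : ℕ) : ℤ) = palindromeStack (yCoord ω) n 0 := by
      simp only [palindromeStack]
      push_cast
      rw [Int.emod_self, Int.zero_emod]
    rw [xCoord, zCoord, e1, e2, e3]
    rfl
  · have hy : palindromeStack (yCoord ω) n k = yCoord ω k := by
      have : (k : ℤ) % (2 * n) = k := Int.emod_eq_of_lt (by omega) (by omega)
      rw [palindromeStack, this, min_eq_left (by omega)]
    have hqk := hq k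
    rw [hy] at hqk
    rw [hiter, pointα_shiftBy]
    refine (dist_point_le ha hb (k := k) (l := n - k) (fun j hj => ?_) (fun j hj => ?_)
      (hω.yCoord_mem k) hqk).trans ?_
    · exact palindrome_of_lt ω (by omega) (by omega)
    · exact palindrome_of_lt ω (by omega) (by omega)
    · have := pow_le_pow_of_le_one hθ hθ1 (show n - 1 - k ≤ n - k by omega)
      linarith
  · have hc : ((2 * n - 1 - k : ℕ) : ℤ) = 2 * n - 1 - k := by omega
    have hy : palindromeStack (yCoord ω) n ((2 * n - 1 - k : ℕ) : ℤ) = yCoord ω (k + 1) := by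
      have : (2 * n - 1 - k : ℤ) % (2 * n) = 2 * n - 1 - k :=
        Int.emod_eq_of_lt (by omega) (by omega)
      rw [hc, palindromeStack, this]
      congr 1
      omega
    have hqk := hq ((2 * n - 1 - k : ℕ) : ℤ)
    rw [hy, hc] at hqk
    have hpt := pointβ_rev_shiftBy (a := a) (b := b) (-((k : ℤ) + 1)) ω
    rw [neg_neg] at hpt
    rw [hiter, hpt, hc]
    refine (dist_point_le ha hb (k := n - 1 - k) (l := k + 1) (fun j hj => ?_) (fun j hj => ?_)
      (hω.yCoord_mem _) hqk).trans ?_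
    · simp only [past, rev]
      rw [palindrome_of_le ω (by omega) (by omega)]
      congr 2; ring
    · simp only [future, rev]
      rw [palindrome_of_le ω (by omega) (by omega)]
      congr 2; ring
    · have := pow_le_pow_of_le_one hθ hθ1 (show k ≤ k + 1 by omega)
      linarith

end Baker

/-! ### Weak* convergence of periodic orbit measures -/

namespace Dynamics

section
variable {Ω ι : Type*} [MeasurableSpace Ω] {μ : Measure Ω} [IsProbabilityMeasure μ] {T : Ω → Ω}

/-- Some orbit segment is long and equidistributes well for finitely many given functions. -/
lemma exists_birkhoffAverage_near (hT : Ergodic T μ) (s : Finset ι) {g : ι → Ω → ℝ}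
    (hg : ∀ i, Measurable (g i)) (hC : ∀ i, ∃ C, ∀ x, |g i x| ≤ C) {G : Set Ω}
    (hG : ∀ᵐ x ∂μ, x ∈ G) {ε : ℝ} (hε : 0 < ε) (N : ℕ) :
    ∃ n > N, ∃ x ∈ G, ∀ i ∈ s, |birkhoffAverage ℝ T (g i) n x - ∫ y, g i y ∂μ| ≤ ε := by
  have hint : ∀ i n, Integrable (fun x => |birkhoffAverage ℝ T (g i) n x - ∫ y, g i y ∂μ|) μ := by
    intro i n
    obtain ⟨C, hC⟩ := hC i
    have hgi : Integrable (g i) μ :=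
      Integrable.of_bound (hg i).aestronglyMeasurable C (Eventually.of_forall hC)
    have h1 : Integrable (birkhoffAverage ℝ T (g i) n) μ := by
      have h2 : Integrable (fun x => ∑ k ∈ Finset.range n, g i (T^[k] x)) μ :=
        integrable_finsetSum _ fun k _ =>
          (hT.toMeasurePreserving.iterate k).integrable_comp_of_integrable hgi
      exact h2.smul (n : ℝ)⁻¹
    exact (h1.sub (integrable_const _)).abs
  have hlim : Tendsto (fun n => ∑ i ∈ s,
      ∫ x, |birkhoffAverage ℝ T (g i) n x - ∫ y, g i y ∂μ| ∂μ) atTop (𝓝 0) := by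
    have := tendsto_finsetSum s fun i _ => by
      obtain ⟨C, hC⟩ := hC i
      exact tendsto_integral_abs_birkhoffAverage_sub hT (hg i) hC
    simpa using this
  obtain ⟨n, hn1, hn2⟩ := ((hlim.eventually_le_const hε).and (eventually_gt_atTop N)).exists
  rw [← integral_finsetSum _ fun i _ => hint i n] at hn1
  obtain ⟨x, hxG, hx⟩ := exists_notMem_null_le_integral
    (integrable_finsetSum s fun i _ => hint i n) (ae_iff.1 hG)
  refine ⟨n, hn2, x, not_not.1 hxG, fun i hi => ?_⟩
  exact (Finset.single_le_sum (f := fun i => |birkhoffAverage ℝ T (g i) n x - ∫ y, g i y ∂μ|)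
    (fun i _ => abs_nonneg _) hi).trans (hx.trans hn1)

end

section
variable {X : Type*} [MetricSpace X] [CompactSpace X]

lemma abs_sub_le_add_mul_dist (φ : C(X, ℝ)) {ε : ℝ} (hε : 0 < ε) :
    ∃ K ≥ 0, ∀ x y, |φ x - φ y| ≤ ε + K * dist x y := by
  obtain ⟨δ, hδ, h⟩ := Metric.uniformContinuous_iff.1
    (CompactSpace.uniformContinuous_of_continuous φ.continuous) ε hε
  refine ⟨2 * ‖φ‖ / δ, by positivity, fun x y => ?_⟩
  by_cases hxy : dist x y < δ
  · have h1 := h hxy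
    rw [Real.dist_eq] at h1
    have : 0 ≤ 2 * ‖φ‖ / δ * dist x y := by positivity
    linarith
  · have h1 : |φ x - φ y| ≤ 2 * ‖φ‖ := by
      refine (abs_sub _ _).trans ?_
      have := φ.norm_coe_le_norm x
      have := φ.norm_coe_le_norm y
      rw [Real.norm_eq_abs] at *
      linarith
    have h2 : 2 * ‖φ‖ ≤ 2 * ‖φ‖ / δ * dist x y := by
      rw [div_mul_eq_mul_div, le_div_iff₀ hδ]
      exact mul_le_mul_of_nonneg_left (not_lt.1 hxy) (by positivity)
    linarith

/-- Orbit segments that approach each other exponentially away from their ends have almost the same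
Birkhoff sums. -/
lemma abs_sum_sub_sum_le (φ : C(X, ℝ)) {θ : ℝ} (hθ : 0 ≤ θ) (hθ1 : θ < 1) {ε : ℝ} (hε : 0 < ε) :
    ∃ M ≥ 0, ∀ (n : ℕ) (p q : ℕ → X), (∀ k < n, dist (p k) (q k) ≤ θ ^ k + θ ^ (n - 1 - k)) →
      |∑ k ∈ Finset.range n, φ (p k) - ∑ k ∈ Finset.range n, φ (q k)| ≤ n * ε + M := by
  obtain ⟨K, hK, h⟩ := abs_sub_le_add_mul_dist φ hε
  refine ⟨K * (2 * (1 - θ)⁻¹), mul_nonneg hK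
    (mul_nonneg zero_le_two (inv_nonneg.2 (sub_nonneg.2 hθ1.le))), fun n p q hpq => ?_⟩
  have hgeo : ∑ k ∈ Finset.range n, θ ^ k ≤ (1 - θ)⁻¹ := by
    rw [← tsum_geometric_of_lt_one hθ hθ1]
    exact (summable_geometric_of_lt_one hθ hθ1).sum_le_tsum _ fun k _ => pow_nonneg hθ k
  rw [← Finset.sum_sub_distrib]
  calc |∑ k ∈ Finset.range n, (φ (p k) - φ (q k))|
      ≤ ∑ k ∈ Finset.range n, |φ (p k) - φ (q k)| := Finset.abs_sum_le_sum_abs _ _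
    _ ≤ ∑ k ∈ Finset.range n, (ε + K * (θ ^ k + θ ^ (n - 1 - k))) :=
      Finset.sum_le_sum fun k hk => (h _ _).trans (add_le_add le_rfl
        (mul_le_mul_of_nonneg_left (hpq k (Finset.mem_range.1 hk)) hK))
    _ = n * ε + K * (∑ k ∈ Finset.range n, θ ^ k + ∑ k ∈ Finset.range n, θ ^ (n - 1 - k)) := by
      rw [Finset.sum_add_distrib, ← Finset.mul_sum, Finset.sum_add_distrib]
      simp
    _ ≤ _ := by
      rw [Finset.sum_range_reflect (fun k => θ ^ k) n]
      have := mul_le_mul_of_nonneg_left hgeo hK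
      linarith

variable [MeasurableSpace X] [BorelSpace X]

/-- Weak* convergence can be tested on a dense set of continuous functions. -/
lemma tendsto_of_denseRange {φ : ℕ → C(X, ℝ)} (hφ : DenseRange φ) {ν : ℕ → ProbabilityMeasure X}
    {μ : ProbabilityMeasure X} (h : ∀ j, Tendsto (fun n => ∫ x, φ j x ∂(ν n : Measure X)) atTop
      (𝓝 (∫ x, φ j x ∂(μ : Measure X)))) : Tendsto ν atTop (𝓝 μ) := by
  refine ProbabilityMeasure.tendsto_iff_forall_integral_tendsto.2 fun f => ?_
  have hint : ∀ (κ : ProbabilityMeasure X) (ψ : C(X, ℝ)), Integrable ψ (κ : Measure X) := fun κ ψ =>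
    Integrable.of_bound ψ.continuous.measurable.aestronglyMeasurable ‖ψ‖
      (Eventually.of_forall ψ.norm_coe_le_norm)
  rw [Metric.tendsto_atTop]
  intro ε hε
  obtain ⟨j, hj⟩ := hφ.exists_dist_lt f.toContinuousMap (show 0 < ε / 4 by positivity)
  have hclose : ∀ κ : ProbabilityMeasure X,
      |∫ x, f x ∂(κ : Measure X) - ∫ x, φ j x ∂(κ : Measure X)| ≤ ε / 4 := by
    intro κ
    have e := integral_sub (hint κ f.toContinuousMap) (hint κ (φ j))
    refine (congrArg abs e).symm.trans_le ?_
    have h1 := norm_integral_le_of_norm_le_const (μ := (κ : Measure X)) (C := ε / 4)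
      (f := fun x => f.toContinuousMap x - φ j x) (Eventually.of_forall fun x => by
        rw [← dist_eq_norm]
        exact (ContinuousMap.dist_apply_le_dist (f := f.toContinuousMap) (g := φ j) x).trans hj.le)
    rwa [probReal_univ, mul_one] at h1
  obtain ⟨N, hN⟩ := Metric.tendsto_atTop.1 (h j) (ε / 4) (by positivity)
  refine ⟨N, fun n hn => ?_⟩
  have h1 := hclose (ν n)
  have h2 := hclose μ
  have h3 := hN n hn
  rw [Real.dist_eq] at h3 ⊢
  rw [abs_le] at h1 h2
  rw [abs_lt] at h3 ⊢
  constructor <;> linarith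

end

section
variable {X : Type*} [MeasurableSpace X]

/-- The uniform distribution on the first `n` points of an orbit. -/
noncomputable def orbitMeasure (T : X → X) (p : X) (n : ℕ) : Measure X :=
  (n : ENNReal)⁻¹ • ∑ k ∈ Finset.range n, Measure.dirac (T^[k] p)

lemma isProbabilityMeasure_orbitMeasure (T : X → X) (p : X) {n : ℕ} (hn : 0 < n) :
    IsProbabilityMeasure (orbitMeasure T p n) := by
  refine ⟨?_⟩
  simp only [orbitMeasure, Measure.smul_apply, Measure.finsetSum_apply, measure_univ,
    Finset.sum_const, Finset.card_range, nsmul_eq_mul, mul_one, smul_eq_mul]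
  exact ENNReal.inv_mul_cancel (by exact_mod_cast hn.ne') (ENNReal.natCast_ne_top n)

lemma integral_orbitMeasure [MeasurableSingletonClass X] (T : X → X) (p : X) (n : ℕ) (f : X → ℝ) :
    ∫ x, f x ∂orbitMeasure T p n = (n : ℝ)⁻¹ * ∑ k ∈ Finset.range n, f (T^[k] p) := by
  rw [orbitMeasure, integral_smul_measure, integral_finsetSum_measure fun k _ => by
    exact integrable_dirac (by simp)]
  simp

end

end Dynamics

namespace Baker
open Dyck Affine BernoulliShift Shannon Dynamics
variable {m : ℕ} {a b : ℝ} {ha : a ∈ Ioo (0 : ℝ) (1 / m)} {hb : b ∈ Ioo (0 : ℝ) (1 / m)} [NeZero m]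

/-- A typical sequence provides a long palindromic periodic orbit whose first half equidistributes
with respect to the first, and whose second half with respect to the second measure. -/
theorem exists_periodic_near (hm : 2 ≤ m) (φ : ℕ → C(cube, ℝ)) (J : ℕ) :
    ∃ n > J, ∃ p q q' : ℕ → cube, Function.IsPeriodicPt (map ha hb) (2 * n) (p 0) ∧
      (∀ k, p k = (map ha hb)^[k] (p 0)) ∧
      (∀ k < n, dist (p k) (q k) ≤ rate m a b ^ k + rate m a b ^ (n - 1 - k)) ∧
      (∀ k < n, dist (p (2 * n - 1 - k)) (q' k) ≤ rate m a b ^ k + rate m a b ^ (n - 1 - k)) ∧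
      ∀ j ≤ J, |∑ k ∈ Finset.range n, φ j (q k) - n * ∫ x, φ j x ∂(muα ha hb)| ≤ n / (J + 1) ∧
        |∑ k ∈ Finset.range n, φ j (q' k) - n * ∫ x, φ j x ∂(muβ ha hb)| ≤ n / (J + 1) := by
  have herg : Ergodic (shiftBy 1) (Dyck.bernoulli (Fin m ⊕ Unit)) := ergodic_shiftBy _ one_ne_zero
  have hα := measurable_pointα_fill (m := m) a b
  have hβ := (measurable_pointβ_rev_fill (m := m) a b).comp (measurable_shiftBy 1)
  let g : ℕ × Bool → (ℤ → Fin m ⊕ Unit) → ℝ := fun i η =>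
    if i.2 then φ i.1 (pointα a b (fill η)) else φ i.1 (pointβ a b (rev (fill (shiftBy 1 η))))
  have hg : ∀ i, Measurable (g i) := by
    rintro ⟨j, c⟩
    cases c
    · exact (φ j).continuous.measurable.comp hβ
    · exact (φ j).continuous.measurable.comp hα
  have hC : ∀ i, ∃ C, ∀ η, |g i η| ≤ C := fun i => by
    refine ⟨‖φ i.1‖, fun η => ?_⟩
    simp only [g]
    split_ifs <;> exact (φ i.1).norm_coe_le_norm _
  obtain ⟨n, hn, η, hη, hnear⟩ := exists_birkhoffAverage_near herg
    (Finset.range (J + 1) ×ˢ (Finset.univ : Finset Bool)) hg hC (ae_regular_fill hm)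
    (show (0 : ℝ) < 1 / (J + 1) by positivity) J
  have hn0 : 0 < n := by omega
  have hn' : (0 : ℝ) < n := by exact_mod_cast hn0
  obtain ⟨p, hp, h1, h2⟩ := exists_periodic_shadow ha hb hη hn0
  have key : ∀ (c : ℝ) (S : ℝ), |(n : ℝ)⁻¹ * S - c| ≤ 1 / (J + 1) → |S - n * c| ≤ n / (J + 1) := by
    intro c S h
    have e : S - n * c = n * ((n : ℝ)⁻¹ * S - c) := by field_simp
    rw [e, abs_mul, abs_of_pos hn', div_eq_mul_one_div]
    exact mul_le_mul_of_nonneg_left h hn'.le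
  refine ⟨n, hn, fun k => (map ha hb)^[k] p, fun k => pointα a b (shiftBy k (fill η)),
    fun k => pointβ a b (rev (shiftBy (k + 1) (fill η))), hp, fun k => rfl, h1, h2,
    fun j hj => ⟨key _ _ ?_, key _ _ ?_⟩⟩
  · have h := hnear (j, true) (by simp; omega)
    have e : birkhoffAverage ℝ (shiftBy 1) (g (j, true)) n η
        = (n : ℝ)⁻¹ * ∑ k ∈ Finset.range n, φ j (pointα a b (shiftBy k (fill η))) := by
      refine congrArg ((n : ℝ)⁻¹ * ·) (Finset.sum_congr rfl fun k _ => ?_)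
      simp only [g, if_true, shiftBy_iterate, mul_one, fill_shiftBy]
    have hI : ∫ η, g (j, true) η ∂(Dyck.bernoulli (Fin m ⊕ Unit)) = ∫ x, φ j x ∂(muα ha hb) := by
      rw [muα_eq hm, integral_map hα.aemeasurable (φ j).continuous.measurable.aestronglyMeasurable]
      simp only [g, if_true]
    rw [← e, ← hI]
    exact h
  · have h := hnear (j, false) (by simp; omega)
    have e : birkhoffAverage ℝ (shiftBy 1) (g (j, false)) n η
        = (n : ℝ)⁻¹ * ∑ k ∈ Finset.range n, φ j (pointβ a b (rev (shiftBy (k + 1) (fill η)))) := by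
      refine congrArg ((n : ℝ)⁻¹ * ·) (Finset.sum_congr rfl fun k _ => ?_)
      have hshift : shiftBy 1 (shiftBy (k : ℤ) (fill η)) = shiftBy (k + 1) (fill η) := by
        funext i
        simp only [shiftBy]
        congr 1; ring
      simp only [g, Bool.false_eq_true, if_false, shiftBy_iterate, mul_one, hshift, fill_shiftBy]
    have hI : ∫ η, g (j, false) η ∂(Dyck.bernoulli (Fin m ⊕ Unit)) = ∫ x, φ j x ∂(muβ ha hb) := by
      have e : muβ ha hb = (Dyck.bernoulli (Fin m ⊕ Unit)).map
          ((fun η => pointβ a b (rev (fill η))) ∘ shiftBy 1) := by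
        rw [← Measure.map_map (measurable_pointβ_rev_fill a b) (measurable_shiftBy 1),
          show (Dyck.bernoulli (Fin m ⊕ Unit)).map (shiftBy 1) = _ from herg.map_eq, muβ_eq hm]
      rw [e, integral_map hβ.aemeasurable (φ j).continuous.measurable.aestronglyMeasurable]
      simp only [g, Bool.false_eq_true, if_false, Function.comp]
    rw [← e, ← hI]
    exact h

lemma integral_muMean (hm : 2 ≤ m) (φ : C(cube, ℝ)) : ∫ x, φ x ∂(muMean ha hb)
    = 2⁻¹ * (∫ x, φ x ∂(muα ha hb) + ∫ x, φ x ∂(muβ ha hb)) := by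
  have := isProbabilityMeasure_muα (ha := ha) (hb := hb) hm
  have := isProbabilityMeasure_muβ (ha := ha) (hb := hb) hm
  have hint : ∀ κ : Measure cube, IsProbabilityMeasure κ → Integrable φ κ := fun κ _ =>
    Integrable.of_bound φ.continuous.measurable.aestronglyMeasurable ‖φ‖
      (Eventually.of_forall φ.norm_coe_le_norm)
  rw [muMean, integral_smul_measure, integral_add_measure (hint _ ‹_›) (hint _ ‹_›)]
  simp

/-- The periodic orbits equidistribute with precision `1 / (J + 1)` for the first `J + 1` functions of
a dense sequence. -/
theorem exists_tendsto_periodic (hm : 2 ≤ m) {μ : ProbabilityMeasure cube}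
    (hμ : (μ : Measure cube) = muMean ha hb) :
    ∃ ν : ℕ → ProbabilityMeasure cube,
      (∀ n, IsPeriodicOrbitMeasure (map ha hb) (ν n : Measure cube)) ∧ Tendsto ν atTop (𝓝 μ) := by
  set φ : ℕ → C(cube, ℝ) := TopologicalSpace.denseSeq C(cube, ℝ) with hφ
  choose n hn p q q' hper hpk hq hq' hnear using
    fun J => exists_periodic_near (ha := ha) (hb := hb) hm φ J
  have hn0 : ∀ J, 0 < 2 * n J := fun J => by have := hn J; omega
  refine ⟨fun J => ⟨orbitMeasure (map ha hb) (p J 0) (2 * n J),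
    isProbabilityMeasure_orbitMeasure _ _ (hn0 J)⟩, fun J => ⟨p J 0, 2 * n J, hn0 J, hper J, rfl⟩,
    tendsto_of_denseRange (TopologicalSpace.denseRange_denseSeq C(cube, ℝ)) fun j => ?_⟩
  simp only [ProbabilityMeasure.coe_mk, ← hφ]
  rw [hμ, integral_muMean hm]
  set A := ∫ x, φ j x ∂(muα ha hb)
  set B := ∫ x, φ j x ∂(muβ ha hb)
  rw [Metric.tendsto_atTop]
  intro ε hε
  obtain ⟨M, hM, hsum⟩ := abs_sum_sub_sum_le (φ j) (rate_nonneg (b := b) ha) (rate_lt_one ha hb)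
    (half_pos hε)
  obtain ⟨N, hN⟩ := exists_nat_gt ((M + 1) / (ε / 2))
  refine ⟨max N j, fun J hJ => ?_⟩
  have hJN : (N : ℝ) ≤ J := by exact_mod_cast (le_max_left _ _).trans hJ
  have hJj : j ≤ J := (le_max_right _ _).trans hJ
  have hnJ : ((J : ℝ) + 1) ≤ n J := by exact_mod_cast hn J
  have hJ0 : (0 : ℝ) < (J : ℝ) + 1 := by positivity
  have hn' : (0 : ℝ) < n J := hJ0.trans_le hnJ
  obtain ⟨h1, h2⟩ := hnear J j hJj
  have h3 := hsum (n J) (p J) (q J) (hq J)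
  have h4 := hsum (n J) (fun k => p J (2 * n J - 1 - k)) (q' J) (hq' J)
  rw [integral_orbitMeasure]
  have hsplit : ∑ k ∈ Finset.range (2 * n J), φ j ((map ha hb)^[k] (p J 0))
      = ∑ k ∈ Finset.range (n J), φ j (p J k)
        + ∑ k ∈ Finset.range (n J), φ j (p J (2 * n J - 1 - k)) := by
    simp only [← hpk]
    rw [two_mul, Finset.sum_range_add, ← Finset.sum_range_reflect (fun k => φ j (p J (n J + k)))]
    congr 1
    refine Finset.sum_congr rfl fun k hk => ?_
    have := Finset.mem_range.1 hk
    congr 2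
    omega
  rw [hsplit]
  set S := ∑ k ∈ Finset.range (n J), φ j (p J k)
  set S' := ∑ k ∈ Finset.range (n J), φ j (p J (2 * n J - 1 - k))
  have hMJ : (M + 1) / (J + 1) < ε / 2 := by
    rw [div_lt_iff₀ hJ0]
    rw [div_lt_iff₀ (by positivity)] at hN
    nlinarith
  have hMn : M ≤ n J * (M / (J + 1)) := by
    rw [← mul_div_assoc, le_div_iff₀ hJ0, mul_comm]
    exact mul_le_mul_of_nonneg_right hnJ hM
  have e0 : (n J : ℝ) / (J + 1) = n J * (1 / (J + 1)) := by ring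
  rw [e0] at h1 h2
  have e1 : (M + 1) / ((J : ℝ) + 1) = M / (J + 1) + 1 / (J + 1) := by ring
  rw [e1] at hMJ
  have hlt : |S + S' - n J * (A + B)| < 2 * n J * ε := by
    have e2 := mul_lt_mul_of_pos_left hMJ hn'
    rw [mul_add] at e2
    rw [abs_le] at h1 h2 h3 h4
    rw [abs_lt]
    constructor <;> linarith
  have e3 : ((2 * n J : ℕ) : ℝ)⁻¹ * (S + S') - 2⁻¹ * (A + B)
      = (2 * n J : ℝ)⁻¹ * (S + S' - n J * (A + B)) := by
    push_cast
    field_simp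
  rw [Real.dist_eq, e3, abs_mul, abs_of_pos (by positivity), inv_mul_lt_iff₀ (by positivity)]
  exact hlt

end Baker

theorem theoremC (m : ℕ) (hm : 2 ≤ m) (a b : ℝ)
    (ha : a ∈ Ioo (0 : ℝ) (1 / m)) (hb : b ∈ Ioo (0 : ℝ) (1 / m))
    (hac : a ∈ Ioo (1 / ((m : ℝ) * (m + 1))) (1 / ((m : ℝ) + 1))) (hba : b ≤ a) :
    -- `μ_α` and `μ_β` are ergodic probability measures of entropy `log (m + 1)`
    IsProbabilityMeasure (Baker.muα ha hb) ∧ IsProbabilityMeasure (Baker.muβ ha hb) ∧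
    Ergodic (Baker.map ha hb) (Baker.muα ha hb) ∧ Ergodic (Baker.map ha hb) (Baker.muβ ha hb) ∧
    Dynamics.entropy (Baker.map ha hb) (Baker.muα ha hb) = ENNReal.ofReal (Real.log (m + 1)) ∧
    Dynamics.entropy (Baker.map ha hb) (Baker.muβ ha hb) = ENNReal.ofReal (Real.log (m + 1)) ∧
    (Baker.muα ha hb).real {p | ∃ i : Fin m, (p : ℝ × ℝ × ℝ) ∈ Baker.Ω a (Sum.inl i)}
      = m / (m + 1) ∧
    (Baker.muβ ha hb).real {p | ∃ i : Fin m, (p : ℝ × ℝ × ℝ) ∈ Baker.Ω a (Sum.inr i)}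
      = m / (m + 1) ∧
    -- their half and half combination `μ`
    ∃ μ : ProbabilityMeasure Baker.cube,
      (μ : Measure Baker.cube) = (2 : ENNReal)⁻¹ • (Baker.muα ha hb + Baker.muβ ha hb) ∧
      MeasurePreserving (Baker.map ha hb) (μ : Measure Baker.cube) (μ : Measure Baker.cube) ∧
      ¬ Ergodic (Baker.map ha hb) (μ : Measure Baker.cube) ∧
      Dynamics.entropy (Baker.map ha hb) (μ : Measure Baker.cube)
        = ENNReal.ofReal (Real.log (m + 1)) ∧
      Dynamics.Approachable (Baker.map ha hb) μ ∧
      (∃ ν : ℕ → ProbabilityMeasure Baker.cube,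
        (∀ n, Dynamics.IsPeriodicOrbitMeasure (Baker.map ha hb) (ν n : Measure Baker.cube)) ∧
        Tendsto ν atTop (𝓝 μ)) ∧
      ¬ Dynamics.EntropyApproachable (Baker.map ha hb) μ := by
  have : NeZero m := ⟨by omega⟩
  obtain ⟨ν, hν, hlim⟩ := Baker.exists_tendsto_periodic (ha := ha) (hb := hb) hm
    (μ := ⟨Baker.muMean ha hb, Baker.isProbabilityMeasure_muMean hm⟩) rfl
  exact ⟨Baker.isProbabilityMeasure_muα hm, Baker.isProbabilityMeasure_muβ hm,
    Baker.ergodic_muα hm, Baker.ergodic_muβ hm, Baker.entropy_muα hm, Baker.entropy_muβ hm,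
    Baker.muα_real hm, Baker.muβ_real hm,
    ⟨Baker.muMean ha hb, Baker.isProbabilityMeasure_muMean hm⟩, rfl,
    Baker.measurePreserving_muMean hm, Baker.not_ergodic_muMean hm, Baker.entropy_muMean hm,
    mem_closure_of_tendsto hlim
      (Eventually.of_forall fun n => (hν n).ergodic (Baker.measurable_map ha hb)),
    ⟨ν, hν, hlim⟩, Baker.not_entropyApproachable hm rfl⟩
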